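/- Let $n\ge 1$ be an integer, $p\in(1,\infty)$, $s\in(0,1)$ and $1\le\lambda\le\Lambda<\infty$. Let $K:\mathbb R^n\times\mathbb R^n\to[0,\infty)$ denote a measurable symmetric kernel, $K(x,y)=K(y,x)$, with $$\lambda\le K(x,y)\,|x-y|^{n+sp}\le\Lambda\qquad\text{for a.e. }(x,y)\in\mathbb R^n\times\mathbb R^n .$$ Let $W^{s,p}(\mathbb R^n)$ be the space of all $v\in L^p(\mathbb R^n)$ with $|v(x)-v(y)|\,|x-y|^{-n/p-s}\in L^p(\mathbb R^n\times\mathbb R^n)$, and for a bounded open set $\Omega\subset\mathbb R^n$ let $W^{s,p}_0(\Omega)$ be the set of those $v\in W^{s,p}(\mathbb R^n)$ that vanish a.e. in $\mathbb R^n\setminus\Omega$. Given $g\in W^{s,p}(\mathbb R^n)$, a function $u\in W^{s,p}(\mathbb R^n)$ is a weak subsolution (respectively supersolution) of the problem $\mathcal Lu=0$ in $\Omega$, $u=g$ in $\mathbb R^n\setminus\Omega$, if $(g-u)_-\in W^{s,p}_0(\Omega)$ (respectively $(g-u)_+\in W^{s,p}_0(\Omega)$) and $$\int_{\mathbb R^n}\int_{\mathbb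 R^n}K(x,y)|u(x)-u(y)|^{p-2}(u(x)-u(y))(\eta(x)-\eta(y))\,dx\,dy\le 0\quad(\text{respectively}\ \ge 0)$$ for every nonnegative $\eta\in W^{s,p}_0(\Omega)$; it is a weak solution if it is both. For $x_0\in\mathbb R^n$ and $R>0$ put $$\mathrm{Tail}(u;x_0,R)=\Big[R^{sp}\int_{\mathbb R^n\setminus B_R(x_0)}|u(x)|^{p-1}|x-x_0|^{-(n+sp)}\,dx\Big]^{1/(p-1)} .$$ **Theorem (Hölder continuity).** There are constants $\alpha\in(0,1]$ with $\alpha<sp/(p-1)$ and $c>0$, both depending only on $n,p,s,\lambda,\Lambda$, such that for every such kernel $K$, every bounded open $\Omega\subset\mathbb R^n$, every $g\in W^{s,p}(\mathbb R^n)$ and every weak solution $u\in W^{s,p}(\mathbb R^n)$ of the above problem the following holds. The function $u$ is locally Hölder continuous in $\Omega$: it agrees a.e. in $\Omega$ with a function that is Hölder continuous with exponent $\alpha$ on every compact subset of $\Omega$. Moreover, whenever $r>0$, $B_{2r}(x_0)\subset\Omega$ and $0<\varrho\le r$, $$\operatorname*{osc}_{B_\varrho(x_0)}u\le c\Big(\frac{\varrho}{r}\Big)^{\alpha}\Big[\mathrm{Tail}(u;x_0,r)+\Big(\frac{1}{|B_{2r}(x_0)|}\int_{B_{2r}(x_0)}|u|^p\,dx\Big)^{1/p}\Big],$$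 where $\operatorname{osc}_{B}u=\operatorname{ess\,sup}_{B}u-\operatorname{ess\,inf}_{B}u$. -/

import Mathlib

open MeasureTheory Set

noncomputable section

/-- The fractional Sobolev space `W^{s,p}(ℝⁿ)`: `v ∈ L^p(ℝⁿ)` and
`|v x - v y| / |x - y|^{n/p + s} ∈ L^p(ℝⁿ × ℝⁿ)`. -/
def FracSobolev (n : ℕ) (s p : ℝ) (v : EuclideanSpace ℝ (Fin n) → ℝ) : Prop :=
  MemLp v (ENNReal.ofReal p) volume ∧
  MemLp (fun z : EuclideanSpace ℝ (Fin n) × EuclideanSpace ℝ (Fin n) =>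
      |v z.1 - v z.2| / ‖z.1 - z.2‖ ^ ((n : ℝ) / p + s)) (ENNReal.ofReal p) volume

/-- The space `W₀^{s,p}(Ω)`: functions of `W^{s,p}(ℝⁿ)` that vanish a.e. outside `Ω`. -/
def FracSobolevZero (n : ℕ) (s p : ℝ) (Ω : Set (EuclideanSpace ℝ (Fin n)))
    (v : EuclideanSpace ℝ (Fin n) → ℝ) : Prop :=
  FracSobolev n s p v ∧ ∀ᵐ x, x ∉ Ω → v x = 0

/-- A nonnegative, symmetric, (Lebesgue) measurable kernel of order `(s, p)` with ellipticity
bounds `lam`, `Lam`. For real-valued functions, Lebesgue measurability is `AEMeasurable`. -/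
structure IsEllipticKernel (n : ℕ) (s p lam Lam : ℝ)
    (K : EuclideanSpace ℝ (Fin n) → EuclideanSpace ℝ (Fin n) → ℝ) : Prop where
  nonneg : ∀ x y, 0 ≤ K x y
  symm : ∀ x y, K x y = K y x
  measurable : AEMeasurable
    (fun z : EuclideanSpace ℝ (Fin n) × EuclideanSpace ℝ (Fin n) => K z.1 z.2) volume
  bounds : ∀ᵐ z : EuclideanSpace ℝ (Fin n) × EuclideanSpace ℝ (Fin n),
    lam ≤ K z.1 z.2 * ‖z.1 - z.2‖ ^ ((n : ℝ) + s * p) ∧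
      K z.1 z.2 * ‖z.1 - z.2‖ ^ ((n : ℝ) + s * p) ≤ Lam

/-- The form
`∬ K(x,y) |u(x)-u(y)|^{p-2} (u(x)-u(y)) (η(x)-η(y)) dx dy`.
For an elliptic kernel and `u, η ∈ W^{s,p}(ℝⁿ)` the integrand is absolutely integrable
(Hölder's inequality); where `u x = u y` it is `0` for every `p`. -/
def energyForm (n : ℕ) (p : ℝ)
    (K : EuclideanSpace ℝ (Fin n) → EuclideanSpace ℝ (Fin n) → ℝ)
    (u η : EuclideanSpace ℝ (Fin n) → ℝ) : ℝ :=
  ∫ z : EuclideanSpace ℝ (Fin n) × EuclideanSpace ℝ (Fin n),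
    K z.1 z.2 * |u z.1 - u z.2| ^ (p - 2) * (u z.1 - u z.2) * (η z.1 - η z.2)

/-- Weak subsolution of `L u = 0` in `Ω`, `u = g` outside `Ω`: `u ∈ W^{s,p}(ℝⁿ)`,
`(g - u)₋ ∈ W₀^{s,p}(Ω)`, and the form is `≤ 0` on nonnegative test functions. -/
structure IsWeakSubsolution (n : ℕ) (s p : ℝ)
    (K : EuclideanSpace ℝ (Fin n) → EuclideanSpace ℝ (Fin n) → ℝ)
    (Ω : Set (EuclideanSpace ℝ (Fin n))) (g u : EuclideanSpace ℝ (Fin n) → ℝ) : Prop where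
  mem : FracSobolev n s p u
  boundary : FracSobolevZero n s p Ω (fun x => max (-(g x - u x)) 0)
  test : ∀ η : EuclideanSpace ℝ (Fin n) → ℝ, FracSobolevZero n s p Ω η →
    (∀ᵐ x, 0 ≤ η x) → energyForm n p K u η ≤ 0

/-- Weak supersolution of `L u = 0` in `Ω`, `u = g` outside `Ω`: `u ∈ W^{s,p}(ℝⁿ)`,
`(g - u)₊ ∈ W₀^{s,p}(Ω)`, and the form is `≥ 0` on nonnegative test functions. -/
structure IsWeakSupersolution (n : ℕ) (s p : ℝ)
    (K : EuclideanSpace ℝ (Fin n) → EuclideanSpace ℝ (Fin n) → ℝ)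
    (Ω : Set (EuclideanSpace ℝ (Fin n))) (g u : EuclideanSpace ℝ (Fin n) → ℝ) : Prop where
  mem : FracSobolev n s p u
  boundary : FracSobolevZero n s p Ω (fun x => max (g x - u x) 0)
  test : ∀ η : EuclideanSpace ℝ (Fin n) → ℝ, FracSobolevZero n s p Ω η →
    (∀ᵐ x, 0 ≤ η x) → 0 ≤ energyForm n p K u η

/-- Weak solution: both a weak subsolution and a weak supersolution. -/
def IsWeakSolution (n : ℕ) (s p : ℝ)
    (K : EuclideanSpace ℝ (Fin n) → EuclideanSpace ℝ (Fin n) → ℝ)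
    (Ω : Set (EuclideanSpace ℝ (Fin n))) (g u : EuclideanSpace ℝ (Fin n) → ℝ) : Prop :=
  IsWeakSubsolution n s p K Ω g u ∧ IsWeakSupersolution n s p K Ω g u

/-- The nonlocal tail
`[R^{sp} ∫_{ℝⁿ \ B_R(x₀)} |v(x)|^{p-1} |x - x₀|^{-(n+sp)} dx]^{1/(p-1)}`;
the integral is finite for `v ∈ L^p(ℝⁿ)` and `R > 0`. -/
def nonlocalTail (n : ℕ) (s p : ℝ) (v : EuclideanSpace ℝ (Fin n) → ℝ)
    (x₀ : EuclideanSpace ℝ (Fin n)) (R : ℝ) : ℝ :=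
  (R ^ (s * p) * ∫ x in (Metric.ball x₀ R)ᶜ,
    |v x| ^ (p - 1) * ‖x - x₀‖ ^ (-((n : ℝ) + s * p))) ^ (1 / (p - 1))

/-- The (essential) oscillation `ess sup_S u - ess inf_S u`, as an extended real number, so that
an upper bound by a real number includes essential boundedness of `u` on `S`. -/
def essOsc {n : ℕ} (u : EuclideanSpace ℝ (Fin n) → ℝ)
    (S : Set (EuclideanSpace ℝ (Fin n))) : EReal :=
  essSup (fun x => (u x : EReal)) (volume.restrict S) -
    essInf (fun x => (u x : EReal)) (volume.restrict S)

end

/-!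
Interior Hölder regularity for weak solutions of nonlocal equations of `p`-Laplace type.

Testing the equation with `(u - k)₊ φᵖ`, where `φ` is a cut-off between two concentric balls,
gives a Caccioppoli inequality (`caccioppoli`). Its left-hand side contains the Gagliardo seminorm
of `(u - k)₊ φ` and also the mixed term
`∬ (u - k)₊(x) φ(x)ᵖ (u - k)₋(y)ᵖ⁻¹ |x - y|^{-(n+sp)}`, which has no analogue for local equations;
on the right are the local error of the cut-off and the tail of `(u - k)₊`.

The seminorm term is combined with the fractional Faber–Krahn inequality (`faber_krahn`): a function
vanishing on half of each ball of radius `t` satisfies `∫ |f|ᵖ ≤ C t^{sp} [f]ᵖ`, as one sees by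
integrating only over its zero set. This gain is all that De Giorgi's iteration requires, and no
Sobolev embedding is used. The iteration (`exists_le_of_small_excess`) bounds `u` from above on a
ball as soon as its excess over a level is small in `Lᵖ` on the doubled ball and has a small tail.

The mixed term replaces the logarithmic estimate or the isoperimetric inequality of the local
theory. Suppose `u ≤ k + h` on a ball and `u ≤ k` on half of a smaller one. At the level
`k + h - δh` the mixed term is at least a multiple of `h^{p-1} ∫ (u - (k + h - δh))₊`, while the
errors are of order `(δh)ᵖ`. Hence that integral is small, and the iteration improves the upper
bound by `δh/2` (`exists_growth`). Applying this to `u` or to `-u` contracts the oscillation by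
a factor `τ` when the radius shrinks by a factor `θ` (`exists_osc_step`). The tails beyond the
current upper and lower bounds are part of the induction hypothesis: shrinking the ball multiplies
the old tail by `θ^{sp}`, so it stays in control when `θ^{sp}` is small compared with `τ^{p-1}`,
and this is why the exponent `α = log τ / log θ` is less than `sp / (p - 1)`.

The representative is the upper envelope of `u`, which inherits every essential bound on a ball
around a point and agrees with `u` almost everywhere by Lebesgue differentiation.
-/

open MeasureTheory Set

noncomputable section

/-! ### Pointwise inequalities for the monotone nonlinearity -/

lemma abs_rpow_sub_two_mul_of_nonneg {p t : ℝ} (hp : 1 < p) (ht : 0 ≤ t) :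
    |t| ^ (p - 2) * t = t ^ (p - 1) := by
  rcases ht.eq_or_lt with rfl | h
  · rw [mul_zero, Real.zero_rpow (by linarith)]
  · rw [abs_of_pos h, ← Real.rpow_add_one h.ne']; congr 1; ring

lemma abs_abs_rpow_sub_two_mul {p : ℝ} (hp : 1 < p) (t : ℝ) :
    |(|t| ^ (p - 2) * t)| = |t| ^ (p - 1) := by
  rw [abs_mul, abs_of_nonneg (Real.rpow_nonneg (abs_nonneg t) _),
    ← abs_rpow_sub_two_mul_of_nonneg hp (abs_nonneg t), abs_abs]

lemma rpow_sub_one_mul_self {p t : ℝ} (hp : 1 < p) (ht : 0 ≤ t) : t ^ (p - 1) * t = t ^ p := by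
  rw [← Real.rpow_add_one' ht (by linarith)]; congr 1; ring

lemma rpow_add_le_two_rpow_mul {p a b : ℝ} (hp : 0 ≤ p) (ha : 0 ≤ a) (hb : 0 ≤ b) :
    (a + b) ^ p ≤ 2 ^ p * (a ^ p + b ^ p) := by
  have h1 : (a + b) ^ p ≤ (2 * max a b) ^ p :=
    Real.rpow_le_rpow (by positivity) (by linarith [le_max_left a b, le_max_right a b]) hp
  rw [Real.mul_rpow (by norm_num) (le_max_of_le_left ha)] at h1
  refine h1.trans (mul_le_mul_of_nonneg_left ?_ (by positivity))
  rcases max_cases a b with ⟨h, _⟩ | ⟨h, _⟩ <;> rw [h]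
  · linarith [Real.rpow_nonneg hb p]
  · linarith [Real.rpow_nonneg ha p]

/-- A form of Young's inequality with exponents `p / (p - 1)` and `p`. -/
lemma rpow_sub_one_mul_le {p t y : ℝ} (hp : 1 < p) (ht : 0 ≤ t) (hy : 0 ≤ y) :
    t ^ (p - 1) * y ≤ 1 / 2 * t ^ p + 2 ^ (p - 1) * y ^ p := by
  rcases le_total (2 * y) t with h | h
  · have := mul_le_mul_of_nonneg_left (by linarith : y ≤ 1 / 2 * t) (Real.rpow_nonneg ht (p - 1))
    have h2 := rpow_sub_one_mul_self hp ht
    have : 0 ≤ (2 : ℝ) ^ (p - 1) * y ^ p := by positivity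
    nlinarith
  · have h1 := Real.rpow_le_rpow ht h (by linarith : 0 ≤ p - 1)
    rw [Real.mul_rpow (by norm_num) hy] at h1
    have h2 := mul_le_mul_of_nonneg_right h1 hy
    rw [mul_assoc, rpow_sub_one_mul_self hp hy] at h2
    have : 0 ≤ t ^ p := by positivity
    linarith

lemma rpow_le_rpow_add_mul_abs_sub {p x y : ℝ} (hp : 1 < p) (hx : 0 ≤ x) (hy : 0 ≤ y) :
    x ^ p ≤ y ^ p + p * x ^ (p - 1) * |x - y| := by
  rcases le_total x y with h | h
  · have := Real.rpow_le_rpow hx h (by linarith : 0 ≤ p)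
    have : 0 ≤ p * x ^ (p - 1) * |x - y| := by positivity
    linarith
  · rcases hx.eq_or_lt with rfl | hx'
    · rw [Real.zero_rpow (by linarith)]; positivity
    · have h1 := one_add_mul_self_le_rpow_one_add (s := (y - x) / x) (p := p)
        (by rw [le_div_iff₀ hx']; linarith) hp.le
      have h2 : y ^ p = x ^ p * (1 + (y - x) / x) ^ p := by
        rw [← Real.mul_rpow hx]
        · congr 1; field_simp; ring
        · have : 1 + (y - x) / x = y / x := by field_simp; ring
          rw [this]; positivity
      have h3 : x ^ p * (1 + p * ((y - x) / x)) = x ^ p - p * x ^ (p - 1) * (x - y) := by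
        rw [← rpow_sub_one_mul_self hp hx]; field_simp; ring
      have h4 := mul_le_mul_of_nonneg_left h1 (Real.rpow_nonneg hx p)
      rw [abs_of_nonneg (by linarith)]
      linarith

/-- The constant multiplying the gain in the pointwise Caccioppoli inequalities. -/
def gainConst (p : ℝ) : ℝ := 2 ^ (-(p + 1))

/-- The constant multiplying the loss in the pointwise Caccioppoli inequalities. -/
def lossConst (p : ℝ) : ℝ := 1 + 2 ^ p * p ^ p

lemma gainConst_pos (p : ℝ) : 0 < gainConst p := by unfold gainConst; positivity

lemma gainConst_le (p : ℝ) (hp : 1 < p) : gainConst p ≤ 1 / 4 := by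
  unfold gainConst
  calc (2 : ℝ) ^ (-(p + 1)) ≤ 2 ^ (-2 : ℝ) :=
        Real.rpow_le_rpow_of_exponent_le (by norm_num) (by linarith)
    _ = 1 / 4 := by
        rw [Real.rpow_neg (by norm_num)]; norm_num

lemma two_le_lossConst (p : ℝ) (hp : 1 < p) : 2 ≤ lossConst p := by
  unfold lossConst
  have h1 : (1 : ℝ) ≤ 2 ^ p := Real.one_le_rpow (by norm_num) (by linarith)
  have h2 : (1 : ℝ) ≤ p ^ p := Real.one_le_rpow hp.le (by linarith)
  nlinarith

lemma test_difference_ge_of_le {p a b x y : ℝ} (hp : 1 < p) (hx : 0 ≤ x) (hy : 0 ≤ y)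
    (hba : b ≤ a) :
    gainConst p * (|max a 0 * x - max b 0 * y| ^ p +
        (max (-b) 0 ^ (p - 1) * (max a 0 * x ^ p) + max (-a) 0 ^ (p - 1) * (max b 0 * y ^ p))) -
      lossConst p * ((max a 0 ^ p + max b 0 ^ p) * |x - y| ^ p) ≤
    |a - b| ^ (p - 2) * (a - b) * (max a 0 * x ^ p - max b 0 * y ^ p) := by
  have hp0 : p ≠ 0 := by linarith
  have hp1 : p - 1 ≠ 0 := by linarith
  have hL := two_le_lossConst p hp
  have hG := gainConst_le p hp
  have hG0 := gainConst_pos p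
  rw [abs_rpow_sub_two_mul_of_nonneg hp (sub_nonneg.2 hba)]
  rcases le_or_gt a 0 with ha | ha
  · simp [max_eq_right ha, max_eq_right (hba.trans ha), Real.zero_rpow hp0]
  rcases le_or_gt b 0 with hb | hb
  · rw [max_eq_left ha.le, max_eq_right hb, max_eq_left (by linarith : 0 ≤ -b),
      max_eq_right (by linarith : -a ≤ 0)]
    simp only [zero_mul, sub_zero, mul_zero, add_zero, Real.zero_rpow hp0]
    rw [abs_of_nonneg (by positivity), Real.mul_rpow ha.le hx, ← rpow_sub_one_mul_self hp ha.le]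
    have h1 := Real.rpow_le_rpow ha.le (by linarith : a ≤ a - b) (by linarith : 0 ≤ p - 1)
    have h2 := Real.rpow_le_rpow (by linarith) (by linarith : -b ≤ a - b) (by linarith : 0 ≤ p - 1)
    have h3 : 0 ≤ a * x ^ p := by positivity
    have h1' := mul_le_mul_of_nonneg_right h1 h3
    have h2' := mul_le_mul_of_nonneg_right h2 h3
    have h5 : 0 ≤ lossConst p * (a ^ (p - 1) * a * |x - 0 * y| ^ p) := by positivity
    have h5' : 0 ≤ lossConst p * (a ^ (p - 1) * a * |x - y| ^ p) := by positivity
    have h6 : 0 ≤ (a - b) ^ (p - 1) * (a * x ^ p) := by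
      have : 0 ≤ a - b := by linarith
      positivity
    nlinarith
  · have hab : 0 ≤ a - b := by linarith
    rw [max_eq_left ha.le, max_eq_left hb.le, max_eq_right (by linarith : -b ≤ 0),
      max_eq_right (by linarith : -a ≤ 0)]
    simp only [Real.zero_rpow hp1, zero_mul, add_zero]
    set D := |x - y| with hD
    have hD0 : 0 ≤ D := abs_nonneg _
    have e1 := rpow_le_rpow_add_mul_abs_sub hp hy hx
    rw [abs_sub_comm, ← hD] at e1
    -- the test difference is bounded below by its value at the second cut-off
    have e2 : (a - b) * y ^ p - a * (p * y ^ (p - 1) * D) ≤ a * x ^ p - b * y ^ p := by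
      nlinarith
    have e3 := mul_le_mul_of_nonneg_left e2 (Real.rpow_nonneg hab (p - 1))
    have e4 := rpow_sub_one_mul_le hp (mul_nonneg hab hy) (by positivity : 0 ≤ p * a * D)
    rw [Real.mul_rpow hab hy] at e4
    have e5 : (a - b) ^ (p - 1) * ((a - b) * y ^ p - a * (p * y ^ (p - 1) * D)) =
        ((a - b) * y) ^ p - (a - b) ^ (p - 1) * y ^ (p - 1) * (p * a * D) := by
      rw [Real.mul_rpow hab hy, ← rpow_sub_one_mul_self hp hab]; ring
    have e6 : |a * x - b * y| ^ p ≤ 2 ^ p * (((a - b) * y) ^ p + (a * D) ^ p) := by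
      refine le_trans (Real.rpow_le_rpow (abs_nonneg _) ?_ (by linarith))
        (rpow_add_le_two_rpow_mul (by linarith) (by positivity) (by positivity))
      have : a * x - b * y = (a - b) * y + a * (x - y) := by ring
      rw [this]
      refine (abs_add_le _ _).trans (le_of_eq ?_)
      rw [abs_mul, abs_mul, abs_of_nonneg hab, abs_of_nonneg hy, abs_of_pos ha]
    have e7 : gainConst p * 2 ^ p = 1 / 2 := by
      unfold gainConst
      rw [← Real.rpow_add (by norm_num), show -(p + 1) + p = (-1 : ℝ) by ring, Real.rpow_neg_one]
      norm_num
    have e8 := mul_le_mul_of_nonneg_left e6 hG0.le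
    rw [← mul_assoc, e7, Real.mul_rpow ha.le hD0] at e8
    have e9 : (p * a * D) ^ p = p ^ p * (a ^ p * D ^ p) := by
      rw [Real.mul_rpow (by positivity) hD0, Real.mul_rpow (by positivity) ha.le]; ring
    rw [e9] at e4
    have e10 : (2 : ℝ) ^ (p - 1) ≤ 2 ^ p :=
      Real.rpow_le_rpow_of_exponent_le (by norm_num) (by linarith)
    have e11 : 0 ≤ a ^ p * D ^ p := by positivity
    have e12 : 0 ≤ lossConst p * (b ^ p * D ^ p) := by positivity
    have e13 : (2 : ℝ) ^ (p - 1) * (p ^ p * (a ^ p * D ^ p)) ≤ 2 ^ p * (p ^ p * (a ^ p * D ^ p)) :=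
      mul_le_mul_of_nonneg_right e10 (by positivity)
    rw [← Real.mul_rpow hab hy] at e4
    have e14 : lossConst p * ((a ^ p + b ^ p) * D ^ p) =
      a ^ p * D ^ p + 2 ^ p * (p ^ p * (a ^ p * D ^ p)) + lossConst p * (b ^ p * D ^ p) := by
      unfold lossConst; ring
    have e15 : (a - b) ^ (p - 1) * y ^ (p - 1) = ((a - b) * y) ^ (p - 1) :=
      (Real.mul_rpow hab hy).symm
    rw [e5, e15] at e3
    rw [e14]
    linarith

/-- Pointwise Caccioppoli inequality: testing the nonlinearity against `a₊ xᵖ - b₊ yᵖ` controls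
the difference of the localized truncations and the mixed term `b₋ᵖ⁻¹ a₊`, up to differences of
the cut-off. The mixed term is what makes the nonlocal growth lemma elementary. -/
lemma test_difference_ge {p a b x y : ℝ} (hp : 1 < p) (hx : 0 ≤ x) (hy : 0 ≤ y) :
    gainConst p * (|max a 0 * x - max b 0 * y| ^ p + max (-b) 0 ^ (p - 1) * (max a 0 * x ^ p)) -
      lossConst p * ((max a 0 ^ p + max b 0 ^ p) * |x - y| ^ p) ≤
    |a - b| ^ (p - 2) * (a - b) * (max a 0 * x ^ p - max b 0 * y ^ p) := by
  have hG0 := gainConst_pos p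
  rcases le_total b a with h | h
  · refine le_trans ?_ (test_difference_ge_of_le hp hx hy h)
    have : 0 ≤ gainConst p * (max (-a) 0 ^ (p - 1) * (max b 0 * y ^ p)) := by positivity
    linarith
  · have := test_difference_ge_of_le hp hy hx h
    have h2 : 0 ≤ gainConst p * (max (-a) 0 ^ (p - 1) * (max b 0 * y ^ p)) := by positivity
    rw [abs_sub_comm (max b 0 * y), abs_sub_comm y x, abs_sub_comm b a] at this
    linarith

/-- Far-field version of `test_difference_ge`: one of the two points is off the
support of the cut-off. -/
lemma test_value_ge {p a b x : ℝ} (hp : 1 < p) (hx : 0 ≤ x) :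
    gainConst p * ((max a 0 * x) ^ p + max (-b) 0 ^ (p - 1) * (max a 0 * x ^ p)) -
      lossConst p * (max b 0 ^ (p - 1) * (max a 0 * x ^ p)) ≤
    |a - b| ^ (p - 2) * (a - b) * (max a 0 * x ^ p) := by
  have hp0 : p ≠ 0 := by linarith
  have hp1 : p - 1 ≠ 0 := by linarith
  have hp1' : 0 ≤ p - 1 := by linarith
  have hL := two_le_lossConst p hp
  have hG := gainConst_le p hp
  have hG0 := gainConst_pos p
  rw [Real.mul_rpow (le_max_right _ _) hx, ← rpow_sub_one_mul_self hp (le_max_right a 0)]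
  rcases le_or_gt a 0 with ha | ha
  · simp [max_eq_right ha]
  have hX : 0 ≤ max a 0 * x ^ p := by positivity
  suffices h : gainConst p * (max a 0 ^ (p - 1) + max (-b) 0 ^ (p - 1)) -
      lossConst p * max b 0 ^ (p - 1) ≤ |a - b| ^ (p - 2) * (a - b) by
    have := mul_le_mul_of_nonneg_right h hX
    linarith
  rw [max_eq_left ha.le]
  rcases le_or_gt b 0 with hb | hb
  · rw [max_eq_right hb, max_eq_left (by linarith : 0 ≤ -b), Real.zero_rpow hp1,
      abs_rpow_sub_two_mul_of_nonneg hp (by linarith)]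
    have h1 := Real.rpow_le_rpow ha.le (by linarith : a ≤ a - b) hp1'
    have h2 := Real.rpow_le_rpow (by linarith) (by linarith : -b ≤ a - b) hp1'
    have h3 : 0 ≤ (a - b) ^ (p - 1) := Real.rpow_nonneg (by linarith) _
    nlinarith
  · rw [max_eq_left hb.le, max_eq_right (by linarith : -b ≤ 0), Real.zero_rpow hp1, add_zero]
    rcases le_or_gt (2 * b) a with h | h
    · rw [abs_rpow_sub_two_mul_of_nonneg hp (by linarith)]
      have h1 := Real.rpow_le_rpow (by linarith) (by linarith : a / 2 ≤ a - b) hp1'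
      rw [Real.div_rpow ha.le (by norm_num)] at h1
      have h2 : gainConst p * a ^ (p - 1) ≤ a ^ (p - 1) / 2 ^ (p - 1) := by
        rw [div_eq_inv_mul]
        refine mul_le_mul_of_nonneg_right ?_ (by positivity)
        rw [← Real.rpow_neg (by norm_num), gainConst]
        exact Real.rpow_le_rpow_of_exponent_le (by norm_num) (by linarith)
      have h3 : 0 ≤ lossConst p * b ^ (p - 1) := by positivity
      linarith
    · have h1 := Real.rpow_le_rpow ha.le h.le hp1'
      rw [Real.mul_rpow (by norm_num) hb.le] at h1
      have h2 : gainConst p * a ^ (p - 1) ≤ b ^ (p - 1) := by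
        refine (mul_le_mul_of_nonneg_left h1 hG0.le).trans ?_
        rw [← mul_assoc]
        refine mul_le_of_le_one_left (by positivity) ?_
        rw [gainConst, ← Real.rpow_add (by norm_num)]
        exact Real.rpow_le_one_of_one_le_of_nonpos (by norm_num) (by linarith)
      have h3 : 0 ≤ b ^ (p - 1) := by positivity
      have h4 : -b ^ (p - 1) ≤ |a - b| ^ (p - 2) * (a - b) := by
        rcases le_total b a with h | h
        · rw [abs_rpow_sub_two_mul_of_nonneg hp (by linarith)]
          have : 0 ≤ (a - b) ^ (p - 1) := Real.rpow_nonneg (by linarith) _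
          linarith
        · have := abs_rpow_sub_two_mul_of_nonneg hp (by linarith : 0 ≤ b - a)
          rw [abs_sub_comm] at this
          have h5 := Real.rpow_le_rpow (by linarith) (by linarith : b - a ≤ b) hp1'
          linarith
      nlinarith

/-! ### Integrals of the homogeneous kernel -/

/-- The truncated kernel `min(1, L|x - y|)ᵖ |x - y|^{-(n+sp)}` has integral at most a multiple
of `L^{sp}`; this bounds both the local error caused by a Lipschitz cut-off and the mass of the
kernel away from the diagonal. -/
lemma exists_lintegral_truncated_kernel_le (n : ℕ) (hn : 1 ≤ n) (p s : ℝ) (hp : 1 < p)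
    (hs0 : 0 < s) (hs1 : s < 1) :
    ∃ C : ℝ, 1 ≤ C ∧ ∀ L : ℝ, 0 < L → ∀ x : EuclideanSpace ℝ (Fin n),
      ∫⁻ y, ENNReal.ofReal (min 1 (L * ‖x - y‖) ^ p * ‖x - y‖ ^ (-(n + s * p))) ≤
        ENNReal.ofReal (C * L ^ (s * p)) := by
  have : Nonempty (Fin n) := ⟨⟨0, hn⟩⟩
  have hsp : 0 < s * p := by positivity
  set F : ℝ → ℝ := fun t => min 1 t ^ p * t ^ (-(n + s * p)) with hF
  have hFm : Measurable F := by fun_prop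
  have hint : Integrable (fun z : EuclideanSpace ℝ (Fin n) => F ‖z‖) volume := by
    rw [integrable_fun_norm_addHaar, finrank_euclideanSpace_fin, ← Ioc_union_Ioi_eq_Ioi zero_le_one]
    refine IntegrableOn.union ?_ ?_
    · have h1 : IntegrableOn (fun t : ℝ => t ^ (p - s * p - 1)) (Ioc 0 1) volume := by
        rw [← intervalIntegrable_iff_integrableOn_Ioc_of_le zero_le_one]
        exact intervalIntegral.intervalIntegrable_rpow' (by nlinarith)
      refine h1.congr_fun (fun t ht => ?_) measurableSet_Ioc
      simp only [hF, smul_eq_mul, min_eq_right ht.2]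
      rw [← Real.rpow_natCast, ← Real.rpow_add ht.1, ← Real.rpow_add ht.1, Nat.cast_sub hn]
      congr 1; push_cast; ring
    · have h1 : IntegrableOn (fun t : ℝ => t ^ (-(s * p) - 1)) (Ioi 1) volume :=
        integrableOn_Ioi_rpow_of_lt (by linarith) one_pos
      refine h1.congr_fun (fun t ht => ?_) measurableSet_Ioi
      have ht' : (1 : ℝ) < t := ht
      have ht0 : (0 : ℝ) < t := by linarith
      simp only [hF, smul_eq_mul, min_eq_left ht'.le, Real.one_rpow, one_mul]
      rw [← Real.rpow_natCast, ← Real.rpow_add ht0, Nat.cast_sub hn]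
      congr 1; push_cast; ring
  have hFnn : ∀ z : EuclideanSpace ℝ (Fin n), 0 ≤ F ‖z‖ := fun z => by
    have : 0 ≤ min 1 ‖z‖ := le_min zero_le_one (norm_nonneg _)
    simp only [hF]; positivity
  refine ⟨max 1 (∫ z : EuclideanSpace ℝ (Fin n), F ‖z‖), le_max_left _ _, fun L hL x => ?_⟩
  have h1 : ∀ t : ℝ, 0 ≤ t → min 1 (L * t) ^ p * t ^ (-(n + s * p)) =
      L ^ (n + s * p) * F (L * t) := fun t ht => by
    simp only [hF]
    rw [Real.mul_rpow hL.le ht, Real.rpow_neg hL.le]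
    have : L ^ (n + s * p) ≠ 0 := by positivity
    field_simp
  have h2 : ∫⁻ y, ENNReal.ofReal (min 1 (L * ‖x - y‖) ^ p * ‖x - y‖ ^ (-(n + s * p))) =
      ∫⁻ z : EuclideanSpace ℝ (Fin n), ENNReal.ofReal (L ^ (n + s * p) * F (L * ‖z‖)) := by
    rw [← lintegral_sub_left_eq_self _ x]
    refine lintegral_congr fun y => ?_
    rw [h1 _ (norm_nonneg _), sub_sub_cancel]
  have h3 : ∀ z : EuclideanSpace ℝ (Fin n), F (L * ‖z‖) = F ‖L • z‖ := fun z => by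
    rw [norm_smul, Real.norm_of_nonneg hL.le]
  have h4 : ∫⁻ z : EuclideanSpace ℝ (Fin n), ENNReal.ofReal (F (L * ‖z‖)) =
      ENNReal.ofReal (L ^ (-(n : ℝ)) * ∫ z : EuclideanSpace ℝ (Fin n), F ‖z‖) := by
    simp_rw [h3]
    rw [← ofReal_integral_eq_lintegral_ofReal ((integrable_comp_smul_iff volume
      (fun z : EuclideanSpace ℝ (Fin n) => F ‖z‖) hL.ne').2 hint)
      (Filter.Eventually.of_forall fun z => hFnn _)]
    rw [Measure.integral_comp_smul volume (fun z : EuclideanSpace ℝ (Fin n) => F ‖z‖),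
      finrank_euclideanSpace_fin, abs_of_pos (by positivity), smul_eq_mul, Real.rpow_neg hL.le,
      Real.rpow_natCast]
  rw [h2]
  simp_rw [ENNReal.ofReal_mul (Real.rpow_nonneg hL.le (n + s * p))]
  rw [lintegral_const_mul' _ _ ENNReal.ofReal_ne_top, h4, ← ENNReal.ofReal_mul (by positivity)]
  refine ENNReal.ofReal_le_ofReal ?_
  have h5 : L ^ (n + s * p) * (L ^ (-(n : ℝ)) * ∫ z : EuclideanSpace ℝ (Fin n), F ‖z‖) =
      (∫ z : EuclideanSpace ℝ (Fin n), F ‖z‖) * L ^ (s * p) := by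
    rw [← mul_assoc, ← Real.rpow_add hL, mul_comm]; congr 2; ring
  rw [h5]
  exact mul_le_mul_of_nonneg_right (le_max_right _ _) (by positivity)

/-! ### Truncations, cut-offs and test functions -/

/-- The positive part `(u - k)₊` of the excess of `u` over the level `k`. -/
def excess {α : Type*} (u : α → ℝ) (k : ℝ) (x : α) : ℝ := max (u x - k) 0

lemma excess_nonneg {α : Type*} (u : α → ℝ) (k : ℝ) (x : α) : 0 ≤ excess u k x := le_max_right _ _

lemma excess_le {α : Type*} (u : α → ℝ) (k : ℝ) (x : α) : excess u k x ≤ |u x| + |k| :=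
  max_le ((le_abs_self _).trans (abs_sub _ _)) (by positivity)

@[fun_prop]
lemma Measurable.excess {α : Type*} [MeasurableSpace α] {u : α → ℝ} (hu : Measurable u) (k : ℝ) :
    Measurable (excess u k) := by unfold _root_.excess; fun_prop

/-- The homogeneous kernel `|x - y|^{-(n+sp)}`, with value `0` on the diagonal, a null set. -/
def homKernel (n : ℕ) (s p : ℝ) (z : EuclideanSpace ℝ (Fin n) × EuclideanSpace ℝ (Fin n)) : ℝ :=
  ‖z.1 - z.2‖ ^ (-(n + s * p))

/-- The kernel `min(1, L|x - y|)ᵖ |x - y|^{-(n+sp)}`, integrable in each variable. -/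
def truncKernel (n : ℕ) (s p L : ℝ)
    (z : EuclideanSpace ℝ (Fin n) × EuclideanSpace ℝ (Fin n)) : ℝ :=
  min 1 (L * ‖z.1 - z.2‖) ^ p * ‖z.1 - z.2‖ ^ (-(n + s * p))

lemma homKernel_nonneg (n : ℕ) (s p : ℝ) (z) : 0 ≤ homKernel n s p z := by
  unfold homKernel; positivity

@[fun_prop]
lemma measurable_homKernel (n : ℕ) (s p : ℝ) : Measurable (homKernel n s p) := by
  unfold homKernel; fun_prop

lemma truncKernel_nonneg (n : ℕ) (s p : ℝ) {L : ℝ} (hL : 0 ≤ L) (z) :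
    0 ≤ truncKernel n s p L z := by
  have : 0 ≤ min 1 (L * ‖z.1 - z.2‖) := by positivity
  unfold truncKernel; positivity

@[fun_prop]
lemma measurable_truncKernel (n : ℕ) (s p L : ℝ) : Measurable (truncKernel n s p L) := by
  unfold truncKernel; fun_prop

lemma truncKernel_swap (n : ℕ) (s p L : ℝ) (z) :
    truncKernel n s p L z.swap = truncKernel n s p L z := by
  simp [truncKernel, norm_sub_rev]

/-- The constant `C` bounds the truncated kernels in each variable, uniformly in the scale. -/
def IsKernelConst (n : ℕ) (s p C : ℝ) : Prop :=
  1 ≤ C ∧ ∀ L : ℝ, 0 < L → ∀ x : EuclideanSpace ℝ (Fin n),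
    ∫⁻ y, ENNReal.ofReal (truncKernel n s p L (x, y)) ≤ ENNReal.ofReal (C * L ^ (s * p))

lemma integrable_mul_truncKernel_fst {n : ℕ} {s p C L : ℝ} (hC : IsKernelConst n s p C) (hL : 0 < L)
    {v : EuclideanSpace ℝ (Fin n) → ℝ} (hv : Measurable v) (hv0 : ∀ x, 0 ≤ v x)
    (hvi : Integrable v) :
    Integrable (fun z => v z.1 * truncKernel n s p L z) ∧
      ∫ z, v z.1 * truncKernel n s p L z ≤ C * L ^ (s * p) * ∫ x, v x := by
  have hC0 : 0 ≤ C := zero_le_one.trans hC.1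
  have hm : Measurable (fun z => v z.1 * truncKernel n s p L z) := by fun_prop
  have hnn : ∀ z, 0 ≤ v z.1 * truncKernel n s p L z :=
    fun z => mul_nonneg (hv0 _) (truncKernel_nonneg n s p hL.le z)
  have key : ∫⁻ z, ENNReal.ofReal (v z.1 * truncKernel n s p L z) ≤
      ENNReal.ofReal (C * L ^ (s * p) * ∫ x, v x) := by
    rw [Measure.volume_eq_prod, lintegral_prod _ (by fun_prop)]
    calc ∫⁻ x, ∫⁻ y, ENNReal.ofReal (v x * truncKernel n s p L (x, y))
        ≤ ∫⁻ x, ENNReal.ofReal (v x) * ENNReal.ofReal (C * L ^ (s * p)) := by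
          refine lintegral_mono fun x => ?_
          simp_rw [ENNReal.ofReal_mul (hv0 x)]
          rw [lintegral_const_mul' _ _ ENNReal.ofReal_ne_top]
          gcongr
          exact hC.2 L hL x
      _ = ENNReal.ofReal (C * L ^ (s * p) * ∫ x, v x) := by
          rw [lintegral_mul_const' _ _ ENNReal.ofReal_ne_top,
            ← ofReal_integral_eq_lintegral_ofReal hvi (Filter.Eventually.of_forall hv0),
            ← ENNReal.ofReal_mul (integral_nonneg hv0), mul_comm]
  have hint : Integrable (fun z => v z.1 * truncKernel n s p L z) :=
    (lintegral_ofReal_ne_top_iff_integrable hm.aestronglyMeasurable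
      (Filter.Eventually.of_forall hnn)).1 (key.trans_lt ENNReal.ofReal_lt_top).ne
  refine ⟨hint, ?_⟩
  rw [← ofReal_integral_eq_lintegral_ofReal hint (Filter.Eventually.of_forall hnn)] at key
  exact (ENNReal.ofReal_le_ofReal_iff
    (mul_nonneg (by positivity) (integral_nonneg hv0))).1 key

lemma integrable_mul_truncKernel_snd {n : ℕ} {s p C L : ℝ} (hC : IsKernelConst n s p C) (hL : 0 < L)
    {v : EuclideanSpace ℝ (Fin n) → ℝ} (hv : Measurable v) (hv0 : ∀ x, 0 ≤ v x)
    (hvi : Integrable v) :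
    Integrable (fun z => v z.2 * truncKernel n s p L z) ∧
      ∫ z, v z.2 * truncKernel n s p L z ≤ C * L ^ (s * p) * ∫ x, v x := by
  obtain ⟨h1, h2⟩ := integrable_mul_truncKernel_fst hC hL hv hv0 hvi
  have e : (fun z : EuclideanSpace ℝ (Fin n) × EuclideanSpace ℝ (Fin n) =>
      v z.2 * truncKernel n s p L z) = (fun z => v z.1 * truncKernel n s p L z) ∘ Prod.swap := by
    funext z
    simp only [Function.comp, truncKernel_swap, Prod.fst_swap]
  rw [e]
  constructor
  · exact h1.swap
  · refine le_trans (le_of_eq ?_) h2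
    exact integral_prod_swap (fun z : EuclideanSpace ℝ (Fin n) × EuclideanSpace ℝ (Fin n) =>
      v z.1 * truncKernel n s p L z)

/-- The integral `∫_{ℝⁿ \ B_R(x₀)} vᵖ⁻¹ |x - x₀|^{-(n+sp)} dx` entering the nonlocal tail. -/
def tailIntegral (n : ℕ) (s p : ℝ) (v : EuclideanSpace ℝ (Fin n) → ℝ)
    (x₀ : EuclideanSpace ℝ (Fin n)) (R : ℝ) : ℝ :=
  ∫ y in (Metric.ball x₀ R)ᶜ, v y ^ (p - 1) * ‖y - x₀‖ ^ (-(n + s * p))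

lemma lintegral_compl_ball_le {n : ℕ} {s p C R : ℝ} (hC : IsKernelConst n s p C) (hR : 0 < R)
    (x₀ : EuclideanSpace ℝ (Fin n)) :
    ∫⁻ y in (Metric.ball x₀ R)ᶜ, ENNReal.ofReal (‖y - x₀‖ ^ (-(n + s * p))) ≤
      ENNReal.ofReal (C * R ^ (-(s * p))) := by
  have h := hC.2 R⁻¹ (by positivity) x₀
  rw [Real.inv_rpow hR.le, ← Real.rpow_neg hR.le] at h
  refine le_trans ?_ ((setLIntegral_le_lintegral (Metric.ball x₀ R)ᶜ _).trans h)
  refine setLIntegral_mono (by fun_prop) fun y hy => ENNReal.ofReal_le_ofReal (le_of_eq ?_)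
  have h1 : R ≤ ‖y - x₀‖ := by simpa [dist_eq_norm] using hy
  have h2 : 1 ≤ R⁻¹ * ‖x₀ - y‖ := by
    rw [norm_sub_rev, inv_mul_eq_div, le_div_iff₀ hR]; linarith
  simp only [truncKernel, min_eq_left h2, Real.one_rpow, one_mul, norm_sub_rev]

lemma integrableOn_compl_ball {n : ℕ} {s p C R : ℝ} (hC : IsKernelConst n s p C) (hR : 0 < R)
    (x₀ : EuclideanSpace ℝ (Fin n)) :
    IntegrableOn (fun y => ‖y - x₀‖ ^ (-(n + s * p))) (Metric.ball x₀ R)ᶜ ∧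
      ∫ y in (Metric.ball x₀ R)ᶜ, ‖y - x₀‖ ^ (-(n + s * p)) ≤ C * R ^ (-(s * p)) := by
  have key := lintegral_compl_ball_le hC hR x₀
  have hnn : ∀ y, 0 ≤ ‖y - x₀‖ ^ (-(n + s * p)) := fun y => by positivity
  have hint : IntegrableOn (fun y => ‖y - x₀‖ ^ (-(n + s * p))) (Metric.ball x₀ R)ᶜ :=
    (lintegral_ofReal_ne_top_iff_integrable (Measurable.aestronglyMeasurable (by fun_prop))
      (Filter.Eventually.of_forall hnn)).1 (key.trans_lt ENNReal.ofReal_lt_top).ne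
  refine ⟨hint, ?_⟩
  rw [← ofReal_integral_eq_lintegral_ofReal hint (Filter.Eventually.of_forall hnn)] at key
  have hC0 : 0 ≤ C := zero_le_one.trans hC.1
  exact (ENNReal.ofReal_le_ofReal_iff (by positivity)).1 key

lemma norm_rpow_le_of_notMem_ball {n : ℕ} {s p R : ℝ} (hsp : 0 ≤ s * p) (hR : 0 < R)
    {x₀ y : EuclideanSpace ℝ (Fin n)} (hy : y ∉ Metric.ball x₀ R) :
    ‖y - x₀‖ ^ (-(n + s * p)) ≤ R ^ (-(n + s * p)) :=
  Real.rpow_le_rpow_of_nonpos hR (by simpa [dist_eq_norm] using hy)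
    (by have : (0 : ℝ) ≤ n := by positivity
        linarith)

lemma rpow_sub_one_le_one_add {p t : ℝ} (hp : 1 < p) (ht : 0 ≤ t) : t ^ (p - 1) ≤ 1 + t ^ p := by
  rcases le_total t 1 with h | h
  · have := Real.rpow_le_one ht h (by linarith : 0 ≤ p - 1)
    have : 0 ≤ t ^ p := by positivity
    linarith
  · have := Real.rpow_le_rpow_of_exponent_le h (by linarith : p - 1 ≤ p)
    linarith

lemma integrable_abs_rpow {n : ℕ} {p : ℝ} (hp : 1 < p) {u : EuclideanSpace ℝ (Fin n) → ℝ}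
    (hu : MemLp u (ENNReal.ofReal p) volume) : Integrable (fun x => |u x| ^ p) := by
  have h := hu.integrable_norm_rpow (by simpa using (by linarith : 0 < p)) ENNReal.ofReal_ne_top
  rw [ENNReal.toReal_ofReal (by linarith)] at h
  exact h

/-- For `u ∈ Lᵖ`, every function dominated by `|u| + const` has a finite tail. -/
lemma integrableOn_tail {n : ℕ} {s p C R : ℝ} (hC : IsKernelConst n s p C) (hp : 1 < p)
    (hsp : 0 ≤ s * p) (hR : 0 < R) {u v : EuclideanSpace ℝ (Fin n) → ℝ}
    (hu : MemLp u (ENNReal.ofReal p) volume) (hv : Measurable v) (hv0 : ∀ x, 0 ≤ v x) {b : ℝ}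
    (hb : 0 ≤ b) (hvu : ∀ x, v x ≤ |u x| + b) (x₀ : EuclideanSpace ℝ (Fin n)) :
    IntegrableOn (fun y => v y ^ (p - 1) * ‖y - x₀‖ ^ (-(n + s * p))) (Metric.ball x₀ R)ᶜ := by
  have h1 : IntegrableOn (fun y => 2 ^ p * R ^ (-(n + s * p)) * |u y| ^ p +
      (1 + 2 ^ p * b ^ p) * ‖y - x₀‖ ^ (-(n + s * p))) (Metric.ball x₀ R)ᶜ :=
    ((integrable_abs_rpow hp hu).integrableOn.const_mul _).add
      ((integrableOn_compl_ball hC hR x₀).1.const_mul _)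
  refine Integrable.mono' h1 (Measurable.aestronglyMeasurable (by fun_prop)) ?_
  refine (ae_restrict_iff' measurableSet_ball.compl).2 (Filter.Eventually.of_forall fun y hy => ?_)
  have h2 := norm_rpow_le_of_notMem_ball hsp hR hy
  set κ := ‖y - x₀‖ ^ (-(n + s * p))
  have hκ : 0 ≤ κ := by positivity
  have h3 : v y ^ (p - 1) ≤ 1 + 2 ^ p * (|u y| ^ p + b ^ p) :=
    (rpow_sub_one_le_one_add hp (hv0 y)).trans (by
      have := (Real.rpow_le_rpow (hv0 y) (hvu y) (by linarith : 0 ≤ p)).trans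
        (rpow_add_le_two_rpow_mul (by linarith) (abs_nonneg _) hb)
      linarith)
  rw [Real.norm_of_nonneg (mul_nonneg (Real.rpow_nonneg (hv0 y) _) hκ)]
  have h4 := mul_le_mul_of_nonneg_right h3 hκ
  have h5 : 2 ^ p * |u y| ^ p * κ ≤ 2 ^ p * |u y| ^ p * R ^ (-(n + s * p)) :=
    mul_le_mul_of_nonneg_left h2 (by positivity)
  linarith

/-- The radial cut-off that is `1` on `B_ρ(x₀)`, vanishes off `B_{(ρ+R)/2}(x₀)` and has Lipschitz
constant `2/(R - ρ)`. -/
def cutoff {n : ℕ} (x₀ : EuclideanSpace ℝ (Fin n)) (ρ R : ℝ) (x : EuclideanSpace ℝ (Fin n)) : ℝ :=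
  max 0 (min 1 (2 / (R - ρ) * ((ρ + R) / 2 - ‖x - x₀‖)))

section Cutoff

variable {n : ℕ} (x₀ : EuclideanSpace ℝ (Fin n)) {ρ R : ℝ}

lemma cutoff_nonneg (ρ R : ℝ) (x) : 0 ≤ cutoff x₀ ρ R x := le_max_left _ _

lemma cutoff_le_one (ρ R : ℝ) (x) : cutoff x₀ ρ R x ≤ 1 := max_le zero_le_one (min_le_left _ _)

@[fun_prop]
lemma measurable_cutoff (ρ R : ℝ) : Measurable (cutoff x₀ ρ R) := by unfold cutoff; fun_prop

lemma cutoff_eq_one (h : ρ < R) {x} (hx : x ∈ Metric.ball x₀ ρ) : cutoff x₀ ρ R x = 1 := by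
  have h1 : ‖x - x₀‖ < ρ := by simpa [dist_eq_norm] using hx
  have h2 : 1 ≤ 2 / (R - ρ) * ((ρ + R) / 2 - ‖x - x₀‖) := by
    rw [div_mul_eq_mul_div, le_div_iff₀ (by linarith)]; linarith
  rw [cutoff, min_eq_left h2, max_eq_right zero_le_one]

lemma cutoff_eq_zero (h : ρ < R) {x} (hx : (ρ + R) / 2 ≤ ‖x - x₀‖) : cutoff x₀ ρ R x = 0 := by
  rw [cutoff, max_eq_left]
  refine (min_le_right _ _).trans (mul_nonpos_of_nonneg_of_nonpos ?_ (by linarith))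
  have : 0 < R - ρ := by linarith
  positivity

lemma cutoff_eq_zero_of_notMem (h : ρ < R) {x} (hx : x ∉ Metric.ball x₀ R) :
    cutoff x₀ ρ R x = 0 := by
  have h1 : R ≤ ‖x - x₀‖ := by simpa [dist_eq_norm] using hx
  exact cutoff_eq_zero x₀ h (by linarith)

lemma abs_cutoff_sub_le (h : ρ < R) (x y) :
    |cutoff x₀ ρ R x - cutoff x₀ ρ R y| ≤ min 1 (2 / (R - ρ) * ‖x - y‖) := by
  refine le_min ?_ ?_
  · rw [abs_le]
    constructor <;> linarith [cutoff_nonneg x₀ ρ R x, cutoff_nonneg x₀ ρ R y,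
      cutoff_le_one x₀ ρ R x, cutoff_le_one x₀ ρ R y]
  · have hd : 0 < R - ρ := by linarith
    unfold cutoff
    refine (abs_max_sub_max_le_max _ _ _ _).trans (max_le (by simp; positivity) ?_)
    refine (abs_min_sub_min_le_max _ _ _ _).trans (max_le (by simp; positivity) ?_)
    rw [← mul_sub, abs_mul, abs_of_pos (by positivity)]
    refine mul_le_mul_of_nonneg_left ?_ (by positivity)
    rw [sub_sub_sub_cancel_left, norm_sub_rev x y]
    refine (abs_norm_sub_norm_le _ _).trans (le_of_eq ?_)
    rw [sub_sub_sub_cancel_right]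

lemma abs_cutoff_rpow_sub_le {p : ℝ} (hp : 1 < p) (h : ρ < R) (x y) :
    |cutoff x₀ ρ R x ^ p - cutoff x₀ ρ R y ^ p| ≤ min 1 (p * (2 / (R - ρ)) * ‖x - y‖) := by
  have key : ∀ a b : ℝ, 0 ≤ a → a ≤ 1 → 0 ≤ b → a ^ p - b ^ p ≤ p * |a - b| :=
      fun a b ha ha1 hb => by
    have h1 := rpow_le_rpow_add_mul_abs_sub hp ha hb
    have h2 : p * a ^ (p - 1) * |a - b| ≤ p * |a - b| := by
      refine mul_le_mul_of_nonneg_right ?_ (abs_nonneg _)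
      exact mul_le_of_le_one_right (by linarith) (Real.rpow_le_one ha ha1 (by linarith))
    linarith
  have hx0 := cutoff_nonneg x₀ ρ R x
  have hy0 := cutoff_nonneg x₀ ρ R y
  have hx1 := cutoff_le_one x₀ ρ R x
  have hy1 := cutoff_le_one x₀ ρ R y
  have h0 := (abs_cutoff_sub_le x₀ h x y).trans (min_le_right _ _)
  refine le_min ?_ ?_
  · have a1 := Real.rpow_le_one hx0 hx1 (by linarith : 0 ≤ p)
    have a2 := Real.rpow_le_one hy0 hy1 (by linarith : 0 ≤ p)
    have a3 := Real.rpow_nonneg hx0 p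
    have a4 := Real.rpow_nonneg hy0 p
    rw [abs_le]; constructor <;> linarith
  · have b1 := key _ _ hx0 hx1 hy0
    have b2 := key _ _ hy0 hy1 hx0
    rw [abs_sub_comm] at b2
    have b3 := mul_le_mul_of_nonneg_left h0 (by linarith : 0 ≤ p)
    rw [abs_le]; constructor <;> linarith

end Cutoff

/-- For measurable functions, membership in `W^{s,p}` expressed with the kernel
`|x - y|^{-(n+sp)}`. -/
lemma fracSobolev_iff {n : ℕ} {s p : ℝ} (hp : 1 < p) {v : EuclideanSpace ℝ (Fin n) → ℝ}
    (hv : Measurable v) :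
    FracSobolev n s p v ↔ MemLp v (ENNReal.ofReal p) volume ∧
      Integrable (fun z : EuclideanSpace ℝ (Fin n) × EuclideanSpace ℝ (Fin n) =>
        |v z.1 - v z.2| ^ p * homKernel n s p z) := by
  refine and_congr_right fun _ => ?_
  rw [← integrable_norm_rpow_iff (Measurable.aestronglyMeasurable (by fun_prop))
    (by simpa using (by linarith : 0 < p)) ENNReal.ofReal_ne_top]
  refine integrable_congr (Filter.Eventually.of_forall fun z => ?_)
  simp only [homKernel]
  rw [ENNReal.toReal_ofReal (by linarith), Real.norm_of_nonneg (by positivity),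
    Real.div_rpow (abs_nonneg _) (by positivity), ← Real.rpow_mul (norm_nonneg _),
    Real.rpow_neg (norm_nonneg _), div_eq_mul_inv]
  congr 3
  field_simp

/-- The excess, restricted to a ball. -/
def ballExcess {n : ℕ} (u : EuclideanSpace ℝ (Fin n) → ℝ) (k : ℝ) (x₀ : EuclideanSpace ℝ (Fin n))
    (R : ℝ) : EuclideanSpace ℝ (Fin n) → ℝ :=
  (Metric.ball x₀ R).indicator (excess u k)

section BallExcess

variable {n : ℕ} {u : EuclideanSpace ℝ (Fin n) → ℝ} (k : ℝ) (x₀ : EuclideanSpace ℝ (Fin n)) (R : ℝ)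

lemma ballExcess_nonneg (x) : 0 ≤ ballExcess u k x₀ R x :=
  indicator_nonneg (fun x _ => excess_nonneg u k x) x

lemma measurable_ballExcess (hu : Measurable u) : Measurable (ballExcess u k x₀ R) :=
  (hu.excess k).indicator measurableSet_ball

lemma memLp_ballExcess {p : ℝ} (hu : Measurable u) (hup : MemLp u (ENNReal.ofReal p) volume) :
    MemLp (ballExcess u k x₀ R) (ENNReal.ofReal p) volume := by
  rw [ballExcess, memLp_indicator_iff_restrict measurableSet_ball]
  have : IsFiniteMeasure (volume.restrict (Metric.ball x₀ R)) := ⟨by simp [measure_ball_lt_top]⟩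
  have h1 : MemLp (fun x => |u x| + |k|) (ENNReal.ofReal p) (volume.restrict (Metric.ball x₀ R)) :=
    hup.abs.restrict _ |>.add (memLp_const _)
  refine h1.mono (hu.excess k).aestronglyMeasurable (Filter.Eventually.of_forall fun x => ?_)
  rw [Real.norm_of_nonneg (excess_nonneg _ _ _), Real.norm_of_nonneg (by positivity)]
  exact excess_le u k x

lemma integrable_ballExcess_rpow {p : ℝ} (hp : 1 < p) (hu : Measurable u)
    (hup : MemLp u (ENNReal.ofReal p) volume) :
    Integrable (fun x => ballExcess u k x₀ R x ^ p) := by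
  have := integrable_abs_rpow hp (memLp_ballExcess k x₀ R hu hup)
  simpa only [abs_of_nonneg (ballExcess_nonneg k x₀ R _)] using this

lemma integrable_ballExcess {p : ℝ} (hp : 1 < p) (hu : Measurable u)
    (hup : MemLp u (ENNReal.ofReal p) volume) : Integrable (ballExcess u k x₀ R) := by
  rw [ballExcess, integrable_indicator_iff measurableSet_ball]
  have : IsFiniteMeasure (volume.restrict (Metric.ball x₀ R)) := ⟨by simp [measure_ball_lt_top]⟩
  have h1 := (memLp_indicator_iff_restrict measurableSet_ball).1 (memLp_ballExcess k x₀ R hu hup)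
  exact h1.integrable (by simpa using hp.le)

end BallExcess

/-- The localized truncation `(u - k)₊ φᵖ` is an admissible test function. -/
lemma fracSobolevZero_test {n : ℕ} {s p C : ℝ} (hp : 1 < p) (hC : IsKernelConst n s p C)
    {u : EuclideanSpace ℝ (Fin n) → ℝ} (hu : Measurable u) (hW : FracSobolev n s p u)
    {Ω : Set (EuclideanSpace ℝ (Fin n))} {x₀ : EuclideanSpace ℝ (Fin n)} {ρ R : ℝ} (hρR : ρ < R)
    (hΩ : Metric.ball x₀ R ⊆ Ω) (k : ℝ) :
    FracSobolevZero n s p Ω (fun x => excess u k x * cutoff x₀ ρ R x ^ p) := by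
  have hp0 : 0 ≤ p := by linarith
  have hηm : Measurable (fun x => excess u k x * cutoff x₀ ρ R x ^ p) := by fun_prop
  have hz : ∀ x ∉ Metric.ball x₀ R, cutoff x₀ ρ R x ^ p = 0 := fun x hx => by
    rw [cutoff_eq_zero_of_notMem x₀ hρR hx, Real.zero_rpow (by linarith)]
  have hφ0 : ∀ x, 0 ≤ cutoff x₀ ρ R x ^ p := fun x => Real.rpow_nonneg (cutoff_nonneg _ _ _ _) _
  have hφ1 : ∀ x, cutoff x₀ ρ R x ^ p ≤ 1 := fun x =>
    Real.rpow_le_one (cutoff_nonneg _ _ _ _) (cutoff_le_one _ _ _ _) hp0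
  have hv0 := ballExcess_nonneg (u := u) k x₀ R
  have hvm := measurable_ballExcess k x₀ R hu
  refine ⟨(fracSobolev_iff hp hηm).2 ⟨?_, ?_⟩, Filter.Eventually.of_forall fun x hx => ?_⟩
  · refine (memLp_ballExcess k x₀ R hu hW.1).mono hηm.aestronglyMeasurable
      (Filter.Eventually.of_forall fun x => ?_)
    rw [Real.norm_of_nonneg (mul_nonneg (excess_nonneg _ _ _) (hφ0 x)), Real.norm_of_nonneg (hv0 x)]
    by_cases hx : x ∈ Metric.ball x₀ R
    · rw [ballExcess, indicator_of_mem hx]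
      exact mul_le_of_le_one_right (excess_nonneg _ _ _) (hφ1 x)
    · rw [hz x hx, mul_zero]; exact hv0 x
  · have hL : 0 < p * (2 / (R - ρ)) := by
      have : 0 < R - ρ := by linarith
      positivity
    have hvi := integrable_ballExcess_rpow k x₀ R hp hu hW.1
    have hvp0 : ∀ x, 0 ≤ ballExcess u k x₀ R x ^ p := fun x => Real.rpow_nonneg (hv0 x) _
    have i1 := (integrable_mul_truncKernel_fst hC hL (hvm.pow_const p) hvp0 hvi).1
    have i2 := (integrable_mul_truncKernel_snd hC hL (hvm.pow_const p) hvp0 hvi).1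
    have i0 := ((fracSobolev_iff hp hu).1 hW).2
    refine Integrable.mono' (((i0.const_mul (2 ^ p)).add
      ((i1.add i2).const_mul (2 ^ p * 2 ^ p))))
      (Measurable.aestronglyMeasurable (by fun_prop)) (Filter.Eventually.of_forall fun z => ?_)
    obtain ⟨x, y⟩ := z
    rw [Real.norm_of_nonneg (mul_nonneg (by positivity) (homKernel_nonneg _ _ _ _))]
    simp only [Pi.add_apply]
    set M := min 1 (p * (2 / (R - ρ)) * ‖x - y‖) with hM
    have hM0 : 0 ≤ M := by positivity
    have hMb := abs_cutoff_rpow_sub_le x₀ hp hρR x y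
    rw [← hM] at hMb
    have hlip : |excess u k x - excess u k y| ≤ |u x - u y| := by
      unfold excess
      refine (abs_max_sub_max_le_max _ _ _ _).trans (max_le ?_ (by simp))
      rw [sub_sub_sub_cancel_right]
    have hk : truncKernel n s p (p * (2 / (R - ρ))) (x, y) = M ^ p * homKernel n s p (x, y) := rfl
    have key : |excess u k x * cutoff x₀ ρ R x ^ p - excess u k y * cutoff x₀ ρ R y ^ p| ≤
        |u x - u y| + (ballExcess u k x₀ R x + ballExcess u k x₀ R y) * M := by
      -- the product rule is used with the untruncated factor taken inside the ball
      have aux : ∀ a b : EuclideanSpace ℝ (Fin n), a ∈ Metric.ball x₀ R →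
          |excess u k a * cutoff x₀ ρ R a ^ p - excess u k b * cutoff x₀ ρ R b ^ p| ≤
          |excess u k a - excess u k b| + ballExcess u k x₀ R a *
            |cutoff x₀ ρ R a ^ p - cutoff x₀ ρ R b ^ p| := fun a b ha => by
        rw [ballExcess, indicator_of_mem ha]
        have e : excess u k a * cutoff x₀ ρ R a ^ p - excess u k b * cutoff x₀ ρ R b ^ p =
          (excess u k a - excess u k b) * cutoff x₀ ρ R b ^ p +
          excess u k a * (cutoff x₀ ρ R a ^ p - cutoff x₀ ρ R b ^ p) := by ring
        rw [e]
        refine (abs_add_le _ _).trans ?_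
        rw [abs_mul, abs_mul, abs_of_nonneg (hφ0 b), abs_of_nonneg (excess_nonneg u k a)]
        have := mul_le_of_le_one_right (abs_nonneg (excess u k a - excess u k b)) (hφ1 b)
        linarith
      by_cases hx : x ∈ Metric.ball x₀ R
      · have := aux x y hx
        have h1 := mul_le_mul_of_nonneg_left hMb (hv0 x)
        have h2 := mul_nonneg (hv0 y) hM0
        linarith
      by_cases hy : y ∈ Metric.ball x₀ R
      · have := aux y x hy
        rw [abs_sub_comm (cutoff x₀ ρ R x ^ p)] at hMb
        have h1 := mul_le_mul_of_nonneg_left hMb (hv0 y)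
        have h2 := mul_nonneg (hv0 x) hM0
        rw [abs_sub_comm, abs_sub_comm (excess u k y)] at this
        linarith
      · rw [hz x hx, hz y hy]
        have h1 := mul_nonneg (add_nonneg (hv0 x) (hv0 y)) hM0
        simp only [mul_zero, sub_zero, abs_zero]
        positivity
    have k1 := Real.rpow_le_rpow (abs_nonneg _) key hp0
    have k2 := rpow_add_le_two_rpow_mul hp0 (abs_nonneg (u x - u y))
      (mul_nonneg (add_nonneg (hv0 x) (hv0 y)) hM0)
    rw [Real.mul_rpow (add_nonneg (hv0 x) (hv0 y)) hM0] at k2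
    have k3 := mul_le_mul_of_nonneg_right (rpow_add_le_two_rpow_mul hp0 (hv0 x) (hv0 y))
      (Real.rpow_nonneg hM0 p)
    have k4 : |excess u k x * cutoff x₀ ρ R x ^ p - excess u k y * cutoff x₀ ρ R y ^ p| ^ p ≤
        2 ^ p * (|u x - u y| ^ p +
          2 ^ p * (ballExcess u k x₀ R x ^ p + ballExcess u k x₀ R y ^ p) * M ^ p) :=
      k1.trans (k2.trans (by gcongr))
    refine (mul_le_mul_of_nonneg_right k4 (homKernel_nonneg n s p (x, y))).trans (le_of_eq ?_)
    rw [hk]; ring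
  · simp only [hz x (fun h => hx (hΩ h)), mul_zero]

/-! ### The Caccioppoli inequality with its mixed term -/

/-- Ellipticity, rewritten as a comparison with the homogeneous kernel. -/
lemma IsEllipticKernel.ae_bounds {n : ℕ} {s p lam Lam : ℝ}
    {K : EuclideanSpace ℝ (Fin n) → EuclideanSpace ℝ (Fin n) → ℝ}
    (hK : IsEllipticKernel n s p lam Lam K) (hlam : 1 ≤ lam) :
    ∀ᵐ z : EuclideanSpace ℝ (Fin n) × EuclideanSpace ℝ (Fin n),
      homKernel n s p z ≤ K z.1 z.2 ∧ K z.1 z.2 ≤ Lam * homKernel n s p z := by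
  filter_upwards [hK.bounds] with z hz
  have h0 : 0 ≤ ‖z.1 - z.2‖ ^ ((n : ℝ) + s * p) := by positivity
  -- the lower bound excludes the diagonal, where the power vanishes
  have h1 : 0 < ‖z.1 - z.2‖ ^ ((n : ℝ) + s * p) := by
    rcases h0.eq_or_lt with h | h
    · rw [← h, mul_zero] at hz; linarith [hz.1]
    · exact h
  rw [homKernel, Real.rpow_neg (norm_nonneg _), ← div_eq_mul_inv, le_div_iff₀ h1]
  refine ⟨?_, hz.2⟩
  rw [inv_eq_one_div, div_le_iff₀ h1]
  linarith [hz.1]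

/-- The integrand of the energy form is absolutely integrable, so that the sign of the form can be
combined with pointwise bounds. -/
lemma integrable_energy {n : ℕ} {s p lam Lam : ℝ} (hp : 1 < p) (hlam : 1 ≤ lam)
    {K : EuclideanSpace ℝ (Fin n) → EuclideanSpace ℝ (Fin n) → ℝ}
    (hK : IsEllipticKernel n s p lam Lam K) {u η : EuclideanSpace ℝ (Fin n) → ℝ}
    (hu : Measurable u) (hη : Measurable η) (hWu : FracSobolev n s p u)
    (hWη : FracSobolev n s p η) :
    Integrable (fun z : EuclideanSpace ℝ (Fin n) × EuclideanSpace ℝ (Fin n) =>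
      K z.1 z.2 * |u z.1 - u z.2| ^ (p - 2) * (u z.1 - u z.2) * (η z.1 - η z.2)) := by
  have i1 := ((fracSobolev_iff hp hu).1 hWu).2
  have i2 := ((fracSobolev_iff hp hη).1 hWη).2
  refine Integrable.mono' (((i1.const_mul (1 / 2)).add (i2.const_mul (2 ^ (p - 1)))).const_mul Lam)
    ?_ ?_
  · refine AEMeasurable.aestronglyMeasurable ?_
    have h1 := hK.measurable
    have h2 : Measurable (fun z : EuclideanSpace ℝ (Fin n) × EuclideanSpace ℝ (Fin n) =>
      |u z.1 - u z.2| ^ (p - 2)) := by fun_prop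
    have h3 : Measurable (fun z : EuclideanSpace ℝ (Fin n) × EuclideanSpace ℝ (Fin n) =>
      (u z.1 - u z.2)) := by fun_prop
    have h4 : Measurable (fun z : EuclideanSpace ℝ (Fin n) × EuclideanSpace ℝ (Fin n) =>
      (η z.1 - η z.2)) := by fun_prop
    exact ((h1.mul h2.aemeasurable).mul h3.aemeasurable).mul h4.aemeasurable
  · filter_upwards [hK.ae_bounds hlam] with z hz
    have h1 := rpow_sub_one_mul_le hp (abs_nonneg (u z.1 - u z.2)) (abs_nonneg (η z.1 - η z.2))
    have hK0 := hK.nonneg z.1 z.2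
    rw [mul_assoc (K z.1 z.2), Real.norm_eq_abs, abs_mul, abs_mul, abs_abs_rpow_sub_two_mul hp,
      abs_of_nonneg hK0, mul_assoc]
    have h2 : 0 ≤ 1 / 2 * |u z.1 - u z.2| ^ p + 2 ^ (p - 1) * |η z.1 - η z.2| ^ p := by positivity
    calc _ ≤ K z.1 z.2 * (1 / 2 * |u z.1 - u z.2| ^ p + 2 ^ (p - 1) * |η z.1 - η z.2| ^ p) :=
          mul_le_mul_of_nonneg_left h1 hK0
      _ ≤ Lam * homKernel n s p z *
          (1 / 2 * |u z.1 - u z.2| ^ p + 2 ^ (p - 1) * |η z.1 - η z.2| ^ p) :=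
          mul_le_mul_of_nonneg_right hz.2 h2
      _ = _ := by simp only [Pi.add_apply]; ring

/-- The tail integrand `(u - k)₊ᵖ⁻¹ |y - x₀|^{-(n+sp)}` off the ball `B_R(x₀)`. -/
def tailDensity {n : ℕ} (s p : ℝ) (u : EuclideanSpace ℝ (Fin n) → ℝ) (k : ℝ)
    (x₀ : EuclideanSpace ℝ (Fin n)) (R : ℝ) : EuclideanSpace ℝ (Fin n) → ℝ :=
  (Metric.ball x₀ R)ᶜ.indicator (fun y => excess u k y ^ (p - 1) * ‖y - x₀‖ ^ (-(n + s * p)))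

lemma tailDensity_nonneg {n : ℕ} (s p : ℝ) (u : EuclideanSpace ℝ (Fin n) → ℝ) (k : ℝ)
    (x₀ : EuclideanSpace ℝ (Fin n)) (R : ℝ) (y) : 0 ≤ tailDensity s p u k x₀ R y :=
  indicator_nonneg (fun y _ => mul_nonneg (Real.rpow_nonneg (excess_nonneg _ _ _) _)
    (by positivity)) y

/-- The pointwise error in the Caccioppoli inequality: a local part, due to the variation of the
cut-off, and the interaction of the ball with its complement. -/
def caccioppoliError {n : ℕ} (s p : ℝ) (u : EuclideanSpace ℝ (Fin n) → ℝ) (k : ℝ)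
    (x₀ : EuclideanSpace ℝ (Fin n)) (ρ R : ℝ)
    (z : EuclideanSpace ℝ (Fin n) × EuclideanSpace ℝ (Fin n)) : ℝ :=
  (ballExcess u k x₀ R z.1 ^ p * truncKernel n s p (2 / (R - ρ)) z +
    ballExcess u k x₀ R z.2 ^ p * truncKernel n s p (2 / (R - ρ)) z) +
  (2 * R / (R - ρ)) ^ (n + s * p) *
    (ballExcess u k x₀ R z.1 * tailDensity s p u k x₀ R z.2 +
      tailDensity s p u k x₀ R z.1 * ballExcess u k x₀ R z.2)

/-- The pointwise gain in the Caccioppoli inequality: the Gagliardo integrand of the localized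
truncation and the mixed term. -/
def caccioppoliGain {n : ℕ} (p : ℝ) (u : EuclideanSpace ℝ (Fin n) → ℝ) (k : ℝ)
    (x₀ : EuclideanSpace ℝ (Fin n)) (ρ R : ℝ)
    (z : EuclideanSpace ℝ (Fin n) × EuclideanSpace ℝ (Fin n)) : ℝ :=
  |excess u k z.1 * cutoff x₀ ρ R z.1 - excess u k z.2 * cutoff x₀ ρ R z.2| ^ p +
    excess (-u) (-k) z.2 ^ (p - 1) * (excess u k z.1 * cutoff x₀ ρ R z.1 ^ p)

lemma caccioppoliGain_nonneg {n : ℕ} (p : ℝ) (u : EuclideanSpace ℝ (Fin n) → ℝ) (k : ℝ)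
    (x₀ : EuclideanSpace ℝ (Fin n)) (ρ R : ℝ) (z) : 0 ≤ caccioppoliGain p u k x₀ ρ R z :=
  add_nonneg (by positivity) (mul_nonneg (Real.rpow_nonneg (excess_nonneg _ _ _) _)
    (mul_nonneg (excess_nonneg _ _ _) (Real.rpow_nonneg (cutoff_nonneg _ _ _ _) _)))

/-- Comparison of the kernel seen from a point of the support of the cut-off with the kernel seen
from the centre. -/
lemma homKernel_le_of_support {n : ℕ} {s p ρ R : ℝ} (hsp : 0 ≤ s * p) (hρ : 0 < ρ) (hρR : ρ < R)
    {x₀ x y : EuclideanSpace ℝ (Fin n)} (hx : ‖x - x₀‖ < (ρ + R) / 2)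
    (hy : y ∉ Metric.ball x₀ R) :
    homKernel n s p (x, y) ≤ (2 * R / (R - ρ)) ^ (n + s * p) * ‖y - x₀‖ ^ (-(n + s * p)) := by
  have hy' : R ≤ ‖y - x₀‖ := by simpa [dist_eq_norm] using hy
  have hd : 0 < R - ρ := by linarith
  have hq : 0 ≤ (n : ℝ) + s * p := by positivity
  have h1 : ‖y - x₀‖ ≤ ‖x - y‖ + ‖x - x₀‖ := by
    have := norm_sub_le_norm_sub_add_norm_sub y x x₀
    rwa [norm_sub_rev y x] at this
  have hyy : 0 < ‖y - x₀‖ := by linarith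
  have h2 : (2 * R / (R - ρ))⁻¹ * ‖y - x₀‖ ≤ ‖x - y‖ := by
    rw [inv_div, div_mul_eq_mul_div, div_le_iff₀ (by linarith)]
    nlinarith
  have h3 : 0 < 2 * R / (R - ρ) := by
    have : 0 < R := by linarith
    positivity
  calc homKernel n s p (x, y) ≤ ((2 * R / (R - ρ))⁻¹ * ‖y - x₀‖) ^ (-(n + s * p)) :=
        Real.rpow_le_rpow_of_nonpos (by positivity) h2 (by linarith)
    _ = _ := by
        rw [Real.mul_rpow (by positivity) hyy.le, Real.inv_rpow h3.le, ← Real.rpow_neg h3.le,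
          neg_neg]

/-- The pointwise form of the Caccioppoli inequality. Pairs inside the ball are treated by
`test_difference_ge`, and pairs with exactly one point inside by `test_value_ge`. -/
lemma caccioppoli_pointwise {n : ℕ} {s p Lam ρ R : ℝ} (hp : 1 < p) (hsp : 0 ≤ s * p)
    (hLam : 1 ≤ Lam) (hρ : 0 < ρ) (hρR : ρ < R) (u : EuclideanSpace ℝ (Fin n) → ℝ) (k : ℝ)
    (x₀ : EuclideanSpace ℝ (Fin n)) {K₀ : ℝ}
    (z : EuclideanSpace ℝ (Fin n) × EuclideanSpace ℝ (Fin n))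
    (h1 : homKernel n s p z ≤ K₀) (h2 : K₀ ≤ Lam * homKernel n s p z) :
    gainConst p * (caccioppoliGain p u k x₀ ρ R z * homKernel n s p z) ≤
      K₀ * |u z.1 - u z.2| ^ (p - 2) * (u z.1 - u z.2) *
        (excess u k z.1 * cutoff x₀ ρ R z.1 ^ p - excess u k z.2 * cutoff x₀ ρ R z.2 ^ p) +
      Lam * lossConst p * caccioppoliError s p u k x₀ ρ R z := by
  obtain ⟨x, y⟩ := z
  have hp0 : p ≠ 0 := by linarith
  have hG0 := gainConst_pos p
  have hL0 : 0 < lossConst p := by linarith [two_le_lossConst p hp]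
  have hκ := homKernel_nonneg n s p (x, y)
  have hK0 : 0 ≤ K₀ := hκ.trans h1
  have hd : 0 < R - ρ := by linarith
  have hR : 0 < R := by linarith
  have hgn := caccioppoliGain_nonneg p u k x₀ ρ R (x, y)
  have hm := truncKernel_nonneg n s p (by positivity : 0 ≤ 2 / (R - ρ)) (x, y)
  have hb := ballExcess_nonneg (u := u) k x₀ R
  have hT := tailDensity_nonneg s p u k x₀ R
  have hw := excess_nonneg u k
  have hφ := cutoff_nonneg x₀ ρ R
  have hA : 0 ≤ (2 * R / (R - ρ)) ^ (n + s * p) := by positivity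
  -- it suffices to compare with the loss multiplied by the homogeneous kernel
  suffices H : ∃ N : ℝ, 0 ≤ N ∧
      gainConst p * caccioppoliGain p u k x₀ ρ R (x, y) - lossConst p * N ≤
        |u x - u y| ^ (p - 2) * (u x - u y) *
          (excess u k x * cutoff x₀ ρ R x ^ p - excess u k y * cutoff x₀ ρ R y ^ p) ∧
      N * homKernel n s p (x, y) ≤ caccioppoliError s p u k x₀ ρ R (x, y) by
    obtain ⟨N, hN0, hN, hNE⟩ := H
    have a1 := mul_le_mul_of_nonneg_left hN hK0
    have a2 := mul_le_mul_of_nonneg_left h1 (mul_nonneg hG0.le hgn)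
    have a3 := mul_le_mul_of_nonneg_left h2 (mul_nonneg hL0.le hN0)
    have a4 := mul_le_mul_of_nonneg_left hNE (mul_nonneg (by linarith : 0 ≤ Lam) hL0.le)
    simp only at *
    linarith
  by_cases hx : x ∈ Metric.ball x₀ R <;> by_cases hy : y ∈ Metric.ball x₀ R
  · refine ⟨(excess u k x ^ p + excess u k y ^ p) * |cutoff x₀ ρ R x - cutoff x₀ ρ R y| ^ p,
      ?_, ?_, ?_⟩
    · have := Real.rpow_nonneg (hw x) p
      have := Real.rpow_nonneg (hw y) p
      positivity
    · have := test_difference_ge (a := u x - k) (b := u y - k) hp (hφ x) (hφ y)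
      rw [sub_sub_sub_cancel_right] at this
      refine le_trans (le_of_eq ?_) this
      simp only [caccioppoliGain, excess, Pi.neg_apply]
      rw [show -u y - -k = -(u y - k) by ring]
    · have e1 : ballExcess u k x₀ R x = excess u k x := indicator_of_mem hx _
      have e2 : ballExcess u k x₀ R y = excess u k y := indicator_of_mem hy _
      have e3 : |cutoff x₀ ρ R x - cutoff x₀ ρ R y| ^ p * homKernel n s p (x, y) ≤
          truncKernel n s p (2 / (R - ρ)) (x, y) :=
        mul_le_mul_of_nonneg_right
          (Real.rpow_le_rpow (abs_nonneg _) (abs_cutoff_sub_le x₀ hρR x y) (by linarith)) hκ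
      have e4 := mul_le_mul_of_nonneg_left e3
        (add_nonneg (Real.rpow_nonneg (hw x) p) (Real.rpow_nonneg (hw y) p))
      have e5 : 0 ≤ (2 * R / (R - ρ)) ^ (n + s * p) *
        (ballExcess u k x₀ R x * tailDensity s p u k x₀ R y +
          tailDensity s p u k x₀ R x * ballExcess u k x₀ R y) :=
        mul_nonneg hA (add_nonneg (mul_nonneg (hb x) (hT y)) (mul_nonneg (hT x) (hb y)))
      simp only [caccioppoliError]
      rw [e1, e2] at *
      linarith
  · have hy0 := cutoff_eq_zero_of_notMem x₀ hρR hy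
    refine ⟨excess u k y ^ (p - 1) * (excess u k x * cutoff x₀ ρ R x ^ p), ?_, ?_, ?_⟩
    · exact mul_nonneg (Real.rpow_nonneg (hw y) _) (mul_nonneg (hw x) (Real.rpow_nonneg (hφ x) _))
    · have := test_value_ge (a := u x - k) (b := u y - k) hp (hφ x)
      rw [sub_sub_sub_cancel_right] at this
      simp only [caccioppoliGain, hy0, Real.zero_rpow hp0, mul_zero, sub_zero]
      rw [abs_of_nonneg (mul_nonneg (hw x) (hφ x))]
      refine le_trans (le_of_eq ?_) this
      simp only [excess, Pi.neg_apply]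
      rw [show -u y - -k = -(u y - k) by ring]
    · have e0 : 0 ≤ ballExcess u k x₀ R x ^ p * truncKernel n s p (2 / (R - ρ)) (x, y) +
          ballExcess u k x₀ R y ^ p * truncKernel n s p (2 / (R - ρ)) (x, y) :=
        add_nonneg (mul_nonneg (Real.rpow_nonneg (hb x) p) hm)
          (mul_nonneg (Real.rpow_nonneg (hb y) p) hm)
      have e1 : ballExcess u k x₀ R x = excess u k x := indicator_of_mem hx _
      have e2 : tailDensity s p u k x₀ R y =
        excess u k y ^ (p - 1) * ‖y - x₀‖ ^ (-(n + s * p)) := indicator_of_mem hy _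
      have e3 : excess u k y ^ (p - 1) * (excess u k x * cutoff x₀ ρ R x ^ p) *
          homKernel n s p (x, y) ≤ (2 * R / (R - ρ)) ^ (n + s * p) *
            (ballExcess u k x₀ R x * tailDensity s p u k x₀ R y) := by
        rw [e1, e2]
        by_cases hx' : ‖x - x₀‖ < (ρ + R) / 2
        · have f1 := homKernel_le_of_support hsp hρ hρR hx' hy
          have f2 : cutoff x₀ ρ R x ^ p ≤ 1 :=
            Real.rpow_le_one (hφ x) (cutoff_le_one _ _ _ _) (by linarith)
          have f3 := mul_le_mul_of_nonneg_left f2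
            (mul_nonneg (Real.rpow_nonneg (hw y) (p - 1)) (hw x))
          have f4 := mul_le_mul f3 f1 hκ (by
            rw [mul_one]; exact mul_nonneg (Real.rpow_nonneg (hw y) (p - 1)) (hw x))
          linarith
        · rw [cutoff_eq_zero x₀ hρR (not_lt.1 hx'), Real.zero_rpow hp0]
          simp only [mul_zero, zero_mul]
          exact mul_nonneg hA (mul_nonneg (hw x) (mul_nonneg (Real.rpow_nonneg (hw y) _)
            (by positivity)))
      have e4 := mul_nonneg hA (mul_nonneg (hT x) (hb y))
      simp only [caccioppoliError]
      linarith
  · have hx0 := cutoff_eq_zero_of_notMem x₀ hρR hx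
    refine ⟨excess u k x ^ (p - 1) * (excess u k y * cutoff x₀ ρ R y ^ p), ?_, ?_, ?_⟩
    · exact mul_nonneg (Real.rpow_nonneg (hw x) _) (mul_nonneg (hw y) (Real.rpow_nonneg (hφ y) _))
    · have := test_value_ge (a := u y - k) (b := u x - k) hp (hφ y)
      rw [sub_sub_sub_cancel_right, abs_sub_comm] at this
      simp only [caccioppoliGain, hx0, Real.zero_rpow hp0, mul_zero, zero_sub, add_zero]
      rw [abs_neg, abs_of_nonneg (mul_nonneg (hw y) (hφ y))]
      have g : 0 ≤ gainConst p * (max (-(u x - k)) 0 ^ (p - 1) *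
        (max (u y - k) 0 * cutoff x₀ ρ R y ^ p)) :=
        mul_nonneg hG0.le (mul_nonneg (Real.rpow_nonneg (le_max_right _ _) _)
          (mul_nonneg (le_max_right _ _) (Real.rpow_nonneg (hφ y) _)))
      simp only [excess] at *
      linarith
    · have e0 : 0 ≤ ballExcess u k x₀ R x ^ p * truncKernel n s p (2 / (R - ρ)) (x, y) +
          ballExcess u k x₀ R y ^ p * truncKernel n s p (2 / (R - ρ)) (x, y) :=
        add_nonneg (mul_nonneg (Real.rpow_nonneg (hb x) p) hm)
          (mul_nonneg (Real.rpow_nonneg (hb y) p) hm)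
      have e1 : ballExcess u k x₀ R y = excess u k y := indicator_of_mem hy _
      have e2 : tailDensity s p u k x₀ R x =
        excess u k x ^ (p - 1) * ‖x - x₀‖ ^ (-(n + s * p)) := indicator_of_mem hx _
      have e3 : excess u k x ^ (p - 1) * (excess u k y * cutoff x₀ ρ R y ^ p) *
          homKernel n s p (x, y) ≤ (2 * R / (R - ρ)) ^ (n + s * p) *
            (tailDensity s p u k x₀ R x * ballExcess u k x₀ R y) := by
        rw [e1, e2]
        by_cases hy' : ‖y - x₀‖ < (ρ + R) / 2
        · have f1 := homKernel_le_of_support hsp hρ hρR hy' hx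
          have f0 : homKernel n s p (y, x) = homKernel n s p (x, y) := by
            simp [homKernel, norm_sub_rev]
          rw [f0] at f1
          have f2 : cutoff x₀ ρ R y ^ p ≤ 1 :=
            Real.rpow_le_one (hφ y) (cutoff_le_one _ _ _ _) (by linarith)
          have f3 := mul_le_mul_of_nonneg_left f2
            (mul_nonneg (Real.rpow_nonneg (hw x) (p - 1)) (hw y))
          have f4 := mul_le_mul f3 f1 hκ (by
            rw [mul_one]; exact mul_nonneg (Real.rpow_nonneg (hw x) (p - 1)) (hw y))
          linarith
        · rw [cutoff_eq_zero x₀ hρR (not_lt.1 hy'), Real.zero_rpow hp0]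
          simp only [mul_zero, zero_mul]
          exact mul_nonneg hA (mul_nonneg (mul_nonneg (Real.rpow_nonneg (hw x) _)
            (by positivity)) (hw y))
      have e4 := mul_nonneg hA (mul_nonneg (hb x) (hT y))
      simp only [caccioppoliError]
      linarith
  · refine ⟨0, le_rfl, ?_, ?_⟩
    · simp [caccioppoliGain, cutoff_eq_zero_of_notMem x₀ hρR hx,
        cutoff_eq_zero_of_notMem x₀ hρR hy, Real.zero_rpow hp0]
    · rw [zero_mul]
      refine add_nonneg (add_nonneg (mul_nonneg (Real.rpow_nonneg (hb x) p) hm)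
          (mul_nonneg (Real.rpow_nonneg (hb y) p) hm)) (mul_nonneg hA (add_nonneg
            (mul_nonneg (hb x) (hT y)) (mul_nonneg (hT x) (hb y))))

/-- The right-hand side of the Caccioppoli inequality between the balls `B_ρ(x₀) ⊂ B_R(x₀)`. -/
def caccioppoliBound {n : ℕ} (s p : ℝ) (u : EuclideanSpace ℝ (Fin n) → ℝ) (k : ℝ)
    (x₀ : EuclideanSpace ℝ (Fin n)) (ρ R : ℝ) : ℝ :=
  (R - ρ) ^ (-(s * p)) * (∫ x in Metric.ball x₀ R, excess u k x ^ p) +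
    (R / (R - ρ)) ^ (n + s * p) * tailIntegral n s p (excess u k) x₀ R *
      ∫ x in Metric.ball x₀ R, excess u k x

lemma integral_ballExcess_rpow {n : ℕ} {p : ℝ} (hp : p ≠ 0) (u : EuclideanSpace ℝ (Fin n) → ℝ)
    (k : ℝ) (x₀ : EuclideanSpace ℝ (Fin n)) (R : ℝ) :
    ∫ x, ballExcess u k x₀ R x ^ p = ∫ x in Metric.ball x₀ R, excess u k x ^ p := by
  rw [← integral_indicator measurableSet_ball]
  congr 1; funext x
  by_cases hx : x ∈ Metric.ball x₀ R
  · simp [ballExcess, hx]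
  · simp [ballExcess, hx, Real.zero_rpow hp]

/-- Subsolution property tested on `W₀^{s,p}(Ω)`, with no reference to boundary data. -/
def IsTestSubsolution (n : ℕ) (s p : ℝ)
    (K : EuclideanSpace ℝ (Fin n) → EuclideanSpace ℝ (Fin n) → ℝ)
    (Ω : Set (EuclideanSpace ℝ (Fin n))) (u : EuclideanSpace ℝ (Fin n) → ℝ) : Prop :=
  FracSobolev n s p u ∧ ∀ η : EuclideanSpace ℝ (Fin n) → ℝ, FracSobolevZero n s p Ω η →
    (∀ᵐ x, 0 ≤ η x) → energyForm n p K u η ≤ 0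

/-- Constant of the Caccioppoli inequality in terms of the kernel constant `C`. -/
def caccioppoliConst (n : ℕ) (s p Lam C : ℝ) : ℝ :=
  Lam * lossConst p * (2 * C * 2 ^ (n + s * p)) / gainConst p

/-- Caccioppoli inequality for subsolutions. The gain is integrated over all of `ℝⁿ × ℝⁿ`, so it
contains the full Gagliardo seminorm of the localized truncation. -/
lemma caccioppoli {n : ℕ} {s p lam Lam C : ℝ} (hp : 1 < p) (hsp : 0 ≤ s * p) (hlam : 1 ≤ lam)
    (hLam : lam ≤ Lam) (hC : IsKernelConst n s p C)
    {K : EuclideanSpace ℝ (Fin n) → EuclideanSpace ℝ (Fin n) → ℝ}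
    (hK : IsEllipticKernel n s p lam Lam K) {Ω : Set (EuclideanSpace ℝ (Fin n))}
    {u : EuclideanSpace ℝ (Fin n) → ℝ} (hu : Measurable u)
    (hsub : IsTestSubsolution n s p K Ω u)
    {x₀ : EuclideanSpace ℝ (Fin n)} {ρ R : ℝ} (hρ : 0 < ρ) (hρR : ρ < R)
    (hΩ : Metric.ball x₀ R ⊆ Ω) (k : ℝ) :
    ∫⁻ z, ENNReal.ofReal (caccioppoliGain p u k x₀ ρ R z * homKernel n s p z) ≤
      ENNReal.ofReal (caccioppoliConst n s p Lam C * caccioppoliBound s p u k x₀ ρ R) := by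
  have hp0 : p ≠ 0 := by linarith
  have hd : 0 < R - ρ := by linarith
  have hR : 0 < R := by linarith
  have hC0 : 0 < C := zero_lt_one.trans_le hC.1
  have hG0 := gainConst_pos p
  have hL0 : 0 < lossConst p := by linarith [two_le_lossConst p hp]
  have hη := fracSobolevZero_test hp hC hu hsub.1 hρR hΩ k
  have hFi := integrable_energy hp hlam hK hu (by fun_prop) hsub.1 hη.1
  have hF0 := hsub.2 _ hη (Filter.Eventually.of_forall fun x =>
    mul_nonneg (excess_nonneg _ _ _) (Real.rpow_nonneg (cutoff_nonneg _ _ _ _) _))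
  have hb0 := ballExcess_nonneg (u := u) k x₀ R
  have hvp0 : ∀ x, 0 ≤ ballExcess u k x₀ R x ^ p := fun x => Real.rpow_nonneg (hb0 x) _
  have hbm := measurable_ballExcess k x₀ R hu
  have hvi := integrable_ballExcess_rpow k x₀ R hp hu hsub.1.1
  have hbi := integrable_ballExcess k x₀ R hp hu hsub.1.1
  obtain ⟨i1, j1⟩ := integrable_mul_truncKernel_fst hC (by positivity : 0 < 2 / (R - ρ))
    (hbm.pow_const p) hvp0 hvi
  obtain ⟨i2, j2⟩ := integrable_mul_truncKernel_snd hC (by positivity : 0 < 2 / (R - ρ))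
    (hbm.pow_const p) hvp0 hvi
  have hTi : Integrable (tailDensity s p u k x₀ R) := by
    rw [tailDensity, integrable_indicator_iff measurableSet_ball.compl]
    exact integrableOn_tail hC hp hsp hR hsub.1.1 (hu.excess k) (excess_nonneg u k)
      (abs_nonneg k) (excess_le u k) x₀
  have i3 : Integrable (fun z : EuclideanSpace ℝ (Fin n) × EuclideanSpace ℝ (Fin n) =>
      ballExcess u k x₀ R z.1 * tailDensity s p u k x₀ R z.2) := hbi.mul_prod hTi
  have i4 : Integrable (fun z : EuclideanSpace ℝ (Fin n) × EuclideanSpace ℝ (Fin n) =>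
      tailDensity s p u k x₀ R z.1 * ballExcess u k x₀ R z.2) := hTi.mul_prod hbi
  have j3 : ∫ z : EuclideanSpace ℝ (Fin n) × EuclideanSpace ℝ (Fin n),
      ballExcess u k x₀ R z.1 * tailDensity s p u k x₀ R z.2 =
      (∫ x, ballExcess u k x₀ R x) * ∫ x, tailDensity s p u k x₀ R x :=
    integral_prod_mul _ _
  have j4 : ∫ z : EuclideanSpace ℝ (Fin n) × EuclideanSpace ℝ (Fin n),
      tailDensity s p u k x₀ R z.1 * ballExcess u k x₀ R z.2 =
      (∫ x, tailDensity s p u k x₀ R x) * ∫ x, ballExcess u k x₀ R x :=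
    integral_prod_mul _ _
  have hNi : Integrable (caccioppoliError s p u k x₀ ρ R) :=
    (i1.add i2).add ((i3.add i4).const_mul _)
  have hNint : ∫ z, caccioppoliError s p u k x₀ ρ R z ≤
      2 * C * 2 ^ (n + s * p) * caccioppoliBound s p u k x₀ ρ R := by
    have e1 : ∫ z, caccioppoliError s p u k x₀ ρ R z =
        ((∫ z, ballExcess u k x₀ R z.1 ^ p * truncKernel n s p (2 / (R - ρ)) z) +
          ∫ z, ballExcess u k x₀ R z.2 ^ p * truncKernel n s p (2 / (R - ρ)) z) +
        (2 * R / (R - ρ)) ^ (n + s * p) * (2 * ((∫ x, tailDensity s p u k x₀ R x) *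
          ∫ x, ballExcess u k x₀ R x)) := by
      simp only [caccioppoliError]
      have a1 := integral_add (i1.add i2)
        ((i3.add i4).const_mul ((2 * R / (R - ρ)) ^ (n + s * p)))
      simp only [Pi.add_apply] at a1
      rw [a1, integral_add i1 i2,
        integral_const_mul, integral_add i3 i4, j3, j4]
      ring
    have e2 : ∫ x, tailDensity s p u k x₀ R x = tailIntegral n s p (excess u k) x₀ R :=
      integral_indicator measurableSet_ball.compl
    have e3 : ∫ x, ballExcess u k x₀ R x = ∫ x in Metric.ball x₀ R, excess u k x :=
      integral_indicator measurableSet_ball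
    rw [integral_ballExcess_rpow hp0] at j1 j2
    rw [e1, e2, e3, caccioppoliBound]
    set I1 := ∫ x in Metric.ball x₀ R, excess u k x ^ p
    set I2 := ∫ x in Metric.ball x₀ R, excess u k x
    set I3 := tailIntegral n s p (excess u k) x₀ R
    have hI1 : 0 ≤ I1 := integral_nonneg fun x => Real.rpow_nonneg (excess_nonneg u k x) _
    have hI2 : 0 ≤ I2 := integral_nonneg fun x => excess_nonneg u k x
    have hI3 : 0 ≤ I3 := integral_nonneg fun x =>
      mul_nonneg (Real.rpow_nonneg (excess_nonneg u k x) _) (by positivity)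
    have e4 : (2 / (R - ρ)) ^ (s * p) = 2 ^ (s * p) * (R - ρ) ^ (-(s * p)) := by
      rw [Real.div_rpow (by norm_num) hd.le, Real.rpow_neg hd.le, div_eq_mul_inv]
    have e5 : (2 * R / (R - ρ)) ^ (n + s * p) = 2 ^ (n + s * p) * (R / (R - ρ)) ^ (n + s * p) := by
      rw [mul_div_assoc, Real.mul_rpow (by norm_num) (by positivity)]
    have e6 : (2 : ℝ) ^ (s * p) ≤ 2 ^ (n + s * p) :=
      Real.rpow_le_rpow_of_exponent_le (by norm_num) (by
        have : (0 : ℝ) ≤ n := by positivity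
        linarith)
    rw [e4] at j1 j2
    rw [e5]
    have e7 : C * (2 ^ (s * p) * (R - ρ) ^ (-(s * p))) * I1 ≤
        C * (2 ^ (n + s * p) * (R - ρ) ^ (-(s * p))) * I1 := by gcongr
    have e8 : 2 ^ (n + s * p) * (R / (R - ρ)) ^ (n + s * p) * (2 * (I3 * I2)) ≤
        C * (2 ^ (n + s * p) * (R / (R - ρ)) ^ (n + s * p) * (2 * (I3 * I2))) :=
      le_mul_of_one_le_left (by positivity) hC.1
    linarith
  have hae : ∀ᵐ z : EuclideanSpace ℝ (Fin n) × EuclideanSpace ℝ (Fin n),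
      caccioppoliGain p u k x₀ ρ R z * homKernel n s p z ≤
      (gainConst p)⁻¹ * (K z.1 z.2 * |u z.1 - u z.2| ^ (p - 2) * (u z.1 - u z.2) *
        (excess u k z.1 * cutoff x₀ ρ R z.1 ^ p - excess u k z.2 * cutoff x₀ ρ R z.2 ^ p) +
      Lam * lossConst p * caccioppoliError s p u k x₀ ρ R z) := by
    filter_upwards [hK.ae_bounds hlam] with z hz
    rw [inv_mul_eq_div, le_div_iff₀ hG0, mul_comm]
    exact caccioppoli_pointwise hp hsp (hlam.trans hLam) hρ hρR u k x₀ z hz.1 hz.2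
  have hsumi := (hFi.add (hNi.const_mul (Lam * lossConst p))).const_mul (gainConst p)⁻¹
  simp only [Pi.add_apply] at hsumi
  refine (lintegral_mono_ae (hae.mono fun z hz => ENNReal.ofReal_le_ofReal hz)).trans ?_
  rw [← ofReal_integral_eq_lintegral_ofReal hsumi (hae.mono fun z hz => le_trans
    (mul_nonneg (caccioppoliGain_nonneg p u k x₀ ρ R z) (homKernel_nonneg n s p z)) hz)]
  refine ENNReal.ofReal_le_ofReal ?_
  rw [integral_const_mul]
  have e := integral_add hFi (hNi.const_mul (Lam * lossConst p))
  rw [integral_const_mul] at e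
  have e' := mul_le_mul_of_nonneg_left hNint (mul_nonneg (by linarith : 0 ≤ Lam) hL0.le)
  rw [caccioppoliConst, div_mul_eq_mul_div, div_eq_inv_mul]
  refine mul_le_mul_of_nonneg_left ?_ (by positivity)
  have hF0' : ∫ z : EuclideanSpace ℝ (Fin n) × EuclideanSpace ℝ (Fin n),
    K z.1 z.2 * |u z.1 - u z.2| ^ (p - 2) * (u z.1 - u z.2) *
        (excess u k z.1 * cutoff x₀ ρ R z.1 ^ p - excess u k z.2 * cutoff x₀ ρ R z.2 ^ p) ≤ 0 := hF0
  rw [e]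
  linarith

/-! ### Fractional Faber–Krahn inequality and De Giorgi classes -/

/-- The volume of the unit ball of `ℝⁿ`. -/
def unitBallVolume (n : ℕ) : ℝ := volume.real (Metric.ball (0 : EuclideanSpace ℝ (Fin n)) 1)

lemma unitBallVolume_pos (n : ℕ) : 0 < unitBallVolume n :=
  ENNReal.toReal_pos (Metric.measure_ball_pos _ _ one_pos).ne' measure_ball_lt_top.ne

lemma volume_real_ball {n : ℕ} (x : EuclideanSpace ℝ (Fin n)) {t : ℝ} (ht : 0 < t) :
    volume.real (Metric.ball x t) = t ^ (n : ℝ) * unitBallVolume n := by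
  rw [unitBallVolume, Measure.real, Measure.addHaar_ball_of_pos _ _ ht, finrank_euclideanSpace_fin,
    ENNReal.toReal_mul, ENNReal.toReal_ofReal (by positivity), Real.rpow_natCast, Measure.real]

/-- A fractional Faber–Krahn inequality: if `f` vanishes on at least half of every ball of radius
`t`, its `Lᵖ` norm is controlled by its Gagliardo seminorm. For each `x` it suffices to integrate
the seminorm over the zero set of `f` in `B_t(x)`. It takes the place of the Sobolev embedding. -/
lemma faber_krahn {n : ℕ} {s p t : ℝ} (hp : 1 < p) (hsp : 0 ≤ s * p) (ht : 0 < t)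
    {f : EuclideanSpace ℝ (Fin n) → ℝ} (hf : Measurable f)
    (h : 2 * volume {x | f x ≠ 0} ≤ volume (Metric.ball (0 : EuclideanSpace ℝ (Fin n)) t)) :
    (∫⁻ x, ENNReal.ofReal (|f x| ^ p)) * ENNReal.ofReal (t ^ (-(s * p)) * (unitBallVolume n / 2)) ≤
      ∫⁻ z : EuclideanSpace ℝ (Fin n) × EuclideanSpace ℝ (Fin n),
        ENNReal.ofReal (|f z.1 - f z.2| ^ p * homKernel n s p z) := by
  have hq : 0 ≤ (n : ℝ) + s * p := by positivity
  have hω := unitBallVolume_pos n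
  rw [Measure.volume_eq_prod, lintegral_prod _ (by fun_prop),
    ← lintegral_mul_const' _ _ ENNReal.ofReal_ne_top]
  refine lintegral_mono fun x => ?_
  by_cases hx : f x = 0
  · simp [hx, Real.zero_rpow (by linarith : p ≠ 0)]
  have hball : ∀ y : EuclideanSpace ℝ (Fin n), volume (Metric.ball y t) =
      ENNReal.ofReal (t ^ (n : ℝ) * (unitBallVolume n / 2)) +
      ENNReal.ofReal (t ^ (n : ℝ) * (unitBallVolume n / 2)) := fun y => by
    rw [← ENNReal.ofReal_add (by positivity) (by positivity), ← mul_add, add_halves,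
      ← volume_real_ball y ht, ofReal_measureReal measure_ball_lt_top.ne]
  set S := Metric.ball x t ∩ {y | f y = 0} with hS
  have hSm : MeasurableSet S := measurableSet_ball.inter (hf (measurableSet_singleton 0))
  have hvS : ENNReal.ofReal (t ^ (n : ℝ) * (unitBallVolume n / 2)) ≤ volume S := by
    have h1 : Metric.ball x t ⊆ S ∪ {y | f y ≠ 0} := fun y hy => by
      by_cases hy0 : f y = 0
      · exact Or.inl ⟨hy, hy0⟩
      · exact Or.inr hy0
    have h2 := (measure_mono h1).trans (measure_union_le (μ := volume) _ _)
    rw [hball, two_mul] at h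
    have h3 : volume {y | f y ≠ 0} ≤ ENNReal.ofReal (t ^ (n : ℝ) * (unitBallVolume n / 2)) := by
      by_contra hcon
      rw [not_le] at hcon
      exact absurd h (not_le.2 (ENNReal.add_lt_add hcon hcon))
    rw [hball] at h2
    exact (ENNReal.add_le_add_iff_right ENNReal.ofReal_ne_top).1
      (h2.trans (add_le_add le_rfl h3))
  calc ENNReal.ofReal (|f x| ^ p) * ENNReal.ofReal (t ^ (-(s * p)) * (unitBallVolume n / 2))
      = ENNReal.ofReal (|f x| ^ p * t ^ (-(n + s * p))) *
        ENNReal.ofReal (t ^ (n : ℝ) * (unitBallVolume n / 2)) := by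
        rw [← ENNReal.ofReal_mul (by positivity), ← ENNReal.ofReal_mul (by positivity)]
        congr 1
        have : t ^ (-(s * p)) = t ^ (-(n + s * p)) * t ^ (n : ℝ) := by
          rw [← Real.rpow_add ht]; congr 1; ring
        rw [this]; ring
    _ ≤ ENNReal.ofReal (|f x| ^ p * t ^ (-(n + s * p))) * volume S := by gcongr
    _ = ∫⁻ _ in S, ENNReal.ofReal (|f x| ^ p * t ^ (-(n + s * p))) := by
        rw [setLIntegral_const]
    _ ≤ ∫⁻ y in S, ENNReal.ofReal (|f x - f y| ^ p * homKernel n s p (x, y)) := by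
        refine setLIntegral_mono (by fun_prop) fun y hy => ENNReal.ofReal_le_ofReal ?_
        have hy0 : f y = 0 := hy.2
        have hxy : x ≠ y := fun e => hx (e ▸ hy0)
        rw [hy0, sub_zero]
        refine mul_le_mul_of_nonneg_left ?_ (by positivity)
        refine Real.rpow_le_rpow_of_nonpos (norm_pos_iff.2 (sub_ne_zero.2 hxy)) ?_ (by linarith)
        have := hy.1
        rw [Metric.mem_ball, dist_comm, dist_eq_norm] at this
        exact this.le
    _ ≤ ∫⁻ y, ENNReal.ofReal (|f x - f y| ^ p * homKernel n s p (x, y)) :=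
        setLIntegral_le_lintegral _ _

/-- Nonlocal De Giorgi class: the two consequences of the Caccioppoli inequality on which the
regularity theory rests. The field `level` combines its Gagliardo term with the Faber–Krahn
inequality, and `mixed` is its mixed term. -/
structure DeGiorgiClass (n : ℕ) (s p H : ℝ) (Ω : Set (EuclideanSpace ℝ (Fin n)))
    (u : EuclideanSpace ℝ (Fin n) → ℝ) : Prop where
  measurable : Measurable u
  memLp : MemLp u (ENNReal.ofReal p) volume
  level : ∀ (x₀ : EuclideanSpace ℝ (Fin n)) (ρ R k t : ℝ), 0 < ρ → ρ < R →
    Metric.ball x₀ R ⊆ Ω → 0 < t →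
    2 * volume.real (Metric.ball x₀ R ∩ {x | k < u x}) ≤ t ^ (n : ℝ) * unitBallVolume n →
    ∫ x in Metric.ball x₀ ρ, excess u k x ^ p ≤ H * t ^ (s * p) * caccioppoliBound s p u k x₀ ρ R
  mixed : ∀ (x₀ : EuclideanSpace ℝ (Fin n)) (ρ R k h : ℝ), 0 < ρ → ρ < R →
    Metric.ball x₀ R ⊆ Ω → 0 ≤ h →
    (∫ x in Metric.ball x₀ ρ, excess u k x) *
      (h ^ (p - 1) * volume.real (Metric.ball x₀ ρ ∩ {x | u x ≤ k - h})) ≤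
      H * (2 * ρ) ^ (n + s * p) * caccioppoliBound s p u k x₀ ρ R

lemma tailIntegral_nonneg {n : ℕ} (s p : ℝ) (u : EuclideanSpace ℝ (Fin n) → ℝ) (k : ℝ)
    (x₀ : EuclideanSpace ℝ (Fin n)) (R : ℝ) : 0 ≤ tailIntegral n s p (excess u k) x₀ R :=
  integral_nonneg fun x =>
    mul_nonneg (Real.rpow_nonneg (excess_nonneg u k x) _) (by positivity)

lemma caccioppoliBound_nonneg {n : ℕ} (s p : ℝ) (u : EuclideanSpace ℝ (Fin n) → ℝ) (k : ℝ)
    (x₀ : EuclideanSpace ℝ (Fin n)) {ρ R : ℝ} (hρ : 0 < ρ) (hρR : ρ < R) :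
    0 ≤ caccioppoliBound s p u k x₀ ρ R := by
  have h1 : 0 ≤ ∫ x in Metric.ball x₀ R, excess u k x ^ p :=
    integral_nonneg fun x => Real.rpow_nonneg (excess_nonneg u k x) _
  have h2 : 0 ≤ ∫ x in Metric.ball x₀ R, excess u k x :=
    integral_nonneg fun x => excess_nonneg u k x
  have h3 := tailIntegral_nonneg s p u k x₀ R
  have hd : 0 < R - ρ := by linarith
  have hR : 0 < R := by linarith
  unfold caccioppoliBound
  positivity

lemma integrableOn_excess {n : ℕ} {p : ℝ} (hp : 1 < p) {u : EuclideanSpace ℝ (Fin n) → ℝ}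
    (hu : Measurable u) (hup : MemLp u (ENNReal.ofReal p) volume) (k : ℝ)
    (x₀ : EuclideanSpace ℝ (Fin n)) (R : ℝ) : IntegrableOn (excess u k) (Metric.ball x₀ R) :=
  (integrable_indicator_iff measurableSet_ball).1 (integrable_ballExcess k x₀ R hp hu hup)

lemma integrableOn_excess_rpow {n : ℕ} {p : ℝ} (hp : 1 < p) {u : EuclideanSpace ℝ (Fin n) → ℝ}
    (hu : Measurable u) (hup : MemLp u (ENNReal.ofReal p) volume) (k : ℝ)
    (x₀ : EuclideanSpace ℝ (Fin n)) (R : ℝ) :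
    IntegrableOn (fun x => excess u k x ^ p) (Metric.ball x₀ R) := by
  refine (integrable_ballExcess_rpow k x₀ R hp hu hup).integrableOn.congr_fun (fun x hx => ?_)
    measurableSet_ball
  simp only [ballExcess, indicator_of_mem hx]

lemma deGiorgiClass_of_isTestSubsolution {n : ℕ} {s p lam Lam C : ℝ} (hp : 1 < p)
    (hsp : 0 ≤ s * p) (hlam : 1 ≤ lam)
    (hLam : lam ≤ Lam) (hC : IsKernelConst n s p C)
    {K : EuclideanSpace ℝ (Fin n) → EuclideanSpace ℝ (Fin n) → ℝ}
    (hK : IsEllipticKernel n s p lam Lam K) {Ω : Set (EuclideanSpace ℝ (Fin n))}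
    {u : EuclideanSpace ℝ (Fin n) → ℝ} (hu : Measurable u)
    (hsub : IsTestSubsolution n s p K Ω u) :
    DeGiorgiClass n s p (caccioppoliConst n s p Lam C * (1 + 2 / unitBallVolume n)) Ω u := by
  have hp0 : p ≠ 0 := by linarith
  have hω := unitBallVolume_pos n
  have hC0 : 0 < C := zero_lt_one.trans_le hC.1
  have hG0 := gainConst_pos p
  have hL0 : 0 < lossConst p := by linarith [two_le_lossConst p hp]
  have hCc : 0 < caccioppoliConst n s p Lam C := by
    have : 0 < Lam := by linarith
    unfold caccioppoliConst; positivity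
  refine ⟨hu, hsub.1.1, fun x₀ ρ R k t hρ hρR hΩ ht hvol => ?_,
    fun x₀ ρ R k h hρ hρR hΩ hh => ?_⟩
  · have hcac := caccioppoli hp hsp hlam hLam hC hK hu hsub hρ hρR hΩ k
    have hQ := caccioppoliBound_nonneg s p u k x₀ hρ hρR
    set Q := caccioppoliBound s p u k x₀ ρ R
    set Cc := caccioppoliConst n s p Lam C
    set f : EuclideanSpace ℝ (Fin n) → ℝ := fun x => excess u k x * cutoff x₀ ρ R x with hfdef
    have hf : Measurable f := by fun_prop
    have hsupp : {x | f x ≠ 0} ⊆ Metric.ball x₀ R ∩ {x | k < u x} := fun x hx => by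
      simp only [hfdef, mem_ofPred_eq, ne_eq, mul_eq_zero, not_or] at hx
      refine ⟨by_contra fun h => hx.2 (cutoff_eq_zero_of_notMem x₀ hρR h), ?_⟩
      by_contra h
      simp only [mem_ofPred_eq, not_lt] at h
      exact hx.1 (max_eq_right (by linarith))
    have hfin : volume (Metric.ball x₀ R ∩ {x | k < u x}) ≠ ⊤ :=
      ((measure_mono inter_subset_left).trans_lt measure_ball_lt_top).ne
    have hv2 : 2 * volume {x | f x ≠ 0} ≤
        volume (Metric.ball (0 : EuclideanSpace ℝ (Fin n)) t) := by
      calc 2 * volume {x | f x ≠ 0} ≤ 2 * volume (Metric.ball x₀ R ∩ {x | k < u x}) := by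
            gcongr
        _ = ENNReal.ofReal (2 * volume.real (Metric.ball x₀ R ∩ {x | k < u x})) := by
            rw [ENNReal.ofReal_mul (by norm_num), ofReal_measureReal hfin]; simp
        _ ≤ ENNReal.ofReal (t ^ (n : ℝ) * unitBallVolume n) := ENNReal.ofReal_le_ofReal hvol
        _ = _ := by
            rw [← volume_real_ball 0 ht, ofReal_measureReal measure_ball_lt_top.ne]
    have hfk := faber_krahn hp hsp ht hf hv2
    have h1 : ∫⁻ z, ENNReal.ofReal (|f z.1 - f z.2| ^ p * homKernel n s p z) ≤
        ENNReal.ofReal (Cc * Q) := by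
      refine (lintegral_mono fun z => ENNReal.ofReal_le_ofReal ?_).trans hcac
      refine mul_le_mul_of_nonneg_right ?_ (homKernel_nonneg n s p z)
      exact le_add_of_nonneg_right (mul_nonneg (Real.rpow_nonneg (excess_nonneg _ _ _) _)
        (mul_nonneg (excess_nonneg _ _ _) (Real.rpow_nonneg (cutoff_nonneg _ _ _ _) _)))
    have h2 : ENNReal.ofReal (∫ x in Metric.ball x₀ ρ, excess u k x ^ p) ≤
        ∫⁻ x, ENNReal.ofReal (|f x| ^ p) := by
      rw [ofReal_integral_eq_lintegral_ofReal (integrableOn_excess_rpow hp hu hsub.1.1 k x₀ ρ)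
        (Filter.Eventually.of_forall fun x => Real.rpow_nonneg (excess_nonneg u k x) _)]
      refine le_trans ?_ (setLIntegral_le_lintegral (Metric.ball x₀ ρ) _)
      refine setLIntegral_mono (by fun_prop) fun x hx => ENNReal.ofReal_le_ofReal ?_
      simp only [hfdef]
      rw [cutoff_eq_one x₀ hρR hx, mul_one, abs_of_nonneg (excess_nonneg _ _ _)]
    have h3 := (mul_le_mul_left h2 _).trans (hfk.trans h1)
    have hI : 0 ≤ ∫ x in Metric.ball x₀ ρ, excess u k x ^ p :=
      integral_nonneg fun x => Real.rpow_nonneg (excess_nonneg u k x) _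
    rw [← ENNReal.ofReal_mul hI, ENNReal.ofReal_le_ofReal_iff (by positivity)] at h3
    set I := ∫ x in Metric.ball x₀ ρ, excess u k x ^ p
    have h4 : I ≤ 2 / unitBallVolume n * t ^ (s * p) * (Cc * Q) := by
      have e : I = 2 / unitBallVolume n * t ^ (s * p) *
          (I * (t ^ (-(s * p)) * (unitBallVolume n / 2))) := by
        rw [Real.rpow_neg ht.le]
        have : t ^ (s * p) ≠ 0 := by positivity
        field_simp
      rw [e]
      exact mul_le_mul_of_nonneg_left h3 (by positivity)
    refine h4.trans ?_
    have : 0 ≤ t ^ (s * p) * (Cc * Q) := by positivity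
    linarith
  · have hcac := caccioppoli hp hsp hlam hLam hC hK hu hsub hρ hρR hΩ k
    have hQ := caccioppoliBound_nonneg s p u k x₀ hρ hρR
    set Q := caccioppoliBound s p u k x₀ ρ R
    set Cc := caccioppoliConst n s p Lam C
    have hSm : MeasurableSet (Metric.ball x₀ ρ ∩ {x | u x ≤ k - h}) :=
      measurableSet_ball.inter (measurableSet_le hu measurable_const)
    set S := Metric.ball x₀ ρ ∩ {x | u x ≤ k - h} with hS
    have hSfin : volume S ≠ ⊤ :=
      ((measure_mono inter_subset_left).trans_lt measure_ball_lt_top).ne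
    set c : ℝ := h ^ (p - 1) * (2 * ρ) ^ (-(n + s * p)) with hc
    have hc0 : 0 ≤ c := by positivity
    have hpt : ∀ z : EuclideanSpace ℝ (Fin n) × EuclideanSpace ℝ (Fin n),
        (Metric.ball x₀ ρ).indicator (fun x => ENNReal.ofReal (excess u k x)) z.1 *
          S.indicator (fun _ => ENNReal.ofReal c) z.2 ≤
        ENNReal.ofReal (caccioppoliGain p u k x₀ ρ R z * homKernel n s p z) := by
      rintro ⟨x, y⟩
      by_cases hx : x ∈ Metric.ball x₀ ρ
      swap
      · simp [hx]
      by_cases hy : y ∈ S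
      swap
      · simp [hy]
      simp only [indicator_of_mem hx, indicator_of_mem hy]
      rw [← ENNReal.ofReal_mul (excess_nonneg _ _ _)]
      refine ENNReal.ofReal_le_ofReal ?_
      have hyk : u y ≤ k - h := hy.2
      by_cases hxy : x = y
      · have : excess u k x = 0 := max_eq_right (by rw [hxy]; linarith)
        rw [this, zero_mul]
        exact mul_nonneg (caccioppoliGain_nonneg _ _ _ _ _ _ _) (homKernel_nonneg _ _ _ _)
      have h1 : h ^ (p - 1) ≤ excess (-u) (-k) y ^ (p - 1) :=
        Real.rpow_le_rpow hh (le_max_of_le_left (by simp only [Pi.neg_apply]; linarith))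
          (by linarith)
      have h2 : (2 * ρ) ^ (-(n + s * p)) ≤ homKernel n s p (x, y) := by
        refine Real.rpow_le_rpow_of_nonpos (norm_pos_iff.2 (sub_ne_zero.2 hxy)) ?_ (by
          have : (0 : ℝ) ≤ n := by positivity
          linarith)
        have a := hx
        have b := hy.1
        rw [Metric.mem_ball] at a b
        have := dist_triangle_right x y x₀
        rw [dist_eq_norm] at this
        simp only
        linarith
      have h3 : excess u k x * h ^ (p - 1) ≤ caccioppoliGain p u k x₀ ρ R (x, y) := by
        simp only [caccioppoliGain, cutoff_eq_one x₀ hρR hx, Real.one_rpow, mul_one]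
        have := mul_le_mul_of_nonneg_right h1 (excess_nonneg u k x)
        have h5 : 0 ≤ |excess u k x - excess u k y * cutoff x₀ ρ R y| ^ p := by positivity
        linarith
      calc excess u k x * c = excess u k x * h ^ (p - 1) * (2 * ρ) ^ (-(n + s * p)) := by
            rw [hc]; ring
        _ ≤ _ := mul_le_mul h3 h2 (by positivity) (caccioppoliGain_nonneg _ _ _ _ _ _ _)
    have h1 := (lintegral_mono hpt).trans hcac
    rw [Measure.volume_eq_prod, lintegral_prod_mul
      ((hu.excess k).ennreal_ofReal.indicator measurableSet_ball).aemeasurable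
      (measurable_const.indicator hSm).aemeasurable, lintegral_indicator measurableSet_ball,
      lintegral_indicator_const hSm,
      ← ofReal_integral_eq_lintegral_ofReal (integrableOn_excess hp hu hsub.1.1 k x₀ ρ)
        (Filter.Eventually.of_forall fun x => excess_nonneg u k x),
      ← ofReal_measureReal hSfin, ← ENNReal.ofReal_mul hc0,
      ← ENNReal.ofReal_mul (integral_nonneg fun x => excess_nonneg u k x),
      ENNReal.ofReal_le_ofReal_iff (by positivity)] at h1
    set I := ∫ x in Metric.ball x₀ ρ, excess u k x
    have e : I * (h ^ (p - 1) * volume.real S) =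
        (2 * ρ) ^ (n + s * p) * (I * (c * volume.real S)) := by
      rw [hc, Real.rpow_neg (by positivity)]
      have : (2 * ρ) ^ (n + s * p) ≠ 0 := by positivity
      field_simp
    rw [e]
    refine (mul_le_mul_of_nonneg_left h1 (by positivity)).trans ?_
    have h5 : 0 ≤ (2 * ρ) ^ (n + s * p) * (Cc * Q) * (2 / unitBallVolume n) := by positivity
    linarith

/-! ### Local boundedness by De Giorgi's iteration -/

lemma excess_anti {α : Type*} (u : α → ℝ) {k l : ℝ} (h : k ≤ l) (x : α) :
    excess u l x ≤ excess u k x := max_le_max (by linarith) le_rfl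

section Chebyshev

variable {n : ℕ} {p : ℝ} {u : EuclideanSpace ℝ (Fin n) → ℝ}

lemma setIntegral_excess_rpow_mono (hp : 1 < p) (hu : Measurable u)
    (hup : MemLp u (ENNReal.ofReal p) volume) {k l : ℝ} (hkl : k ≤ l)
    (x₀ : EuclideanSpace ℝ (Fin n)) {ρ R : ℝ} (hρR : ρ ≤ R) :
    ∫ x in Metric.ball x₀ ρ, excess u l x ^ p ≤ ∫ x in Metric.ball x₀ R, excess u k x ^ p := by
  refine (integral_mono (integrableOn_excess_rpow hp hu hup l x₀ ρ)
    (integrableOn_excess_rpow hp hu hup k x₀ ρ) fun x =>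
      Real.rpow_le_rpow (excess_nonneg u l x) (excess_anti u hkl x) (by linarith)).trans ?_
  exact setIntegral_mono_set (integrableOn_excess_rpow hp hu hup k x₀ R)
    (Filter.Eventually.of_forall fun x => Real.rpow_nonneg (excess_nonneg u k x) _)
    (Metric.ball_subset_ball hρR).eventuallyLE

lemma volume_superlevel_mul_le (hp : 1 < p) (hu : Measurable u)
    (hup : MemLp u (ENNReal.ofReal p) volume) {k l : ℝ} (hkl : k ≤ l)
    (x₀ : EuclideanSpace ℝ (Fin n)) (R : ℝ) :
    (l - k) ^ p * volume.real (Metric.ball x₀ R ∩ {x | l < u x}) ≤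
      ∫ x in Metric.ball x₀ R, excess u k x ^ p := by
  have hm : MeasurableSet (Metric.ball x₀ R ∩ {x | l < u x}) :=
    measurableSet_ball.inter (measurableSet_lt measurable_const hu)
  have hfin : volume (Metric.ball x₀ R ∩ {x | l < u x}) ≠ ⊤ :=
    ((measure_mono inter_subset_left).trans_lt measure_ball_lt_top).ne
  have hi := integrableOn_excess_rpow hp hu hup k x₀ R
  calc (l - k) ^ p * volume.real (Metric.ball x₀ R ∩ {x | l < u x})
      = ∫ _ in Metric.ball x₀ R ∩ {x | l < u x}, (l - k) ^ p := by
        rw [setIntegral_const, smul_eq_mul, mul_comm]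
    _ ≤ ∫ x in Metric.ball x₀ R ∩ {x | l < u x}, excess u k x ^ p := by
        refine setIntegral_mono_on (integrableOn_const hfin) (hi.mono_set inter_subset_left) hm
          fun x hx => ?_
        have : l < u x := hx.2
        exact Real.rpow_le_rpow (by linarith) (le_max_of_le_left (by linarith)) (by linarith)
    _ ≤ _ := setIntegral_mono_set hi
        (Filter.Eventually.of_forall fun x => Real.rpow_nonneg (excess_nonneg u k x) _)
        inter_subset_left.eventuallyLE

lemma setIntegral_excess_mul_le (hp : 1 < p) (hu : Measurable u)
    (hup : MemLp u (ENNReal.ofReal p) volume) {k l : ℝ} (hkl : k ≤ l)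
    (x₀ : EuclideanSpace ℝ (Fin n)) (R : ℝ) :
    (l - k) ^ (p - 1) * (∫ x in Metric.ball x₀ R, excess u l x) ≤
      ∫ x in Metric.ball x₀ R, excess u k x ^ p := by
  rw [← integral_const_mul]
  refine integral_mono ((integrableOn_excess hp hu hup l x₀ R).const_mul _)
    (integrableOn_excess_rpow hp hu hup k x₀ R) fun x => ?_
  simp only
  rw [← rpow_sub_one_mul_self hp (excess_nonneg u k x)]
  rcases le_or_gt (u x) l with h | h
  · have : excess u l x = 0 := max_eq_right (by linarith)
    rw [this, mul_zero]
    exact mul_nonneg (Real.rpow_nonneg (excess_nonneg u k x) _) (excess_nonneg u k x)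
  · refine mul_le_mul ?_ (excess_anti u hkl x) (excess_nonneg u l x)
      (Real.rpow_nonneg (excess_nonneg u k x) _)
    exact Real.rpow_le_rpow (by linarith) (le_max_of_le_left (by linarith)) (by linarith)

end Chebyshev

section Tail

variable {n : ℕ} {s p C : ℝ} {u : EuclideanSpace ℝ (Fin n) → ℝ}

lemma integrableOn_tail_excess (hC : IsKernelConst n s p C) (hp : 1 < p) (hsp : 0 ≤ s * p)
    (hu : Measurable u) (hup : MemLp u (ENNReal.ofReal p) volume) {R : ℝ} (hR : 0 < R) (k : ℝ)
    (x₀ : EuclideanSpace ℝ (Fin n)) :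
    IntegrableOn (fun y => excess u k y ^ (p - 1) * ‖y - x₀‖ ^ (-(n + s * p)))
      (Metric.ball x₀ R)ᶜ :=
  integrableOn_tail hC hp hsp hR hup (hu.excess k) (excess_nonneg u k) (abs_nonneg k)
    (excess_le u k) x₀

lemma tailIntegral_mono (hC : IsKernelConst n s p C) (hp : 1 < p) (hsp : 0 ≤ s * p)
    (hu : Measurable u) (hup : MemLp u (ENNReal.ofReal p) volume) {r R : ℝ} (hr : 0 < r)
    (hrR : r ≤ R) {k l : ℝ} (hkl : k ≤ l) (x₀ : EuclideanSpace ℝ (Fin n)) :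
    tailIntegral n s p (excess u l) x₀ R ≤ tailIntegral n s p (excess u k) x₀ r := by
  have hi := integrableOn_tail_excess hC hp hsp hu hup hr k x₀
  refine (integral_mono (integrableOn_tail_excess hC hp hsp hu hup (hr.trans_le hrR) l x₀)
    (hi.mono_set (compl_subset_compl.2 (Metric.ball_subset_ball hrR))) fun y => ?_).trans
    (setIntegral_mono_set hi (Filter.Eventually.of_forall fun y =>
      mul_nonneg (Real.rpow_nonneg (excess_nonneg u k y) _) (by positivity))
      (compl_subset_compl.2 (Metric.ball_subset_ball hrR)).eventuallyLE)
  exact mul_le_mul_of_nonneg_right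
    (Real.rpow_le_rpow (excess_nonneg u l y) (excess_anti u hkl y) (by linarith)) (by positivity)

/-- Lowering the level by `g` changes the tail by at most the tail of the constant `g`. -/
lemma tailIntegral_lower_level (hC : IsKernelConst n s p C) (hp : 1 < p) (hsp : 0 ≤ s * p)
    (hu : Measurable u) (hup : MemLp u (ENNReal.ofReal p) volume) {R : ℝ} (hR : 0 < R) {g : ℝ}
    (hg : 0 ≤ g) (l : ℝ) (x₀ : EuclideanSpace ℝ (Fin n)) :
    tailIntegral n s p (excess u (l - g)) x₀ R ≤
      2 ^ (p - 1) *
        (tailIntegral n s p (excess u l) x₀ R + g ^ (p - 1) * (C * R ^ (-(s * p)))) := by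
  have hi := integrableOn_tail_excess hC hp hsp hu hup hR l x₀
  obtain ⟨i1, i2⟩ := integrableOn_compl_ball hC hR x₀
  have h1 : tailIntegral n s p (excess u (l - g)) x₀ R ≤
      ∫ y in (Metric.ball x₀ R)ᶜ, 2 ^ (p - 1) *
        (excess u l y ^ (p - 1) * ‖y - x₀‖ ^ (-(n + s * p)) +
          g ^ (p - 1) * ‖y - x₀‖ ^ (-(n + s * p))) := by
    refine integral_mono (integrableOn_tail_excess hC hp hsp hu hup hR (l - g) x₀)
      ((hi.add (i1.const_mul _)).const_mul _) fun y => ?_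
    simp only
    rw [← add_mul, ← mul_assoc]
    refine mul_le_mul_of_nonneg_right ?_ (by positivity)
    refine le_trans (Real.rpow_le_rpow (excess_nonneg _ _ _) ?_ (by linarith))
      (rpow_add_le_two_rpow_mul (by linarith) (excess_nonneg u l y) hg)
    refine max_le ?_ (add_nonneg (excess_nonneg u l y) hg)
    have : u y - l ≤ excess u l y := le_max_left _ _
    linarith
  refine h1.trans ?_
  rw [integral_const_mul, integral_add hi (i1.const_mul _), integral_const_mul]
  refine mul_le_mul_of_nonneg_left (add_le_add le_rfl ?_) (by positivity)
  exact mul_le_mul_of_nonneg_left i2 (by positivity)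

lemma tailIntegral_le_of_ae_le (hC : IsKernelConst n s p C) (hp : 1 < p) (hsp : 0 ≤ s * p)
    (hu : Measurable u) (hup : MemLp u (ENNReal.ofReal p) volume) {r R : ℝ} (hr : 0 < r)
    (hrR : r ≤ R) {k : ℝ} {x₀ : EuclideanSpace ℝ (Fin n)}
    (hk : ∀ᵐ x, x ∈ Metric.ball x₀ R → u x ≤ k) :
    tailIntegral n s p (excess u k) x₀ r ≤ tailIntegral n s p (excess u k) x₀ R := by
  have hi := integrableOn_tail_excess hC hp hsp hu hup hr k x₀
  refine le_of_eq ?_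
  unfold tailIntegral
  rw [← integral_indicator measurableSet_ball.compl, ← integral_indicator measurableSet_ball.compl]
  refine integral_congr_ae ?_
  filter_upwards [hk] with x hx
  by_cases h1 : x ∈ Metric.ball x₀ R
  · have : excess u k x = 0 := max_eq_right (by linarith [hx h1])
    rw [indicator_of_notMem (by simpa using h1 : x ∉ (Metric.ball x₀ R)ᶜ)]
    by_cases h2 : x ∈ Metric.ball x₀ r
    · rw [indicator_of_notMem (by simpa using h2)]
    · rw [indicator_of_mem (by simpa using h2), this, Real.zero_rpow (by linarith), zero_mul]
  · have h2 : x ∉ Metric.ball x₀ r := fun h => h1 (Metric.ball_subset_ball hrR h)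
    rw [indicator_of_mem (show x ∈ (Metric.ball x₀ r)ᶜ from h2),
      indicator_of_mem (show x ∈ (Metric.ball x₀ R)ᶜ from h1)]

end Tail

/-- One step of the iteration: between consecutive radii and levels, the Caccioppoli bound is
controlled by the excess over the lower level. The number `ε` is the relative size of the step. -/
lemma caccioppoliBound_le {n : ℕ} {s p A C : ℝ} (hC : IsKernelConst n s p C) (hp : 1 < p)
    (hs : 0 < s) (hA : 0 ≤ A) {u : EuclideanSpace ℝ (Fin n) → ℝ} (hu : Measurable u)
    (hup : MemLp u (ENNReal.ofReal p) volume) {x₀ : EuclideanSpace ℝ (Fin n)}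
    {r κ k k₁ k₂ ρ R ε : ℝ} (hr : 0 < r) (hκ : 0 < κ)
    (htail : r ^ (s * p) * tailIntegral n s p (excess u k) x₀ r ≤ A * κ ^ (p - 1))
    (hε0 : 0 < ε) (hε1 : ε ≤ 1) (hRρ : R - ρ = r * ε) (hrR : r ≤ R)
    (hR2 : R ≤ 2 * r) (hk02 : k ≤ k₂) (hk21 : k₂ - k₁ = κ * ε) :
    caccioppoliBound s p u k₂ x₀ ρ R ≤
      r ^ (-(s * p)) * ((1 + A) * (2 / ε) ^ (n + s * p + p)) *
        ∫ x in Metric.ball x₀ R, excess u k₁ x ^ p := by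
  have hp0 : 0 < p := by linarith
  have hsp : 0 < s * p := by positivity
  have hrε : 0 < r * ε := by positivity
  have hκε : 0 < κ * ε := by positivity
  have hR0 : 0 < R := by linarith
  have hk12 : k₁ ≤ k₂ := by linarith
  set q : ℝ := n + s * p with hq
  have hq0 : 0 < q := by positivity
  have b1 : ∫ x in Metric.ball x₀ R, excess u k₂ x ^ p ≤
      ∫ x in Metric.ball x₀ R, excess u k₁ x ^ p :=
    setIntegral_excess_rpow_mono hp hu hup hk12 x₀ le_rfl
  have b2 := setIntegral_excess_mul_le hp hu hup hk12 x₀ R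
  rw [hk21] at b2
  have ha0 : 0 ≤ ∫ x in Metric.ball x₀ R, excess u k₁ x ^ p :=
    integral_nonneg fun x => Real.rpow_nonneg (excess_nonneg _ _ _) _
  have b0 : 0 ≤ ∫ x in Metric.ball x₀ R, excess u k₂ x ^ p :=
    integral_nonneg fun x => Real.rpow_nonneg (excess_nonneg _ _ _) _
  have b3 := tailIntegral_mono hC hp hsp.le hu hup hr hrR hk02 x₀
  have b4 : 0 ≤ ∫ x in Metric.ball x₀ R, excess u k₂ x :=
    integral_nonneg fun x => excess_nonneg _ _ _
  have b5 := tailIntegral_nonneg s p u k₂ x₀ R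
  have b6 : tailIntegral n s p (excess u k₂) x₀ R ≤ r ^ (-(s * p)) * (A * κ ^ (p - 1)) := by
    refine b3.trans ?_
    rw [Real.rpow_neg hr.le, inv_mul_eq_div, le_div_iff₀ (by positivity)]
    linarith
  rw [caccioppoliBound, ← hq]
  generalize (∫ x in Metric.ball x₀ R, excess u k₁ x ^ p) = a at *
  generalize (∫ x in Metric.ball x₀ R, excess u k₂ x ^ p) = a' at *
  generalize (∫ x in Metric.ball x₀ R, excess u k₂ x) = b at *
  generalize tailIntegral n s p (excess u k₂) x₀ R = T at *
  have b7 : b ≤ ((κ * ε) ^ (p - 1))⁻¹ * a := by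
    rw [inv_mul_eq_div, le_div_iff₀ (by positivity)]
    linarith
  have b8 : (R / (R - ρ)) ^ q ≤ (2 / ε) ^ q := by
    refine Real.rpow_le_rpow (by rw [hRρ]; positivity) ?_ hq0.le
    rw [hRρ, div_le_div_iff₀ hrε hε0]
    nlinarith
  have h2ε : 1 ≤ 2 / ε := by rw [le_div_iff₀ hε0]; linarith
  have hinv : ε⁻¹ ≤ 2 / ε := by
    rw [div_eq_mul_inv]
    exact le_mul_of_one_le_left (by positivity) (by norm_num)
  have b9 : (R - ρ) ^ (-(s * p)) ≤ r ^ (-(s * p)) * (2 / ε) ^ (q + p) := by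
    rw [hRρ, Real.mul_rpow hr.le hε0.le]
    refine mul_le_mul_of_nonneg_left ?_ (by positivity)
    rw [Real.rpow_neg hε0.le, ← Real.inv_rpow hε0.le]
    have hn : (0 : ℝ) ≤ n := by positivity
    exact (Real.rpow_le_rpow (inv_nonneg.2 hε0.le) hinv hsp.le).trans
      (Real.rpow_le_rpow_of_exponent_le h2ε (by rw [hq]; linarith))
  have b10 : (2 / ε) ^ q * (κ ^ (p - 1) * ((κ * ε) ^ (p - 1))⁻¹) ≤ (2 / ε) ^ (q + p) := by
    have e1 : κ ^ (p - 1) * ((κ * ε) ^ (p - 1))⁻¹ = (ε⁻¹) ^ (p - 1) := by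
      rw [Real.mul_rpow hκ.le hε0.le, Real.inv_rpow hε0.le]
      have : κ ^ (p - 1) ≠ 0 := by positivity
      field_simp
    rw [e1, Real.rpow_add (by positivity : 0 < 2 / ε) q p]
    refine mul_le_mul_of_nonneg_left ?_ (by positivity)
    exact (Real.rpow_le_rpow (inv_nonneg.2 hε0.le) hinv (by linarith)).trans
      (Real.rpow_le_rpow_of_exponent_le h2ε (by linarith))
  have c1 : (R - ρ) ^ (-(s * p)) * a' ≤ r ^ (-(s * p)) * (2 / ε) ^ (q + p) * a :=
    mul_le_mul b9 b1 b0 (by positivity)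
  have c2 : (R / (R - ρ)) ^ q * T * b ≤
      (2 / ε) ^ q * (r ^ (-(s * p)) * (A * κ ^ (p - 1))) * (((κ * ε) ^ (p - 1))⁻¹ * a) :=
    mul_le_mul (mul_le_mul b8 b6 b5 (by positivity)) b7 b4 (by positivity)
  have c3 := mul_le_mul_of_nonneg_left b10
    (mul_nonneg (by positivity : 0 ≤ r ^ (-(s * p)) * A) ha0)
  linarith

/-- De Giorgi's first lemma: if the excess of `u` over `k` is small in `Lᵖ(B_{2r})` and its tail is
controlled, relative to `κ`, then `u ≤ k + κ` in `B_r`. -/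
lemma exists_le_of_small_excess (n : ℕ) (hn : 1 ≤ n) {s p H A C : ℝ} (hp : 1 < p) (hs : 0 < s)
    (hH : 0 < H) (hA : 0 ≤ A) (hC : IsKernelConst n s p C) :
    ∃ ν : ℝ, 0 < ν ∧ ∀ (Ω : Set (EuclideanSpace ℝ (Fin n))) (u : EuclideanSpace ℝ (Fin n) → ℝ),
      DeGiorgiClass n s p H Ω u → ∀ (x₀ : EuclideanSpace ℝ (Fin n)) (r κ k : ℝ), 0 < r → 0 < κ →
        Metric.ball x₀ (2 * r) ⊆ Ω →
        r ^ (s * p) * tailIntegral n s p (excess u k) x₀ r ≤ A * κ ^ (p - 1) →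
        ∫ x in Metric.ball x₀ (2 * r), excess u k x ^ p ≤ ν * (κ ^ p * r ^ (n : ℝ)) →
        ∀ᵐ x, x ∈ Metric.ball x₀ r → u x ≤ k + κ := by
  have hp0 : 0 < p := by linarith
  have hsp : 0 < s * p := by positivity
  have hn0 : (0 : ℝ) < n := by exact_mod_cast hn
  obtain ⟨q, hq⟩ : ∃ q : ℝ, q = n + s * p := ⟨_, rfl⟩
  have hq0 : 0 < q := by rw [hq]; positivity
  obtain ⟨ω, hωdef⟩ : ∃ ω, ω = unitBallVolume n := ⟨_, rfl⟩
  have hω : 0 < ω := hωdef ▸ unitBallVolume_pos n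
  obtain ⟨β, hβ⟩ : ∃ β : ℝ, β = n / (s * p) := ⟨_, rfl⟩
  have hβ0 : 0 < β := by rw [hβ]; positivity
  obtain ⟨B, hB⟩ : ∃ B : ℝ, B = 2 ^ (q + p) := ⟨_, rfl⟩
  have hB1 : 1 < B := hB ▸ Real.one_lt_rpow (by norm_num) (by positivity)
  have hB0 : 0 < B := by linarith
  obtain ⟨D, hD⟩ : ∃ D : ℝ, D = H * (1 + A) * 4 ^ (q + p) := ⟨_, rfl⟩
  have hD0 : 0 < D := by rw [hD]; positivity
  -- the rate of decay balances the growth `B ^ j` of the constants along the iteration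
  obtain ⟨μ, hμ⟩ : ∃ μ : ℝ, μ = (2 ^ p)⁻¹ * (B⁻¹) ^ β := ⟨_, rfl⟩
  have hμ0 : 0 < μ := by rw [hμ]; positivity
  have hμ1 : μ < 1 := by
    have h1 : (2 ^ p : ℝ)⁻¹ < 1 := inv_lt_one_of_one_lt₀ (Real.one_lt_rpow (by norm_num) hp0)
    have h2 : (B⁻¹) ^ β ≤ 1 := Real.rpow_le_one (by positivity)
      (inv_le_one_of_one_le₀ hB1.le) hβ0.le
    have h3 : 0 < (2 ^ p : ℝ)⁻¹ := by positivity
    calc μ ≤ (2 ^ p)⁻¹ * 1 := hμ ▸ mul_le_mul_of_nonneg_left h2 h3.le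
      _ < 1 := by linarith
  obtain ⟨ν, hν⟩ : ∃ ν : ℝ, ν = ω / (2 * 2 ^ p) * (μ / D) ^ β := ⟨_, rfl⟩
  have hν0 : 0 < ν := by rw [hν]; positivity
  refine ⟨ν, hν0, fun Ω u hu x₀ r κ k hr hκ hΩ htail hsmall => ?_⟩
  set a : ℕ → ℝ := fun j =>
    ∫ x in Metric.ball x₀ (r * (1 + (1 / 2) ^ j)),
      excess u (k + κ * (1 - (1 / 2) ^ j)) x ^ p with ha
  have ha0 : ∀ j, 0 ≤ a j := fun j =>
    integral_nonneg fun x => Real.rpow_nonneg (excess_nonneg _ _ _) _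
  have hclaim : ∀ j, a j ≤ ν * (κ ^ p * r ^ (n : ℝ)) * μ ^ j := by
    intro j
    induction j with
    | zero =>
      simp only [ha, pow_zero, sub_self, mul_zero, add_zero, mul_one]
      rw [show r * (1 + 1) = 2 * r by ring]
      exact hsmall
    | succ j ih =>
      obtain ⟨ε, hε⟩ : ∃ ε : ℝ, ε = (1 / 2) ^ (j + 1) := ⟨_, rfl⟩
      have hε0 : 0 < ε := by rw [hε]; positivity
      have hε1 : ε ≤ 1 := hε ▸ pow_le_one₀ (by norm_num) (by norm_num)
      have hε2 : (1 / 2 : ℝ) ^ j = 2 * ε := by rw [hε, pow_succ]; ring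
      set R := r * (1 + (1 / 2) ^ j) with hRdef
      set ρ := r * (1 + ε) with hρdef
      set k₁ := k + κ * (1 - (1 / 2) ^ j) with hk1
      set k₂ := k + κ * (1 - ε) with hk2
      have hRρ : R - ρ = r * ε := by rw [hRdef, hρdef, hε2]; ring
      have hk21 : k₂ - k₁ = κ * ε := by rw [hk2, hk1, hε2]; ring
      have hρ0 : 0 < ρ := by positivity
      have hrε : 0 < r * ε := by positivity
      have hκε : 0 < κ * ε := by positivity
      have hρR : ρ < R := by linarith
      have hR0 : 0 < R := hρ0.trans hρR
      have hR2 : R ≤ 2 * r := by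
        rw [hRdef, mul_comm 2 r]
        refine mul_le_mul_of_nonneg_left ?_ hr.le
        have : (1 / 2 : ℝ) ^ j ≤ 1 := pow_le_one₀ (by norm_num) (by norm_num)
        linarith
      have hrR : r ≤ R := by
        rw [hRdef]; nlinarith [pow_pos (by norm_num : (0 : ℝ) < 1 / 2) j]
      have hk12 : k₁ ≤ k₂ := by linarith
      have hk02 : k ≤ k₂ := by rw [hk2]; nlinarith
      have haj : a j = ∫ x in Metric.ball x₀ R, excess u k₁ x ^ p := rfl
      have haj1 : a (j + 1) = ∫ x in Metric.ball x₀ ρ, excess u k₂ x ^ p := by rw [hρdef, hk2, hε]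
      have hBj : (2 / ε) ^ (q + p) = 4 ^ (q + p) * B ^ j := by
        have e1 : 2 / ε = 4 * 2 ^ j := by
          rw [hε, div_eq_mul_inv, ← inv_pow]; norm_num; rw [pow_succ]; ring
        rw [e1, Real.mul_rpow (by norm_num) (by positivity), hB, ← Real.rpow_natCast,
          ← Real.rpow_natCast, ← Real.rpow_mul (by norm_num), ← Real.rpow_mul (by norm_num),
          mul_comm (j : ℝ)]
      -- the radius at which the Faber–Krahn inequality is used
      obtain ⟨τ, hτ⟩ : ∃ τ : ℝ, τ = (μ / D * (B⁻¹) ^ j) ^ (1 / (s * p)) := ⟨_, rfl⟩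
      have hτ0 : 0 < τ := by rw [hτ]; positivity
      have hτsp : τ ^ (s * p) = μ / D * (B⁻¹) ^ j := by
        rw [hτ, ← Real.rpow_mul (by positivity), one_div, inv_mul_cancel₀ hsp.ne', Real.rpow_one]
      have hτn : τ ^ (n : ℝ) * ω = 2 * 2 ^ p * ν * (2 ^ p * μ) ^ j := by
        have e1 : τ ^ (n : ℝ) = (μ / D) ^ β * ((B⁻¹) ^ β) ^ j := by
          rw [hτ, ← Real.rpow_mul (by positivity), one_div, inv_mul_eq_div, ← hβ,
            Real.mul_rpow (by positivity) (by positivity), ← Real.rpow_natCast,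
            ← Real.rpow_natCast, ← Real.rpow_mul (by positivity), ← Real.rpow_mul (by positivity),
            mul_comm (j : ℝ)]
        have e2 : 2 ^ p * μ = (B⁻¹) ^ β := by
          rw [hμ, ← mul_assoc, mul_inv_cancel₀ (by positivity), one_mul]
        rw [e1, e2, hν]
        field_simp
      have hcheb := volume_superlevel_mul_le hp hu.measurable hu.memLp hk12 x₀ R
      rw [hk21, ← haj] at hcheb
      have hvol : 2 * volume.real (Metric.ball x₀ R ∩ {x | k₂ < u x}) ≤
          (r * τ) ^ (n : ℝ) * ω := by
        have e1 : (κ * ε) ^ p * ((2 * 2 ^ p * ν * (2 ^ p * μ) ^ j) * r ^ (n : ℝ)) =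
            2 * (ν * (κ ^ p * r ^ (n : ℝ)) * μ ^ j) := by
          have e2 : ε ^ p * (2 ^ p * (2 ^ p) ^ j) = 1 := by
            rw [← pow_succ', ← Real.rpow_natCast, ← Real.rpow_mul (by norm_num), mul_comm p,
              Real.rpow_mul (by norm_num), Real.rpow_natCast,
              ← Real.mul_rpow (by positivity) (by positivity), hε, ← mul_pow]
            norm_num
          rw [Real.mul_rpow hκ.le hε0.le, mul_pow]
          calc _ = 2 * (ν * (κ ^ p * r ^ (n : ℝ)) * μ ^ j) * (ε ^ p * (2 ^ p * (2 ^ p) ^ j)) := by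
                ring
            _ = _ := by rw [e2, mul_one]
        rw [Real.mul_rpow hr.le hτ0.le, mul_assoc, hτn, mul_comm (r ^ (n : ℝ))]
        refine le_of_mul_le_mul_left ?_ (by positivity : 0 < (κ * ε) ^ p)
        rw [e1]
        linarith
      have hlev := hu.level x₀ ρ R k₂ (r * τ) hρ0 hρR ((Metric.ball_subset_ball hR2).trans hΩ)
        (by positivity) (hωdef ▸ hvol)
      rw [← haj1] at hlev
      have hQ := caccioppoliBound_le hC hp hs hA hu.measurable hu.memLp hr hκ htail hε0 hε1 hRρ
        hrR hR2 hk02 hk21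
      rw [← hq, hBj, ← haj] at hQ
      have hfinal := hlev.trans (mul_le_mul_of_nonneg_left hQ (by positivity))
      rw [Real.mul_rpow hr.le hτ0.le, hτsp, Real.rpow_neg hr.le] at hfinal
      have e3 : H * (r ^ (s * p) * (μ / D * (B⁻¹) ^ j)) *
          ((r ^ (s * p))⁻¹ * ((1 + A) * (4 ^ (q + p) * B ^ j)) * a j) = μ * a j := by
        have h1 : r ^ (s * p) ≠ 0 := by positivity
        have h2 : (B⁻¹) ^ j * B ^ j = 1 := by
          rw [← mul_pow, inv_mul_cancel₀ hB0.ne', one_pow]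
        calc _ = (r ^ (s * p) * (r ^ (s * p))⁻¹) * (μ * (D / D)) * ((B⁻¹) ^ j * B ^ j) * a j := by
              rw [hD]; ring
          _ = _ := by rw [h2, mul_inv_cancel₀ h1, div_self hD0.ne']; ring
      rw [e3] at hfinal
      calc a (j + 1) ≤ μ * a j := hfinal
        _ ≤ μ * (ν * (κ ^ p * r ^ (n : ℝ)) * μ ^ j) := mul_le_mul_of_nonneg_left ih hμ0.le
        _ = _ := by rw [pow_succ]; ring
  have hlim : Filter.Tendsto (fun j : ℕ => ν * (κ ^ p * r ^ (n : ℝ)) * μ ^ j) Filter.atTop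
      (nhds 0) := by
    simpa using (tendsto_pow_atTop_nhds_zero_of_lt_one hμ0.le hμ1).const_mul
      (ν * (κ ^ p * r ^ (n : ℝ)))
  have hnn : ∀ x, 0 ≤ excess u (k + κ) x ^ p := fun x => Real.rpow_nonneg (excess_nonneg _ _ _) _
  have hle : ∫ x in Metric.ball x₀ r, excess u (k + κ) x ^ p ≤ 0 := by
    refine ge_of_tendsto' hlim fun j => le_trans ?_ (hclaim j)
    have : 0 < (1 / 2 : ℝ) ^ j := by positivity
    exact setIntegral_excess_rpow_mono hp hu.measurable hu.memLp (by nlinarith) x₀ (by nlinarith)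
  have hzero := (setIntegral_eq_zero_iff_of_nonneg_ae (Filter.Eventually.of_forall hnn)
    (integrableOn_excess_rpow hp hu.measurable hu.memLp (k + κ) x₀ r)).1
    (le_antisymm hle (integral_nonneg hnn))
  filter_upwards [(ae_restrict_iff' measurableSet_ball).1 hzero] with x hx hxr
  have h1 := (Real.rpow_eq_zero (excess_nonneg _ _ _) hp0.ne').1 (hx hxr)
  have h2 : u x - (k + κ) ≤ excess u (k + κ) x := le_max_left _ _
  linarith

/-! ### The growth lemma -/

lemma setIntegral_excess_le {n : ℕ} {p : ℝ} (hp : 1 < p) {u : EuclideanSpace ℝ (Fin n) → ℝ}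
    (hu : Measurable u) (hup : MemLp u (ENNReal.ofReal p) volume) {l g R : ℝ} (hg : 0 ≤ g)
    (hR : 0 < R) {x₀ : EuclideanSpace ℝ (Fin n)}
    (h : ∀ᵐ x, x ∈ Metric.ball x₀ R → u x ≤ l + g) :
    ∫ x in Metric.ball x₀ R, excess u l x ≤ g * (R ^ (n : ℝ) * unitBallVolume n) ∧
    ∫ x in Metric.ball x₀ R, excess u l x ^ p ≤ g ^ (p - 1) * ∫ x in Metric.ball x₀ R, excess u l x
    := by
  have hfin : volume (Metric.ball x₀ R) ≠ ⊤ := measure_ball_lt_top.ne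
  have hle : ∀ᵐ x, x ∈ Metric.ball x₀ R → excess u l x ≤ g := by
    filter_upwards [h] with x hx hxR
    exact max_le (by linarith [hx hxR]) hg
  have hi := integrableOn_excess hp hu hup l x₀ R
  constructor
  · refine (setIntegral_mono_on_ae hi (integrableOn_const hfin) measurableSet_ball hle).trans ?_
    rw [setIntegral_const, smul_eq_mul, volume_real_ball x₀ hR, mul_comm]
  · rw [← integral_const_mul]
    refine setIntegral_mono_on_ae (integrableOn_excess_rpow hp hu hup l x₀ R) (hi.const_mul _)
      measurableSet_ball ?_
    filter_upwards [hle] with x hx hxR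
    rw [← rpow_sub_one_mul_self hp (excess_nonneg u l x)]
    exact mul_le_mul_of_nonneg_right (Real.rpow_le_rpow (excess_nonneg _ _ _) (hx hxR)
      (by linarith)) (excess_nonneg _ _ _)

/-- Growth lemma: if `u ≤ k + h` in `B_{4r}`, the tail beyond that level is small, and `u ≤ k` on
half of `B_{2r}`, then the upper bound improves in `B_r` by a fixed fraction of `h`. The mixed term
of the Caccioppoli inequality forces the set where `u` is close to `k + h` to be small. -/
lemma exists_growth (n : ℕ) (hn : 1 ≤ n) {s p H A C : ℝ} (hp : 1 < p) (hs : 0 < s)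
    (hH : 0 < H) (hA : 0 ≤ A) (hC : IsKernelConst n s p C) :
    ∃ δ₀ : ℝ, 0 < δ₀ ∧ ∀ δ : ℝ, 0 < δ → δ ≤ δ₀ → δ ≤ 1 / 2 →
      ∀ (Ω : Set (EuclideanSpace ℝ (Fin n))) (u : EuclideanSpace ℝ (Fin n) → ℝ),
      DeGiorgiClass n s p H Ω u → ∀ (x₀ : EuclideanSpace ℝ (Fin n)) (r k h : ℝ), 0 < r → 0 < h →
        Metric.ball x₀ (4 * r) ⊆ Ω →
        (∀ᵐ x, x ∈ Metric.ball x₀ (4 * r) → u x ≤ k + h) →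
        (4 * r) ^ (s * p) * tailIntegral n s p (excess u (k + h)) x₀ (4 * r) ≤
          A * (δ * h) ^ (p - 1) →
        volume.real (Metric.ball x₀ (2 * r)) ≤
          2 * volume.real (Metric.ball x₀ (2 * r) ∩ {x | u x ≤ k}) →
        ∀ᵐ x, x ∈ Metric.ball x₀ r → u x ≤ k + h - δ * h / 2 := by
  have hp0 : 0 < p := by linarith
  have hp1 : 0 < p - 1 := by linarith
  have hsp : 0 < s * p := by positivity
  have hC0 : 0 < C := zero_lt_one.trans_le hC.1
  set q : ℝ := n + s * p with hq
  have hq0 : 0 < q := by positivity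
  set ω := unitBallVolume n with hωdef
  have hω : 0 < ω := unitBallVolume_pos n
  obtain ⟨ν, hν0, hν⟩ := exists_le_of_small_excess n hn (A := 2 ^ (p - 1) * (A + C) * 2 ^ (p - 1))
    hp hs hH (by positivity) hC
  set E : ℝ := 1 + 2 ^ q * (2 ^ (p - 1) * (A + C)) with hE
  have hE0 : 0 < E := by positivity
  set M : ℝ := H * 4 ^ q * 4 ^ (n : ℝ) * E * 2 * 2 ^ (p - 1) / 2 ^ (n : ℝ) with hM
  have hM0 : 0 < M := by positivity
  refine ⟨(ν / (2 ^ p * M)) ^ (1 / (p - 1)), by positivity,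
    fun δ hδ hδ0 hδ2 Ω u hu x₀ r k h hr hh hΩ hle htail hhalf => ?_⟩
  have hδM : M * δ ^ (p - 1) * 2 ^ p ≤ ν := by
    have h1 := Real.rpow_le_rpow hδ.le hδ0 hp1.le
    rw [← Real.rpow_mul (by positivity), one_div, inv_mul_cancel₀ hp1.ne', Real.rpow_one,
      le_div_iff₀ (by positivity)] at h1
    linarith
  set g := δ * h with hg
  have hg0 : 0 < g := by positivity
  set l := k + h - g with hl
  have hlg : l + g = k + h := by rw [hl]; ring
  have h4r : 0 < 4 * r := by positivity
  have h2r : 0 < 2 * r := by positivity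
  have hT1 := tailIntegral_lower_level hC hp hsp.le hu.measurable hu.memLp h4r hg0.le (k + h) x₀
  rw [← hl] at hT1
  have hrpos : 0 < r ^ (-(s * p)) := by positivity
  have hneg : ∀ c : ℝ, 1 ≤ c → (c * r) ^ (-(s * p)) ≤ r ^ (-(s * p)) := fun c hc =>
    Real.rpow_le_rpow_of_nonpos hr (by nlinarith) (by linarith)
  have htail' : tailIntegral n s p (excess u (k + h)) x₀ (4 * r) ≤
      r ^ (-(s * p)) * (A * g ^ (p - 1)) := by
    have : tailIntegral n s p (excess u (k + h)) x₀ (4 * r) ≤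
        (4 * r) ^ (-(s * p)) * (A * g ^ (p - 1)) := by
      rw [Real.rpow_neg h4r.le, inv_mul_eq_div, le_div_iff₀ (by positivity)]
      linarith
    exact this.trans (mul_le_mul_of_nonneg_right (hneg 4 (by norm_num)) (by positivity))
  have hT : tailIntegral n s p (excess u l) x₀ (4 * r) ≤
      2 ^ (p - 1) * (A + C) * g ^ (p - 1) * r ^ (-(s * p)) := by
    refine hT1.trans ?_
    have h1 : g ^ (p - 1) * (C * (4 * r) ^ (-(s * p))) ≤ g ^ (p - 1) * (C * r ^ (-(s * p))) := by
      have := hneg 4 (by norm_num)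
      gcongr
    have h2 := mul_le_mul_of_nonneg_left (add_le_add htail' h1)
      (by positivity : (0 : ℝ) ≤ 2 ^ (p - 1))
    linarith
  rw [← hlg] at hle
  obtain ⟨I1, I2⟩ := setIntegral_excess_le hp hu.measurable hu.memLp hg0.le h4r hle
  have hle2 : ∀ᵐ x, x ∈ Metric.ball x₀ (2 * r) → u x ≤ l + g := by
    filter_upwards [hle] with x hx hxr
    exact hx (Metric.ball_subset_ball (by linarith) hxr)
  obtain ⟨-, I4⟩ := setIntegral_excess_le hp hu.measurable hu.memLp hg0.le h2r hle2
  have hW0 : 0 ≤ ∫ x in Metric.ball x₀ (4 * r), excess u l x :=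
    integral_nonneg fun x => excess_nonneg _ _ _
  have hW2 : 0 ≤ ∫ x in Metric.ball x₀ (2 * r), excess u l x :=
    integral_nonneg fun x => excess_nonneg _ _ _
  have hV : 0 < (4 * r) ^ (n : ℝ) * ω := by positivity
  have hgp : g ^ (p - 1) * g = g ^ p := rpow_sub_one_mul_self hp hg0.le
  -- the Caccioppoli bound at level `l`
  have hQ : caccioppoliBound s p u l x₀ (2 * r) (4 * r) ≤
      g ^ p * ((4 * r) ^ (n : ℝ) * ω) * r ^ (-(s * p)) * E := by
    have e1 : 4 * r - 2 * r = 2 * r := by ring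
    have e2 : 4 * r / (2 * r) = 2 := by field_simp; norm_num
    rw [caccioppoliBound, e1, e2, ← hq]
    have c1 : (2 * r) ^ (-(s * p)) * (∫ x in Metric.ball x₀ (4 * r), excess u l x ^ p) ≤
        r ^ (-(s * p)) * (g ^ p * ((4 * r) ^ (n : ℝ) * ω)) := by
      refine mul_le_mul (hneg 2 (by norm_num)) (I2.trans ?_)
        (integral_nonneg fun x => Real.rpow_nonneg (excess_nonneg _ _ _) _) hrpos.le
      rw [← hgp, mul_assoc]
      exact mul_le_mul_of_nonneg_left I1 (by positivity)
    have c2 : 2 ^ q * tailIntegral n s p (excess u l) x₀ (4 * r) *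
        (∫ x in Metric.ball x₀ (4 * r), excess u l x) ≤
        2 ^ q * (2 ^ (p - 1) * (A + C) * g ^ (p - 1) * r ^ (-(s * p))) *
          (g * ((4 * r) ^ (n : ℝ) * ω)) :=
      mul_le_mul (mul_le_mul_of_nonneg_left hT (by positivity)) I1 hW0 (by positivity)
    have c3 : 2 ^ q * (2 ^ (p - 1) * (A + C) * g ^ (p - 1) * r ^ (-(s * p))) *
          (g * ((4 * r) ^ (n : ℝ) * ω)) =
        g ^ p * ((4 * r) ^ (n : ℝ) * ω) * r ^ (-(s * p)) * (2 ^ q * (2 ^ (p - 1) * (A + C))) := by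
      rw [← hgp]; ring
    rw [c3] at c2
    rw [hE]
    linarith
  have hmix := hu.mixed x₀ (2 * r) (4 * r) l (h / 2) h2r (by linarith) hΩ (by linarith)
  have hsubset : volume.real (Metric.ball x₀ (2 * r) ∩ {x | u x ≤ k}) ≤
      volume.real (Metric.ball x₀ (2 * r) ∩ {x | u x ≤ l - h / 2}) := by
    refine measureReal_mono (inter_subset_inter_right _ fun x hx => ?_)
      ((measure_mono inter_subset_left).trans_lt measure_ball_lt_top).ne
    have : u x ≤ k := hx
    simp only [mem_ofPred_eq, hl, hg]
    nlinarith
  rw [volume_real_ball x₀ h2r, ← hωdef] at hhalf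
  have hlow : (∫ x in Metric.ball x₀ (2 * r), excess u l x) *
      ((h / 2) ^ (p - 1) * ((2 * r) ^ (n : ℝ) * ω / 2)) ≤
      H * (2 * (2 * r)) ^ q * (g ^ p * ((4 * r) ^ (n : ℝ) * ω) * r ^ (-(s * p)) * E) := by
    refine le_trans (mul_le_mul_of_nonneg_left (mul_le_mul_of_nonneg_left ?_ (by positivity)) hW2)
      (hmix.trans (mul_le_mul_of_nonneg_left hQ (by positivity)))
    linarith
  have hI : ∫ x in Metric.ball x₀ (2 * r), excess u l x ≤
      M * δ ^ p * h * r ^ (n : ℝ) := by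
    refine le_of_mul_le_mul_right (hlow.trans (le_of_eq ?_))
      (by positivity : 0 < (h / 2) ^ (p - 1) * ((2 * r) ^ (n : ℝ) * ω / 2))
    rw [show 2 * (2 * r) = 4 * r by ring, Real.mul_rpow (by norm_num) hr.le,
      Real.mul_rpow (by norm_num) hr.le, Real.mul_rpow (by norm_num) hr.le,
      Real.div_rpow hh.le (by norm_num), hg, Real.mul_rpow hδ.le hh.le,
      ← rpow_sub_one_mul_self hp hh.le, hq, Real.rpow_add hr, Real.rpow_neg hr.le, ← hq, hM]
    have h1 : r ^ (s * p) ≠ 0 := by positivity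
    have h2 : (2 : ℝ) ^ (p - 1) ≠ 0 := by positivity
    have h3 : (2 : ℝ) ^ (n : ℝ) ≠ 0 := by positivity
    field_simp
  have hfin := hν Ω u hu x₀ r (g / 2) l hr (by positivity)
    ((Metric.ball_subset_ball (by linarith)).trans hΩ) ?_ ?_
  · filter_upwards [hfin] with x hx hxr
    have := hx hxr
    rw [hl] at this
    linarith
  · have h1 := tailIntegral_lower_level hC hp hsp.le hu.measurable hu.memLp hr hg0.le (k + h) x₀
    rw [← hl] at h1
    rw [hlg] at hle
    have h2 := (tailIntegral_le_of_ae_le hC hp hsp.le hu.measurable hu.memLp hr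
      (by linarith : r ≤ 4 * r) hle).trans htail'
    have h3 : tailIntegral n s p (excess u l) x₀ r ≤
        r ^ (-(s * p)) * (2 ^ (p - 1) * (A + C) * g ^ (p - 1)) := by
      have := mul_le_mul_of_nonneg_left h2 (by positivity : (0 : ℝ) ≤ 2 ^ (p - 1))
      linarith
    rw [Real.rpow_neg hr.le, inv_mul_eq_div, le_div_iff₀ (by positivity)] at h3
    rw [Real.div_rpow hg0.le (by norm_num)]
    have h4 : 2 ^ (p - 1) * (A + C) * 2 ^ (p - 1) * (g ^ (p - 1) / 2 ^ (p - 1)) =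
      2 ^ (p - 1) * (A + C) * g ^ (p - 1) := by
      have : (2 : ℝ) ^ (p - 1) ≠ 0 := by positivity
      field_simp
    rw [h4]
    linarith
  · refine I4.trans ((mul_le_mul_of_nonneg_left hI (by positivity)).trans ?_)
    have e : g ^ (p - 1) * (M * δ ^ p * h * r ^ (n : ℝ)) =
        M * δ ^ (p - 1) * 2 ^ p * ((g / 2) ^ p * r ^ (n : ℝ)) := by
      rw [Real.div_rpow hg0.le (by norm_num), ← hgp, ← rpow_sub_one_mul_self hp hδ.le, hg]
      have : (2 : ℝ) ^ p ≠ 0 := by positivity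
      field_simp
    rw [e]
    exact mul_le_mul_of_nonneg_right hδM (by positivity)

/-! ### Decay of the oscillation -/

/-- The induction hypothesis of the oscillation decay on `B_R(x₀)`: `u` lies between `m` and `M`
there, and the tails of `u` beyond both levels are small relative to `M - m`. -/
structure OscControl {n : ℕ} (s p A δ : ℝ) (u : EuclideanSpace ℝ (Fin n) → ℝ)
    (x₀ : EuclideanSpace ℝ (Fin n)) (m M R : ℝ) : Prop where
  lt : m < M
  lower : ∀ᵐ x, x ∈ Metric.ball x₀ R → m ≤ u x
  upper : ∀ᵐ x, x ∈ Metric.ball x₀ R → u x ≤ M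
  tail_upper : R ^ (s * p) * tailIntegral n s p (excess u M) x₀ R ≤ A * (δ * (M - m)) ^ (p - 1)
  tail_lower : R ^ (s * p) * tailIntegral n s p (excess (-u) (-m)) x₀ R ≤
    A * (δ * (M - m)) ^ (p - 1)

lemma OscControl.neg {n : ℕ} {s p A δ : ℝ} {u : EuclideanSpace ℝ (Fin n) → ℝ}
    {x₀ : EuclideanSpace ℝ (Fin n)} {m M R : ℝ} (h : OscControl s p A δ u x₀ m M R) :
    OscControl s p A δ (-u) x₀ (-M) (-m) R := by
  have e : -m - -M = M - m := by ring
  refine ⟨by linarith [h.lt], ?_, ?_, ?_, ?_⟩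
  · filter_upwards [h.upper] with x hx hxR using neg_le_neg (hx hxR)
  · filter_upwards [h.lower] with x hx hxR using neg_le_neg (hx hxR)
  · rw [e]; exact h.tail_lower
  · rw [e, neg_neg, neg_neg]; exact h.tail_upper

/-- The tail beyond the upper bound stays in control when the ball shrinks by `θ` and the bound
drops from `M` to `M'`: the old tail gains `θ^{sp}`, and the drop contributes the tail of a
constant. The value of `A` makes these two contributions equal. -/
lemma tail_shrink {n : ℕ} {s p C A δ θ τ : ℝ} (hC : IsKernelConst n s p C) (hp : 1 < p)
    (hsp : 0 < s * p) (hA : A = 2 ^ (p + 1) * C) (hδ : 0 < δ) (hθ : 0 < θ) (hθ1 : θ ≤ 1)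
    (hθp : θ ^ (s * p) * 2 ^ (p - 1) ≤ 1 / 4) (hτ : 0 < τ) (hτp : 1 / 2 ≤ τ ^ (p - 1))
    {u : EuclideanSpace ℝ (Fin n) → ℝ} (hu : Measurable u)
    (hup : MemLp u (ENNReal.ofReal p) volume) {x₀ : EuclideanSpace ℝ (Fin n)} {R M M' h : ℝ}
    (hR : 0 < R) (hh : 0 < h) (hM : M' ≤ M) (hM' : M - M' ≤ δ * h)
    (hle : ∀ᵐ x, x ∈ Metric.ball x₀ R → u x ≤ M)
    (htail : R ^ (s * p) * tailIntegral n s p (excess u M) x₀ R ≤ A * (δ * h) ^ (p - 1)) :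
    (θ * R) ^ (s * p) * tailIntegral n s p (excess u M') x₀ (θ * R) ≤
      A * (δ * (τ * h)) ^ (p - 1) := by
  have hC0 : 0 < C := zero_lt_one.trans_le hC.1
  have hA0 : 0 < A := by rw [hA]; positivity
  have hθR : 0 < θ * R := by positivity
  have h1 := tailIntegral_lower_level hC hp hsp.le hu hup hθR (sub_nonneg.2 hM) M x₀
  rw [sub_sub_cancel] at h1
  have h2 := tailIntegral_le_of_ae_le hC hp hsp.le hu hup hθR
    (mul_le_of_le_one_left hR.le hθ1) hle
  have h3 : (M - M') ^ (p - 1) ≤ (δ * h) ^ (p - 1) :=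
    Real.rpow_le_rpow (sub_nonneg.2 hM) hM' (by linarith)
  set g := (δ * h) ^ (p - 1) with hg
  have hg0 : 0 < g := by positivity
  have h4 : (2 : ℝ) ^ (p + 1) = 4 * 2 ^ (p - 1) := by
    rw [show p + 1 = 2 + (p - 1) by ring, Real.rpow_add (by norm_num)]; norm_num
  have h5 : (θ * R) ^ (s * p) * tailIntegral n s p (excess u M') x₀ (θ * R) ≤
      θ ^ (s * p) * 2 ^ (p - 1) * (R ^ (s * p) * tailIntegral n s p (excess u M) x₀ R) +
        2 ^ (p - 1) * (C * g) := by
    have e1 : (θ * R) ^ (s * p) * (2 ^ (p - 1) * (tailIntegral n s p (excess u M) x₀ R +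
        g * (C * (θ * R) ^ (-(s * p))))) =
      θ ^ (s * p) * 2 ^ (p - 1) * (R ^ (s * p) * tailIntegral n s p (excess u M) x₀ R) +
        2 ^ (p - 1) * (C * g) := by
      rw [Real.rpow_neg hθR.le, mul_add, mul_add, Real.mul_rpow hθ.le hR.le]
      have a1 : θ ^ (s * p) ≠ 0 := by positivity
      have a2 : R ^ (s * p) ≠ 0 := by positivity
      field_simp
    rw [← e1]
    refine mul_le_mul_of_nonneg_left (h1.trans ?_) (by positivity)
    gcongr
  have h6 : θ ^ (s * p) * 2 ^ (p - 1) * (R ^ (s * p) * tailIntegral n s p (excess u M) x₀ R) ≤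
      1 / 4 * (A * g) :=
    mul_le_mul hθp htail (mul_nonneg (by positivity) (tailIntegral_nonneg _ _ _ _ _ _))
      (by norm_num)
  have h7 : 2 ^ (p - 1) * (C * g) = 1 / 4 * (A * g) := by rw [hA, h4]; ring
  have h8 : (δ * (τ * h)) ^ (p - 1) = τ ^ (p - 1) * g := by
    rw [hg, ← Real.mul_rpow hτ.le (by positivity)]; congr 1; ring
  rw [h8]
  have h9 := mul_le_mul_of_nonneg_left hτp (by positivity : 0 ≤ A * g)
  linarith

/-- One step of the oscillation decay. On one half of the smaller ball `u` stays on one side of the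
midpoint of `[m, M]`, and the growth lemma improves the bound on the other side. The condition
`θ^{sp} < τ^{p-1}` is what restricts the Hölder exponent to `α < sp / (p - 1)`. -/
lemma exists_osc_step (n : ℕ) (hn : 1 ≤ n) {s p H C : ℝ} (hp : 1 < p) (hs : 0 < s)
    (hH : 0 < H) (hC : IsKernelConst n s p C) :
    ∃ A δ θ τ : ℝ, 1 ≤ A ∧ 0 < δ ∧ 0 < θ ∧ θ ≤ 1 / 4 ∧ 1 / 2 ≤ τ ∧ τ < 1 ∧
      θ ^ (s * p) < τ ^ (p - 1) ∧
      ∀ (Ω : Set (EuclideanSpace ℝ (Fin n))) (u : EuclideanSpace ℝ (Fin n) → ℝ),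
      DeGiorgiClass n s p H Ω u → DeGiorgiClass n s p H Ω (-u) →
      ∀ (x₀ : EuclideanSpace ℝ (Fin n)) (R m M : ℝ), 0 < R → Metric.ball x₀ R ⊆ Ω →
        OscControl s p A δ u x₀ m M R →
        ∃ m' M', M' - m' = τ * (M - m) ∧ OscControl s p A δ u x₀ m' M' (θ * R) := by
  have hp1 : 0 < p - 1 := by linarith
  have hsp : 0 < s * p := by positivity
  have hC0 : 0 < C := zero_lt_one.trans_le hC.1
  obtain ⟨A, hAdef⟩ : ∃ A : ℝ, A = 2 ^ (p + 1) * C := ⟨_, rfl⟩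
  have hA1 : 1 ≤ A := by
    rw [hAdef]
    exact one_le_mul_of_one_le_of_one_le (Real.one_le_rpow (by norm_num) (by linarith)) hC.1
  have hA0 : 0 < A := by linarith
  obtain ⟨δ₀, hδ₀, hgrow⟩ := exists_growth n hn (A := A * 2 ^ (p - 1)) hp hs hH (by positivity) hC
  have h2p : (2 : ℝ)⁻¹ ^ (1 / (p - 1)) < 1 :=
    Real.rpow_lt_one (by norm_num) (by norm_num) (by positivity)
  obtain ⟨δ, hδ, hδ1, hδ2, hδ3⟩ : ∃ δ : ℝ, 0 < δ ∧ δ ≤ δ₀ ∧ δ ≤ 1 / 2 ∧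
      δ ≤ 4 * (1 - (2 : ℝ)⁻¹ ^ (1 / (p - 1))) :=
    ⟨min δ₀ (min (1 / 2) (4 * (1 - (2 : ℝ)⁻¹ ^ (1 / (p - 1))))),
      lt_min hδ₀ (lt_min (by norm_num) (by linarith)), min_le_left _ _,
      (min_le_right _ _).trans (min_le_left _ _), (min_le_right _ _).trans (min_le_right _ _)⟩
  obtain ⟨θ, hθ, hθ4, hθp⟩ : ∃ θ : ℝ, 0 < θ ∧ θ ≤ 1 / 4 ∧ θ ^ (s * p) * 2 ^ (p - 1) ≤ 1 / 4 := by
    refine ⟨min (1 / 4) ((1 / 4 / 2 ^ (p - 1)) ^ (1 / (s * p))), by positivity, min_le_left _ _, ?_⟩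
    have h1 := Real.rpow_le_rpow (by positivity)
      (min_le_right (1 / 4 : ℝ) ((1 / 4 / 2 ^ (p - 1)) ^ (1 / (s * p)))) hsp.le
    rw [← Real.rpow_mul (by positivity), one_div (s * p), inv_mul_cancel₀ hsp.ne', Real.rpow_one,
      le_div_iff₀ (by positivity)] at h1
    rwa [one_div (s * p)]
  obtain ⟨τ, hτdef⟩ : ∃ τ : ℝ, τ = 1 - δ / 4 := ⟨_, rfl⟩
  have hτ2 : 1 / 2 ≤ τ := by linarith
  have hτ0 : 0 < τ := by linarith
  have hτp : 1 / 2 ≤ τ ^ (p - 1) := by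
    have h1 := Real.rpow_le_rpow (by positivity)
      (by linarith : (2 : ℝ)⁻¹ ^ (1 / (p - 1)) ≤ τ) hp1.le
    rw [← Real.rpow_mul (by positivity), one_div, inv_mul_cancel₀ hp1.ne', Real.rpow_one] at h1
    linarith
  refine ⟨A, δ, θ, τ, hA1, hδ, hθ, hθ4, hτ2, by linarith, ?_, ?_⟩
  · have h1 : (1 : ℝ) ≤ 2 ^ (p - 1) := Real.one_le_rpow (by norm_num) hp1.le
    have h2 : 0 < θ ^ (s * p) := by positivity
    nlinarith
  have main : ∀ (Ω : Set (EuclideanSpace ℝ (Fin n))) (u : EuclideanSpace ℝ (Fin n) → ℝ),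
      DeGiorgiClass n s p H Ω u →
      ∀ (x₀ : EuclideanSpace ℝ (Fin n)) (R m M : ℝ), 0 < R → Metric.ball x₀ R ⊆ Ω →
        OscControl s p A δ u x₀ m M R →
        volume.real (Metric.ball x₀ (2 * (R / 4))) ≤
          2 * volume.real (Metric.ball x₀ (2 * (R / 4)) ∩ {x | u x ≤ (m + M) / 2}) →
        OscControl s p A δ u x₀ m (M - δ / 4 * (M - m)) (θ * R) := by
    intro Ω u hu x₀ R m M hR hΩ hosc hhalf
    have hh : 0 < M - m := by linarith [hosc.lt]
    have e4 : 4 * (R / 4) = R := by ring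
    have eM : (m + M) / 2 + (M - m) / 2 = M := by ring
    have hg := hgrow δ hδ hδ1 hδ2 Ω u hu x₀ (R / 4) ((m + M) / 2) ((M - m) / 2) (by positivity)
      (by positivity) (by rwa [e4]) (by rw [e4, eM]; exact hosc.upper) (by
        rw [e4, eM]
        refine hosc.tail_upper.trans (le_of_eq ?_)
        rw [← mul_div_assoc, Real.div_rpow (by positivity) (by norm_num)]
        have : (2 : ℝ) ^ (p - 1) ≠ 0 := by positivity
        field_simp) hhalf
    have hθR : θ * R ≤ R / 4 := by nlinarith
    have hτh : M - δ / 4 * (M - m) - m = τ * (M - m) := by rw [hτdef]; ring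
    have hsub1 : Metric.ball x₀ (θ * R) ⊆ Metric.ball x₀ R :=
      Metric.ball_subset_ball (by linarith)
    refine ⟨?_, ?_, ?_, ?_, ?_⟩
    · have : 0 < τ * (M - m) := by positivity
      linarith
    · filter_upwards [hosc.lower] with x hx hxR using hx (hsub1 hxR)
    · filter_upwards [hg] with x hx hxR
      have := hx (Metric.ball_subset_ball hθR hxR)
      rw [eM] at this
      linarith
    · rw [hτh]
      exact tail_shrink hC hp hsp hAdef hδ hθ (by linarith) hθp hτ0 hτp hu.measurable hu.memLp
        hR hh (by nlinarith) (by nlinarith) hosc.upper hosc.tail_upper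
    · rw [hτh]
      refine tail_shrink hC hp hsp hAdef hδ hθ (by linarith) hθp hτ0 hτp hu.measurable.neg
        hu.memLp.neg hR hh le_rfl (by nlinarith) ?_ hosc.tail_lower
      filter_upwards [hosc.lower] with x hx hxR using neg_le_neg (hx hxR)
  intro Ω u hu hu' x₀ R m M hR hΩ hosc
  by_cases hcase : volume.real (Metric.ball x₀ (2 * (R / 4))) ≤
      2 * volume.real (Metric.ball x₀ (2 * (R / 4)) ∩ {x | u x ≤ (m + M) / 2})
  · exact ⟨m, M - δ / 4 * (M - m), by rw [hτdef]; ring, main Ω u hu x₀ R m M hR hΩ hosc hcase⟩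
  · have hcase' : volume.real (Metric.ball x₀ (2 * (R / 4))) ≤
        2 * volume.real (Metric.ball x₀ (2 * (R / 4)) ∩ {x | (-u) x ≤ (-M + -m) / 2}) := by
      have h1 : Metric.ball x₀ (2 * (R / 4)) ⊆
          (Metric.ball x₀ (2 * (R / 4)) ∩ {x | u x ≤ (m + M) / 2}) ∪
          (Metric.ball x₀ (2 * (R / 4)) ∩ {x | (-u) x ≤ (-M + -m) / 2}) := fun x hx => by
        rcases le_total (u x) ((m + M) / 2) with h | h
        · exact Or.inl ⟨hx, h⟩
        · refine Or.inr ⟨hx, ?_⟩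
          simp only [mem_ofPred_eq, Pi.neg_apply]
          linarith
      have h2 := (measureReal_mono (μ := volume) h1 (measure_union_lt_top
        ((measure_mono inter_subset_left).trans_lt measure_ball_lt_top)
        ((measure_mono inter_subset_left).trans_lt measure_ball_lt_top)).ne).trans
        (measureReal_union_le _ _)
      linarith
    have h3 := (main Ω (-u) hu' x₀ R (-M) (-m) hR hΩ hosc.neg hcase').neg
    rw [neg_neg, neg_neg] at h3
    exact ⟨_, _, by rw [hτdef]; ring, h3⟩

/-- Quantitative Hölder decay in nonlocal De Giorgi classes: `X` dominates the tail and the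
`Lᵖ` average of `u`. -/
lemma exists_osc_decay (n : ℕ) (hn : 1 ≤ n) {s p H C : ℝ} (hp : 1 < p) (hs : 0 < s)
    (hH : 0 < H) (hC : IsKernelConst n s p C) :
    ∃ α c : ℝ, 0 < α ∧ α ≤ 1 ∧ α < s * p / (p - 1) ∧ 0 < c ∧
      ∀ (Ω : Set (EuclideanSpace ℝ (Fin n))) (u : EuclideanSpace ℝ (Fin n) → ℝ),
      DeGiorgiClass n s p H Ω u → DeGiorgiClass n s p H Ω (-u) →
      ∀ (x₀ : EuclideanSpace ℝ (Fin n)) (r X : ℝ), 0 < r → 0 < X → Metric.ball x₀ (2 * r) ⊆ Ω →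
        r ^ (s * p) * tailIntegral n s p (fun x => |u x|) x₀ r ≤ X ^ (p - 1) →
        ∫ x in Metric.ball x₀ (2 * r), |u x| ^ p ≤
          X ^ p * volume.real (Metric.ball x₀ (2 * r)) →
        (∀ᵐ x, x ∈ Metric.ball x₀ r → |u x| ≤ c * X) ∧
        ∀ ρ, 0 < ρ → ρ ≤ r → ∃ m M : ℝ, M - m ≤ c * (ρ / r) ^ α * X ∧
          (∀ᵐ x, x ∈ Metric.ball x₀ ρ → m ≤ u x) ∧ ∀ᵐ x, x ∈ Metric.ball x₀ ρ → u x ≤ M := by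
  have hp0 : 0 < p := by linarith
  have hp1 : 0 < p - 1 := by linarith
  have hsp : 0 < s * p := by positivity
  obtain ⟨A, δ, θ, τ, hA1, hδ, hθ, hθ4, hτ2, hτ1, hθτ, hstep⟩ := exists_osc_step n hn hp hs hH hC
  obtain ⟨ν, hν, hsup⟩ := exists_le_of_small_excess n hn (A := 1) hp hs hH zero_le_one hC
  have hω := unitBallVolume_pos n
  have hτ0 : 0 < τ := by linarith
  have hθ1 : θ < 1 := by linarith
  have hlogθ : Real.log θ < 0 := Real.log_neg hθ hθ1
  have hlogτ : Real.log τ < 0 := Real.log_neg hτ0 hτ1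
  obtain ⟨α, hαdef⟩ : ∃ α : ℝ, α = Real.log τ / Real.log θ := ⟨_, rfl⟩
  have hα0 : 0 < α := hαdef ▸ div_pos_of_neg_of_neg hlogτ hlogθ
  have hθα : θ ^ α = τ := by
    rw [Real.rpow_def_of_pos hθ, hαdef, mul_div_cancel₀ _ hlogθ.ne, Real.exp_log hτ0]
  have hα1 : α ≤ 1 := by
    rw [hαdef, div_le_one_of_neg hlogθ]
    exact Real.log_le_log hθ (by linarith)
  have hαsp : α < s * p / (p - 1) := by
    rw [lt_div_iff₀ hp1]
    rw [← hθα, ← Real.rpow_mul hθ.le] at hθτ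
    exact (Real.rpow_lt_rpow_left_iff_of_base_lt_one hθ hθ1).1 hθτ
  obtain ⟨c₂, hc21, hc2ν, hc2δ⟩ : ∃ c₂ : ℝ, 1 ≤ c₂ ∧
      2 ^ (n : ℝ) * unitBallVolume n ≤ ν * c₂ ^ p ∧ 1 ≤ δ * (2 * c₂) := by
    have h0 : 0 < 2 ^ (n : ℝ) * unitBallVolume n / ν := by positivity
    obtain ⟨c₃, hc30, hc3⟩ : ∃ c₃ : ℝ, 0 < c₃ ∧ c₃ ^ p = 2 ^ (n : ℝ) * unitBallVolume n / ν := by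
      refine ⟨(2 ^ (n : ℝ) * unitBallVolume n / ν) ^ (1 / p), by positivity, ?_⟩
      rw [← Real.rpow_mul h0.le, one_div, inv_mul_cancel₀ hp0.ne', Real.rpow_one]
    have h1 : 0 < 1 / (2 * δ) := by positivity
    refine ⟨1 + c₃ + 1 / (2 * δ), by linarith, ?_, ?_⟩
    · have h2 : c₃ ^ p ≤ (1 + c₃ + 1 / (2 * δ)) ^ p :=
        Real.rpow_le_rpow hc30.le (by linarith) hp0.le
      rw [hc3, div_le_iff₀ hν] at h2
      linarith
    · have : δ * (2 * (1 / (2 * δ))) = 1 := by field_simp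
      nlinarith
  have hc20 : 0 < c₂ := by linarith
  refine ⟨α, 2 * c₂ * (θ ^ α)⁻¹, hα0, hα1, hαsp, by positivity,
    fun Ω u hu hu' x₀ r X hr hX hΩ htail havg => ?_⟩
  have hcc : c₂ ≤ 2 * c₂ * (θ ^ α)⁻¹ := by
    rw [hθα]
    have : 1 ≤ τ⁻¹ := (one_le_inv₀ hτ0).2 hτ1.le
    nlinarith
  -- excesses over nonnegative levels are dominated by `|u|`
  have hex : ∀ (w : EuclideanSpace ℝ (Fin n) → ℝ) (k : ℝ), 0 ≤ k → (∀ x, w x ≤ |u x|) →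
      ∀ x, excess w k x ≤ |u x| := fun w k hk hw x =>
    max_le (by linarith [hw x]) (abs_nonneg _)
  have htailw : ∀ (w : EuclideanSpace ℝ (Fin n) → ℝ), Measurable w →
      MemLp w (ENNReal.ofReal p) volume → (∀ x, w x ≤ |u x|) → ∀ k, 0 ≤ k →
      r ^ (s * p) * tailIntegral n s p (excess w k) x₀ r ≤ X ^ (p - 1) := by
    intro w hw hwp hwu k hk
    refine le_trans (mul_le_mul_of_nonneg_left ?_ (by positivity)) htail
    refine integral_mono (integrableOn_tail_excess hC hp hsp.le hw hwp hr k x₀)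
      (integrableOn_tail hC hp hsp.le hr hu.memLp (by have := hu.measurable; fun_prop)
        (fun x => abs_nonneg (u x)) le_rfl (fun x => by simp) x₀) fun y => ?_
    exact mul_le_mul_of_nonneg_right (Real.rpow_le_rpow (excess_nonneg _ _ _)
      (hex w k hk hwu y) hp1.le) (by positivity)
  have hbound : ∀ (w : EuclideanSpace ℝ (Fin n) → ℝ), DeGiorgiClass n s p H Ω w →
      (∀ x, w x ≤ |u x|) → ∀ᵐ x, x ∈ Metric.ball x₀ r → w x ≤ c₂ * X := by
    intro w hw hwu
    have h := hsup Ω w hw x₀ r (c₂ * X) 0 hr (by positivity) hΩ ?_ ?_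
    · simpa using h
    · refine (htailw w hw.measurable hw.memLp hwu 0 le_rfl).trans ?_
      rw [one_mul]
      exact Real.rpow_le_rpow hX.le (by nlinarith) hp1.le
    · have h1 : ∫ x in Metric.ball x₀ (2 * r), excess w 0 x ^ p ≤
          ∫ x in Metric.ball x₀ (2 * r), |u x| ^ p :=
        integral_mono (integrableOn_excess_rpow hp hw.measurable hw.memLp 0 x₀ (2 * r))
          (integrable_abs_rpow hp hu.memLp).integrableOn fun x =>
          Real.rpow_le_rpow (excess_nonneg _ _ _) (hex w 0 le_rfl hwu x) hp0.le
      refine h1.trans (havg.trans ?_)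
      rw [volume_real_ball x₀ (by positivity), Real.mul_rpow (by norm_num) hr.le,
        Real.mul_rpow hc20.le hX.le]
      have h2 := mul_le_mul_of_nonneg_left hc2ν (by positivity : 0 ≤ X ^ p * r ^ (n : ℝ))
      linarith
  have hb1 := hbound u hu fun x => le_abs_self _
  have hb2 := hbound (-u) hu' fun x => neg_le_abs _
  refine ⟨?_, fun ρ hρ hρr => ?_⟩
  · filter_upwards [hb1, hb2] with x h1 h2 hx
    refine (abs_le'.2 ⟨h1 hx, h2 hx⟩).trans (mul_le_mul_of_nonneg_right hcc hX.le)
  have hinit : OscControl s p A δ u x₀ (-(c₂ * X)) (c₂ * X) r := by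
    have hcX : 0 < c₂ * X := by positivity
    have h1 : X ^ (p - 1) ≤ A * (δ * (c₂ * X - -(c₂ * X))) ^ (p - 1) := by
      have : X ^ (p - 1) ≤ (δ * (c₂ * X - -(c₂ * X))) ^ (p - 1) :=
        Real.rpow_le_rpow hX.le (by nlinarith) hp1.le
      exact this.trans (le_mul_of_one_le_left (Real.rpow_nonneg (by
        have : c₂ * X - -(c₂ * X) = 2 * (c₂ * X) := by ring
        rw [this]; positivity) _) hA1)
    refine ⟨by linarith, ?_, hb1, ?_, ?_⟩
    · filter_upwards [hb2] with x hx hxr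
      have : -u x ≤ c₂ * X := hx hxr
      linarith
    · exact (htailw u hu.measurable hu.memLp (fun x => le_abs_self _) _ hcX.le).trans h1
    · rw [neg_neg]
      exact (htailw (-u) hu'.measurable hu'.memLp (fun x => neg_le_abs _) _ hcX.le).trans h1
  have hiter : ∀ j : ℕ, ∃ m M : ℝ, M - m = τ ^ j * (2 * (c₂ * X)) ∧
      OscControl s p A δ u x₀ m M (θ ^ j * r) := by
    intro j
    induction j with
    | zero => exact ⟨-(c₂ * X), c₂ * X, by ring, by simpa using hinit⟩
    | succ j ih =>
      obtain ⟨m, M, hMm, hosc⟩ := ih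
      have hθj : θ ^ j * r ≤ 2 * r := by
        have : θ ^ j ≤ 1 := pow_le_one₀ hθ.le hθ1.le
        nlinarith
      obtain ⟨m', M', h1, h2⟩ := hstep Ω u hu hu' x₀ (θ ^ j * r) m M (by positivity)
        ((Metric.ball_subset_ball hθj).trans hΩ) hosc
      refine ⟨m', M', by rw [h1, hMm]; ring, ?_⟩
      rwa [pow_succ', mul_assoc]
  obtain ⟨j, hj1, hj2⟩ := exists_nat_pow_near_of_lt_one (div_pos hρ hr)
    ((div_le_one hr).2 hρr) hθ hθ1
  obtain ⟨m, M, hMm, hosc⟩ := hiter j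
  have hsub : Metric.ball x₀ ρ ⊆ Metric.ball x₀ (θ ^ j * r) :=
    Metric.ball_subset_ball ((div_le_iff₀ hr).1 hj2)
  refine ⟨m, M, ?_, ?_, ?_⟩
  · have h1 : τ ^ j ≤ (θ ^ α)⁻¹ * (ρ / r) ^ α := by
      have h2 := Real.rpow_le_rpow (by positivity) hj1.le hα0.le
      have h3 : (θ ^ (j + 1)) ^ α = τ ^ j * θ ^ α := by
        rw [← Real.rpow_natCast, ← Real.rpow_mul hθ.le, mul_comm, Real.rpow_mul hθ.le, hθα,
          Real.rpow_natCast, pow_succ]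
      rw [h3] at h2
      rw [inv_mul_eq_div, le_div_iff₀ (by positivity)]
      exact h2
    rw [hMm]
    have h4 := mul_le_mul_of_nonneg_right h1 (by positivity : 0 ≤ 2 * (c₂ * X))
    linarith
  · filter_upwards [hosc.lower] with x hx hxr using hx (hsub hxr)
  · filter_upwards [hosc.upper] with x hx hxr using hx (hsub hxr)

/-! ### Continuous representatives -/

/-- Essential bounds on two overlapping balls are compatible. -/
lemma le_of_ae_ball {n : ℕ} {u : EuclideanSpace ℝ (Fin n) → ℝ} {x y : EuclideanSpace ℝ (Fin n)}
    {ρ σ m a : ℝ} (hσ : 0 < σ) (hy : y ∈ Metric.ball x ρ)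
    (hm : ∀ᵐ z, z ∈ Metric.ball x ρ → m ≤ u z) (ha : ∀ᵐ z, z ∈ Metric.ball y σ → u z ≤ a) :
    m ≤ a := by
  by_contra hcon
  rw [not_le] at hcon
  have hpos : 0 < volume (Metric.ball x ρ ∩ Metric.ball y σ) :=
    (Metric.isOpen_ball.inter Metric.isOpen_ball).measure_pos volume
      ⟨y, hy, Metric.mem_ball_self hσ⟩
  have hnull : volume {z | ¬((z ∈ Metric.ball x ρ → m ≤ u z) ∧ (z ∈ Metric.ball y σ → u z ≤ a))} =
      0 := ae_iff.1 (hm.and ha)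
  refine hpos.ne' (measure_mono_null (fun z hz => ?_) hnull)
  simp only [mem_ofPred_eq]
  rintro ⟨h1, h2⟩
  linarith [h1 hz.1, h2 hz.2]

/-- The upper envelope of `u` at `x`, the infimum of the essential upper bounds of `u` on balls
around `x`. The value is meaningful where `u` is locally essentially bounded. -/
def upperEnvelope {n : ℕ} (u : EuclideanSpace ℝ (Fin n) → ℝ) (x : EuclideanSpace ℝ (Fin n)) : ℝ :=
  sInf {a | ∃ σ : ℝ, 0 < σ ∧ ∀ᵐ z, z ∈ Metric.ball x σ → u z ≤ a}

lemma upperEnvelope_mem_Icc {n : ℕ} {u : EuclideanSpace ℝ (Fin n) → ℝ}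
    {x y : EuclideanSpace ℝ (Fin n)} {ρ m M : ℝ} (hy : y ∈ Metric.ball x ρ)
    (hm : ∀ᵐ z, z ∈ Metric.ball x ρ → m ≤ u z) (hM : ∀ᵐ z, z ∈ Metric.ball x ρ → u z ≤ M) :
    upperEnvelope u y ∈ Icc m M := by
  have hMmem : M ∈ {a | ∃ σ : ℝ, 0 < σ ∧ ∀ᵐ z, z ∈ Metric.ball y σ → u z ≤ a} := by
    obtain ⟨σ, hσ, hsub⟩ := Metric.isOpen_iff.1 Metric.isOpen_ball y hy
    exact ⟨σ, hσ, hM.mono fun z hz h => hz (hsub h)⟩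
  have hlb : ∀ a ∈ {a | ∃ σ : ℝ, 0 < σ ∧ ∀ᵐ z, z ∈ Metric.ball y σ → u z ≤ a}, m ≤ a := by
    rintro a ⟨σ, hσ, ha⟩
    exact le_of_ae_ball hσ hy hm ha
  exact ⟨le_csInf ⟨M, hMmem⟩ hlb, csInf_le ⟨m, hlb⟩ hMmem⟩

/-- Where the oscillation of `u` over small balls tends to zero, the upper envelope agrees with `u`
almost everywhere, by Lebesgue's differentiation theorem. -/
lemma upperEnvelope_ae_eq {n : ℕ} {u : EuclideanSpace ℝ (Fin n) → ℝ} (hu : LocallyIntegrable u)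
    {Ω : Set (EuclideanSpace ℝ (Fin n))}
    (h : ∀ x ∈ Ω, ∀ ε : ℝ, 0 < ε → ∃ ρ m M : ℝ, 0 < ρ ∧ M - m ≤ ε ∧
      (∀ᵐ z, z ∈ Metric.ball x ρ → m ≤ u z) ∧ ∀ᵐ z, z ∈ Metric.ball x ρ → u z ≤ M) :
    ∀ᵐ x, x ∈ Ω → upperEnvelope u x = u x := by
  filter_upwards [IsUnifLocDoublingMeasure.ae_tendsto_average volume hu 1] with x hx hxΩ
  have hlim := hx (fun _ : ℝ => x) (fun δ => δ) (l := nhdsWithin 0 (Ioi 0)) Filter.tendsto_id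
    (by filter_upwards [self_mem_nhdsWithin] with δ hδ
        simpa using (mem_Ioi.1 hδ).le)
  refine eq_of_abs_sub_le_all fun ε hε => ?_
  obtain ⟨ρ, m, M, hρ, hMm, hm, hM⟩ := h x hxΩ ε hε
  have h1 := upperEnvelope_mem_Icc (Metric.mem_ball_self hρ) hm hM
  have h2 : u x ∈ Icc m M := by
    refine isClosed_Icc.mem_of_tendsto hlim ?_
    filter_upwards [Ioo_mem_nhdsGT hρ] with δ hδ
    have hsub : Metric.closedBall x δ ⊆ Metric.ball x ρ :=
      Metric.closedBall_subset_ball hδ.2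
    refine (convex_Icc m M).set_average_mem isClosed_Icc
      (Metric.measure_closedBall_pos volume x hδ.1).ne' measure_closedBall_lt_top.ne ?_
      (hu.integrableOn_isCompact (isCompact_closedBall x δ))
    refine (ae_restrict_iff' measurableSet_closedBall).2 ?_
    filter_upwards [hm, hM] with z h3 h4 hz
    exact ⟨h3 (hsub hz), h4 (hsub hz)⟩
  rw [abs_le]
  constructor <;> linarith [h1.1, h1.2, h2.1, h2.2]

/-! ### Weak solutions -/

lemma FracSobolev.congr_ae {n : ℕ} {s p : ℝ} {u v : EuclideanSpace ℝ (Fin n) → ℝ}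
    (hu : FracSobolev n s p u) (h : u =ᵐ[volume] v) : FracSobolev n s p v := by
  refine ⟨hu.1.ae_eq h, hu.2.ae_eq ?_⟩
  have h1 := Measure.quasiMeasurePreserving_fst (μ := (volume : Measure (EuclideanSpace ℝ (Fin n))))
    (ν := (volume : Measure (EuclideanSpace ℝ (Fin n)))) |>.ae_eq_comp h
  have h2 := Measure.quasiMeasurePreserving_snd (μ := (volume : Measure (EuclideanSpace ℝ (Fin n))))
    (ν := (volume : Measure (EuclideanSpace ℝ (Fin n)))) |>.ae_eq_comp h
  rw [← Measure.volume_eq_prod] at h1 h2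
  filter_upwards [h1, h2] with z hz1 hz2
  simp only [Function.comp] at hz1 hz2
  rw [hz1, hz2]

lemma energyForm_congr_ae {n : ℕ} {p : ℝ}
    {K : EuclideanSpace ℝ (Fin n) → EuclideanSpace ℝ (Fin n) → ℝ}
    {u v : EuclideanSpace ℝ (Fin n) → ℝ} (h : u =ᵐ[volume] v) (η) :
    energyForm n p K u η = energyForm n p K v η := by
  refine integral_congr_ae ?_
  have h1 := Measure.quasiMeasurePreserving_fst (μ := (volume : Measure (EuclideanSpace ℝ (Fin n))))
    (ν := (volume : Measure (EuclideanSpace ℝ (Fin n)))) |>.ae_eq_comp h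
  have h2 := Measure.quasiMeasurePreserving_snd (μ := (volume : Measure (EuclideanSpace ℝ (Fin n))))
    (ν := (volume : Measure (EuclideanSpace ℝ (Fin n)))) |>.ae_eq_comp h
  rw [← Measure.volume_eq_prod] at h1 h2
  filter_upwards [h1, h2] with z hz1 hz2
  simp only [Function.comp] at hz1 hz2
  rw [hz1, hz2]

lemma energyForm_neg {n : ℕ} {p : ℝ}
    {K : EuclideanSpace ℝ (Fin n) → EuclideanSpace ℝ (Fin n) → ℝ}
    (u η : EuclideanSpace ℝ (Fin n) → ℝ) : energyForm n p K (-u) η = -energyForm n p K u η := by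
  unfold energyForm
  rw [← integral_neg]
  congr 1; funext z
  simp only [Pi.neg_apply]
  rw [show -u z.1 - -u z.2 = -(u z.1 - u z.2) by ring, abs_neg]
  ring

lemma FracSobolev.neg {n : ℕ} {s p : ℝ} {u : EuclideanSpace ℝ (Fin n) → ℝ}
    (hu : FracSobolev n s p u) : FracSobolev n s p (-u) := by
  refine ⟨hu.1.neg, ?_⟩
  convert hu.2 using 3 with z
  simp only [Pi.neg_apply]
  rw [show -u z.1 - -u z.2 = -(u z.1 - u z.2) by ring, abs_neg]

lemma IsWeakSolution.isTestSubsolution {n : ℕ} {s p : ℝ}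
    {K : EuclideanSpace ℝ (Fin n) → EuclideanSpace ℝ (Fin n) → ℝ}
    {Ω : Set (EuclideanSpace ℝ (Fin n))} {g u v : EuclideanSpace ℝ (Fin n) → ℝ}
    (h : IsWeakSolution n s p K Ω g u) (huv : u =ᵐ[volume] v) :
    IsTestSubsolution n s p K Ω v ∧ IsTestSubsolution n s p K Ω (-v) := by
  have hv := h.1.mem.congr_ae huv
  refine ⟨⟨hv, fun η hη h0 => ?_⟩, hv.neg, fun η hη h0 => ?_⟩
  · rw [← energyForm_congr_ae huv]; exact h.1.test η hη h0
  · rw [energyForm_neg, ← energyForm_congr_ae huv]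
    linarith [h.2.test η hη h0]

lemma essOsc_le {n : ℕ} {u : EuclideanSpace ℝ (Fin n) → ℝ} {x₀ : EuclideanSpace ℝ (Fin n)}
    {ρ m M : ℝ} (hm : ∀ᵐ x, x ∈ Metric.ball x₀ ρ → m ≤ u x)
    (hM : ∀ᵐ x, x ∈ Metric.ball x₀ ρ → u x ≤ M) :
    essOsc u (Metric.ball x₀ ρ) ≤ ((M - m : ℝ) : EReal) := by
  rw [EReal.coe_sub]
  refine EReal.sub_le_sub ?_ ?_
  · refine essSup_le_of_ae_le _ ((ae_restrict_iff' measurableSet_ball).2 ?_)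
    filter_upwards [hM] with x hx hxr using EReal.coe_le_coe (hx hxr)
  · refine le_essInf_of_ae_le _ ((ae_restrict_iff' measurableSet_ball).2 ?_)
    filter_upwards [hm] with x hx hxr using EReal.coe_le_coe (hx hxr)

/-- The tail of an `Lᵖ` function, bounded uniformly in the centre. -/
lemma tailIntegral_abs_le {n : ℕ} {s p C r : ℝ} (hC : IsKernelConst n s p C) (hp : 1 < p)
    (hsp : 0 ≤ s * p) (hr : 0 < r) {u : EuclideanSpace ℝ (Fin n) → ℝ} (hu : Measurable u)
    (hup : MemLp u (ENNReal.ofReal p) volume) (x₀ : EuclideanSpace ℝ (Fin n)) :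
    tailIntegral n s p (fun x => |u x|) x₀ r ≤
      C * r ^ (-(s * p)) + r ^ (-(n + s * p)) * ∫ x, |u x| ^ p := by
  obtain ⟨i1, j1⟩ := integrableOn_compl_ball hC hr x₀
  have i2 : IntegrableOn (fun x => r ^ (-(n + s * p)) * |u x| ^ p) (Metric.ball x₀ r)ᶜ :=
    ((integrable_abs_rpow hp hup).const_mul _).integrableOn
  have h1 : tailIntegral n s p (fun x => |u x|) x₀ r ≤ ∫ y in (Metric.ball x₀ r)ᶜ,
      (‖y - x₀‖ ^ (-(n + s * p)) + r ^ (-(n + s * p)) * |u y| ^ p) := by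
    refine setIntegral_mono_on (integrableOn_tail hC hp hsp hr hup (by fun_prop)
      (fun x => abs_nonneg (u x)) le_rfl (fun x => by simp) x₀) (i1.add i2)
      measurableSet_ball.compl fun y hy => ?_
    have h2 := mul_le_mul_of_nonneg_right (rpow_sub_one_le_one_add hp (abs_nonneg (u y)))
      (by positivity : 0 ≤ ‖y - x₀‖ ^ (-(n + s * p)))
    have h3 := mul_le_mul_of_nonneg_right (norm_rpow_le_of_notMem_ball hsp hr hy)
      (by positivity : 0 ≤ |u y| ^ p)
    linarith
  refine h1.trans ?_
  rw [integral_add i1 i2, integral_const_mul]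
  refine add_le_add j1 (mul_le_mul_of_nonneg_left ?_ (by positivity))
  exact setIntegral_le_integral (integrable_abs_rpow hp hup)
    (Filter.Eventually.of_forall fun x => by positivity)

/-- A function whose oscillation decays at the rate `α`, uniformly over the points of `S`, has an
upper envelope that is `α`-Hölder on `S`. -/
lemma holderOnWith_upperEnvelope {n : ℕ} {u : EuclideanSpace ℝ (Fin n) → ℝ}
    {S : Set (EuclideanSpace ℝ (Fin n))} {α r c : ℝ} (hα : 0 < α) (hr : 0 < r) (hc : 0 ≤ c)
    (hb : ∀ x ∈ S, ∀ᵐ z, z ∈ Metric.ball x r → |u z| ≤ c)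
    (hosc : ∀ x ∈ S, ∀ ρ, 0 < ρ → ρ ≤ r → ∃ m M : ℝ, M - m ≤ c * (ρ / r) ^ α ∧
      (∀ᵐ z, z ∈ Metric.ball x ρ → m ≤ u z) ∧ ∀ᵐ z, z ∈ Metric.ball x ρ → u z ≤ M) :
    ∃ C : NNReal, HolderOnWith C α.toNNReal (upperEnvelope u) S := by
  have key : ∀ x ∈ S, ∀ y ∈ S, |upperEnvelope u x - upperEnvelope u y| ≤
      2 * c * (2 / r) ^ α * dist x y ^ α := by
    intro x hx y hy
    rcases eq_or_ne x y with rfl | hxy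
    · simp [Real.zero_rpow hα.ne']
    have hd : 0 < dist x y := dist_pos.2 hxy
    have e : 2 * c * (2 / r) ^ α * dist x y ^ α = 2 * (c * (2 * dist x y / r) ^ α) := by
      rw [mul_assoc (2 * c), ← Real.mul_rpow (by positivity) hd.le]
      rw [show 2 / r * dist x y = 2 * dist x y / r by ring]; ring
    rw [e]
    rcases le_or_gt (2 * dist x y) r with h | h
    · obtain ⟨m, M, hMm, hm, hM⟩ := hosc x hx (2 * dist x y) (by positivity) h
      have h1 := upperEnvelope_mem_Icc (Metric.mem_ball_self (by positivity)) hm hM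
      have h2 := upperEnvelope_mem_Icc (y := y) (by
        rw [Metric.mem_ball, dist_comm]; linarith) hm hM
      have h3 : 0 ≤ c * (2 * dist x y / r) ^ α := by positivity
      rw [abs_le]
      constructor <;> linarith [h1.1, h1.2, h2.1, h2.2]
    · have hv : ∀ z ∈ S, |upperEnvelope u z| ≤ c := fun z hz => by
        have := upperEnvelope_mem_Icc (m := -c) (M := c) (Metric.mem_ball_self hr)
          ((hb z hz).mono fun w hw hwr => (abs_le.1 (hw hwr)).1)
          ((hb z hz).mono fun w hw hwr => (abs_le.1 (hw hwr)).2)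
        exact abs_le.2 this
      have h1 : 1 ≤ (2 * dist x y / r) ^ α :=
        Real.one_le_rpow (by rw [le_div_iff₀ hr]; linarith) hα.le
      have h2 := abs_sub (upperEnvelope u x) (upperEnvelope u y)
      have h3 := mul_le_mul_of_nonneg_left h1 hc
      linarith [hv x hx, hv y hy]
  have hK : 0 ≤ 2 * c * (2 / r) ^ α := by positivity
  refine ⟨(2 * c * (2 / r) ^ α).toNNReal, fun x hx y hy => ?_⟩
  rw [edist_dist, edist_dist, Real.coe_toNNReal α hα.le, ENNReal.ofReal_rpow_of_nonneg dist_nonneg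
    hα.le]
  change _ ≤ ENNReal.ofReal (2 * c * (2 / r) ^ α) * _
  rw [← ENNReal.ofReal_mul hK]
  refine ENNReal.ofReal_le_ofReal ?_
  rw [Real.dist_eq]
  exact key x hx y hy

end

/-! ### Hölder continuity -/

/-- Hölder continuity of weak solutions: `u` has a representative on `Ω` which is `α`-Hölder on
every compact subset of `Ω`, with the quantitative decay of the oscillation. -/
theorem theorem1p2 (n : ℕ) (hn : 1 ≤ n) (p s lam Lam : ℝ) (hp : 1 < p) (hs0 : 0 < s) (hs1 : s < 1)
    (hlam : 1 ≤ lam) (hLam : lam ≤ Lam) :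
    ∃ α c : ℝ, 0 < α ∧ α ≤ 1 ∧ α < s * p / (p - 1) ∧ 0 < c ∧
      ∀ (K : EuclideanSpace ℝ (Fin n) → EuclideanSpace ℝ (Fin n) → ℝ)
        (Ω : Set (EuclideanSpace ℝ (Fin n))) (g u : EuclideanSpace ℝ (Fin n) → ℝ),
        IsEllipticKernel n s p lam Lam K →
        IsOpen Ω → Bornology.IsBounded Ω →
        FracSobolev n s p g →
        IsWeakSolution n s p K Ω g u →
        (∃ v : EuclideanSpace ℝ (Fin n) → ℝ, (∀ᵐ x, x ∈ Ω → v x = u x) ∧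
          ∀ S : Set (EuclideanSpace ℝ (Fin n)), IsCompact S → S ⊆ Ω →
            ∃ C : NNReal, HolderOnWith C α.toNNReal v S) ∧
        ∀ (x₀ : EuclideanSpace ℝ (Fin n)) (r : ℝ), 0 < r → Metric.ball x₀ (2 * r) ⊆ Ω →
          ∀ ρ : ℝ, 0 < ρ → ρ ≤ r →
            essOsc u (Metric.ball x₀ ρ) ≤
              ((c * (ρ / r) ^ α *
                (nonlocalTail n s p u x₀ r +
                  (⨍ x in Metric.ball x₀ (2 * r), |u x| ^ p) ^ (1 / p)) : ℝ) : EReal) := by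
  have hp0 : 0 < p := by linarith
  have hp1 : 0 < p - 1 := by linarith
  have hsp : 0 < s * p := by positivity
  obtain ⟨C, hC⟩ : ∃ C, IsKernelConst n s p C :=
    exists_lintegral_truncated_kernel_le n hn p s hp hs0 hs1
  obtain ⟨H, hHdef⟩ : ∃ H : ℝ, H = caccioppoliConst n s p Lam C * (1 + 2 / unitBallVolume n) :=
    ⟨_, rfl⟩
  have hω := unitBallVolume_pos n
  have hH : 0 < H := by
    have hC0 : 0 < C := zero_lt_one.trans_le hC.1
    have hG0 := gainConst_pos p
    have hL0 : 0 < lossConst p := by linarith [two_le_lossConst p hp]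
    have : 0 < Lam := by linarith
    rw [hHdef, caccioppoliConst]; positivity
  obtain ⟨α, c, hα0, hα1, hαsp, hc, hdecay⟩ := exists_osc_decay n hn hp hs0 hH hC
  refine ⟨α, c, hα0, hα1, hαsp, hc, fun K Ω g u hK hΩo hΩb hg hu => ?_⟩
  -- pass to a Borel representative `w` of `u`
  have hae := hu.1.mem.1.aestronglyMeasurable
  obtain ⟨w, hwm, huw⟩ : ∃ w : EuclideanSpace ℝ (Fin n) → ℝ, Measurable w ∧ u =ᵐ[volume] w :=
    ⟨hae.mk u, hae.stronglyMeasurable_mk.measurable, hae.ae_eq_mk⟩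
  obtain ⟨hsub, hsup⟩ := hu.isTestSubsolution huw
  have hDG : DeGiorgiClass n s p H Ω w :=
    hHdef ▸ deGiorgiClass_of_isTestSubsolution hp hsp.le hlam hLam hC hK hwm hsub
  have hDG' : DeGiorgiClass n s p H Ω (-w) :=
    hHdef ▸ deGiorgiClass_of_isTestSubsolution hp hsp.le hlam hLam hC hK hwm.neg hsup
  have hwp := hDG.memLp
  have hdec := hdecay Ω w hDG hDG'
  have hIw : 0 ≤ ∫ x, |w x| ^ p := integral_nonneg fun x => by positivity
  have hIball : ∀ x₀ r, 0 ≤ ∫ x in Metric.ball x₀ r, |w x| ^ p := fun x₀ r =>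
    integral_nonneg fun x => by positivity
  -- for a fixed radius, the right-hand side is bounded uniformly in the centre
  have hunif : ∀ r : ℝ, 0 < r → ∃ X : ℝ, 0 < X ∧ ∀ x₀ : EuclideanSpace ℝ (Fin n),
      r ^ (s * p) * tailIntegral n s p (fun x => |w x|) x₀ r ≤ X ^ (p - 1) ∧
      ∫ x in Metric.ball x₀ (2 * r), |w x| ^ p ≤
        X ^ p * volume.real (Metric.ball x₀ (2 * r)) := by
    intro r hr
    have hC0 : 0 < C := zero_lt_one.trans_le hC.1
    obtain ⟨T₀, hT₀⟩ : ∃ T₀ : ℝ, T₀ = r ^ (s * p) * (C * r ^ (-(s * p)) +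
      r ^ (-(n + s * p)) * ∫ x, |w x| ^ p) := ⟨_, rfl⟩
    have hT₀0 : 0 < T₀ := by rw [hT₀]; positivity
    obtain ⟨V, hV⟩ : ∃ V : ℝ, V = (2 * r) ^ (n : ℝ) * unitBallVolume n := ⟨_, rfl⟩
    have hV0 : 0 < V := by rw [hV]; positivity
    have hI0 : 0 ≤ ((∫ x, |w x| ^ p) / V) ^ (1 / p) := by positivity
    have hT1 : 0 < T₀ ^ (1 / (p - 1)) := by positivity
    refine ⟨T₀ ^ (1 / (p - 1)) + ((∫ x, |w x| ^ p) / V) ^ (1 / p), by positivity,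
      fun x₀ => ⟨?_, ?_⟩⟩
    · have h1 := mul_le_mul_of_nonneg_left (tailIntegral_abs_le hC hp hsp.le hr hwm hwp x₀)
        (by positivity : 0 ≤ r ^ (s * p))
      rw [← hT₀] at h1
      refine h1.trans (le_trans (le_of_eq ?_) (Real.rpow_le_rpow hT1.le
        (le_add_of_nonneg_right hI0) hp1.le))
      rw [← Real.rpow_mul hT₀0.le, one_div, inv_mul_cancel₀ hp1.ne', Real.rpow_one]
    · have h1 : ∫ x in Metric.ball x₀ (2 * r), |w x| ^ p ≤ ∫ x, |w x| ^ p :=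
        setIntegral_le_integral (integrable_abs_rpow hp hwp)
          (Filter.Eventually.of_forall fun x => by positivity)
      rw [volume_real_ball x₀ (by positivity), ← hV, ← div_le_iff₀ hV0]
      refine ((div_le_div_iff_of_pos_right hV0).2 h1).trans (le_trans (le_of_eq ?_)
        (Real.rpow_le_rpow hI0 (le_add_of_nonneg_left hT1.le) hp0.le))
      rw [← Real.rpow_mul (by positivity), one_div, inv_mul_cancel₀ hp0.ne', Real.rpow_one]
  constructor
  · refine ⟨upperEnvelope w, ?_, fun S hS hSΩ => ?_⟩
    · have hw0 := upperEnvelope_ae_eq (Ω := Ω) (hwp.locallyIntegrable (by simpa using hp.le)) ?_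
      · filter_upwards [hw0, huw] with x h1 h2 hx
        rw [h1 hx, h2]
      intro x hx ε hε
      obtain ⟨d, hd, hdΩ⟩ := Metric.isOpen_iff.1 hΩo x hx
      obtain ⟨X, hX, hXb⟩ := hunif (d / 2) (by positivity)
      obtain ⟨-, hosc⟩ := hdec x (d / 2) X (by positivity) hX
        (by rwa [mul_div_cancel₀ d two_ne_zero]) (hXb x).1 (hXb x).2
      obtain ⟨t, ht0, ht1, ht⟩ : ∃ t : ℝ, 0 < t ∧ t ≤ 1 ∧ c * t ^ α * X ≤ ε := by
        refine ⟨min 1 ((ε / (c * X)) ^ (1 / α)), by positivity, min_le_left _ _, ?_⟩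
        have h1 := Real.rpow_le_rpow (by positivity)
          (min_le_right 1 ((ε / (c * X)) ^ (1 / α))) hα0.le
        rw [← Real.rpow_mul (by positivity), one_div, inv_mul_cancel₀ hα0.ne', Real.rpow_one,
          le_div_iff₀ (by positivity)] at h1
        rw [one_div]
        linarith
      obtain ⟨m, M, hMm, hm, hM⟩ := hosc (t * (d / 2)) (by positivity)
        (mul_le_of_le_one_left (by positivity) ht1)
      rw [mul_div_cancel_right₀ t (by positivity)] at hMm
      exact ⟨t * (d / 2), m, M, by positivity, hMm.trans ht, hm, hM⟩
    · obtain ⟨d, hd, hdΩ⟩ := hS.exists_thickening_subset_open hΩo hSΩ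
      obtain ⟨X, hX, hXb⟩ := hunif (d / 2) (by positivity)
      have hall : ∀ x ∈ S, _ := fun x hx => hdec x (d / 2) X (by positivity) hX
        (by rw [mul_div_cancel₀ d two_ne_zero]
            exact (Metric.ball_subset_thickening hx d).trans hdΩ) (hXb x).1 (hXb x).2
      refine holderOnWith_upperEnvelope (r := d / 2) (c := c * X) hα0 (by positivity)
        (by positivity) (fun x hx => (hall x hx).1) fun x hx ρ hρ hρr => ?_
      obtain ⟨m, M, hMm, h⟩ := (hall x hx).2 ρ hρ hρr
      exact ⟨m, M, by linarith, h⟩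
  · intro x₀ r hr hball ρ hρ hρr
    have eT : nonlocalTail n s p u x₀ r =
        (r ^ (s * p) * tailIntegral n s p (fun x => |w x|) x₀ r) ^ (1 / (p - 1)) := by
      unfold nonlocalTail tailIntegral
      congr 2
      refine integral_congr_ae (ae_restrict_of_ae ?_)
      filter_upwards [huw] with x hx
      rw [hx]
    have eA : ⨍ x in Metric.ball x₀ (2 * r), |u x| ^ p =
        (volume.real (Metric.ball x₀ (2 * r)))⁻¹ * ∫ x in Metric.ball x₀ (2 * r), |w x| ^ p := by
      rw [setAverage_eq, smul_eq_mul]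
      congr 1
      refine integral_congr_ae (ae_restrict_of_ae ?_)
      filter_upwards [huw] with x hx
      rw [hx]
    have hV0 : 0 < volume.real (Metric.ball x₀ (2 * r)) := by
      rw [volume_real_ball x₀ (by positivity)]; positivity
    rw [eT, eA]
    obtain ⟨T, hT⟩ : ∃ T, T = r ^ (s * p) * tailIntegral n s p (fun x => |w x|) x₀ r := ⟨_, rfl⟩
    obtain ⟨a, ha⟩ : ∃ a, a = (volume.real (Metric.ball x₀ (2 * r)))⁻¹ *
      ∫ x in Metric.ball x₀ (2 * r), |w x| ^ p := ⟨_, rfl⟩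
    have hT0 : 0 ≤ T := by
      rw [hT]
      exact mul_nonneg (by positivity) (integral_nonneg fun x => by positivity)
    have ha0 : 0 ≤ a := by
      rw [ha]
      exact mul_nonneg (by positivity) (hIball _ _)
    rw [← hT, ← ha]
    have hT1 : 0 ≤ T ^ (1 / (p - 1)) := by positivity
    have ha1 : 0 ≤ a ^ (1 / p) := by positivity
    have hcρ : 0 < c * (ρ / r) ^ α := by positivity
    -- the decay lemma needs a positive bound, so an arbitrarily small amount is added
    refine EReal.le_of_forall_lt_iff_le.1 fun z hz => ?_
    have hz' := EReal.coe_lt_coe_iff.1 hz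
    obtain ⟨X, hX⟩ : ∃ X, X = z / (c * (ρ / r) ^ α) := ⟨_, rfl⟩
    have hX1 : T ^ (1 / (p - 1)) + a ^ (1 / p) < X := by
      rw [hX, lt_div_iff₀ hcρ]; linarith
    have hX0 : 0 < X := by linarith
    obtain ⟨-, hosc⟩ := hdec x₀ r X hr hX0 hball (by
        rw [← hT]
        refine le_trans (le_of_eq ?_) (Real.rpow_le_rpow hT1 (by linarith : _ ≤ X) hp1.le)
        rw [← Real.rpow_mul hT0, one_div, inv_mul_cancel₀ hp1.ne', Real.rpow_one]) (by
        have h1 := Real.rpow_le_rpow ha1 (by linarith : _ ≤ X) hp0.le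
        rw [← Real.rpow_mul ha0, one_div, inv_mul_cancel₀ hp0.ne', Real.rpow_one, ha,
          inv_mul_eq_div, div_le_iff₀ hV0] at h1
        exact h1)
    obtain ⟨m, M, hMm, hm, hM⟩ := hosc ρ hρ hρr
    have hzX : c * (ρ / r) ^ α * X = z := by
      rw [hX]; field_simp
    rw [hzX] at hMm
    refine (essOsc_le (m := m) (M := M) ?_ ?_).trans (EReal.coe_le_coe_iff.2 hMm)
    · filter_upwards [hm, huw] with x h1 h2 hx
      rw [h2]; exact h1 hx
    · filter_upwards [hM, huw] with x h1 h2 hx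
      rw [h2]; exact h1 hx
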